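/- Let $K$ be a field and let $T$ be the front of a bordered Legendrian graph with $\mathbb Z$-valued Maslov potential $\mu$, in \emph{normal form}: read from left to right, $T$ starts with $n_L$ strands (the left border $T_L$), followed by finitely many left cusps, crossings and right cusps, where every right cusp carries a basepoint and there are no other basepoints; at the right end the topmost strands run, in consecutive groups, into the vertices (so each vertex $v$ is of type $(\mathrm{val}(v),0)$ and lies above the right border), and the remaining $n_R$ strands form the right border $T_R$. The upper strand at a cusp has potential one more than the lower one. **The DGAs.** For $m\ge1$ let $T^{(m)}$ be the canonical front $m$-copy ($m$ copies of $T$ pushed off in the $z$-direction, copy $1$ on top) and let $A^{(m)}=(A^{(m)},\partial^{(m)})$ be its Chekanov–Eliashberg DGA over $K$, computed in Ng's resolution. It is freely generated by * the left border chords $k_{PQ}$ for strands $P<Q$ (numbered from the top) of $T_L^{(m)}$, $|k_{PQ}|=\mu(P)-\mu(Q)-1$, $\partial k_{PQ}=\sum_{P<R<Q}(-1)^{|k_{PR}|-1}k_{PR}k_{RQ}$; * the crossings of $T^{(m)}$, the kinks of its right cusps, and the crossings of the half twists that the resolution introduces in front of the vertices; their degree is the difference of the potentials of the two strands (upper minus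 lower, on the left of the crossing), and is $1$ for a kink; their differential counts admissible disks with sign; * the generators $\xi_{a,\ell}$ ($a\in\mathbb Z/n$, $\ell\ge1$) of the internal DGA at each $n$-valent vertex, basepoints counting as bivalent vertices, with $|\xi_{a,\ell}|=\mu(a)-\mu(a+\ell)+N-1$, where $N$ is twice the number of passages from the last to the first half edge, and $\partial\xi_{a,\ell}=\delta_{\ell,n}+\sum_{\ell_1+\ell_2=\ell}(-1)^{|\xi_{a,\ell_1}|-1}\xi_{a,\ell_1}\xi_{a+\ell_1,\ell_2}$. The signed count of disks is the following. For strands $P<Q$ over a generic vertical line let $g_{PQ}\in A^{(m)}$ be the count of half disks to the left of the line whose right boundary is the segment from $P$ to $Q$. On the left border $g_{PQ}=k_{PQ}$. A left cusp adds two strands with $g=1$ between them and $g=0$ between them and the others. A crossing $c$ of the strands $k,k+1$ has $\partial c=g_{k,k+1}$ and changes $g$ into $g'$, with $g'_{k,k+1}=0$, $g'_{i,k}=g_{i,k+1}+g_{i,k}c$, $g'_{i,k+1}=g_{i,k}$ for $i<k$, $g'_{k,j}=g_{k+1,j}$, $g'_{k+1,j}=g_{k,j}-(-1)^{|c|}c\,g_{k+1,j}$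 for $j>k+1$, and the other entries unchanged. A right cusp of the strands $k,k+1$, with kink $c$ and basepoint generators $b_{a,\ell}$, $a\in\{1,2\}$, has $\partial c=b_{1,1}+g_{k,k+1}$, deletes the two strands and, with $R_i=g_{i,k+1}+g_{i,k}c$ and $L_j=g_{k,j}+c\,g_{k+1,j}$, adds $R_ib_{2,1}L_j+g_{i,k}b_{1,2}L_j+R_ib_{2,2}g_{k+1,j}+g_{i,k}b_{1,3}g_{k+1,j}$ to $g_{ij}$ for $i<k$, $j>k+1$. At an $n$-valent vertex with generators $v_{a,\ell}$, the half-twist crossings $t_{ab}$, $a<b$, of the $n$ strands entering it satisfy $$\partial t_{ab}=(-1)^{|t_{ab}|-1}v_{a,b-a}+g_{ab}+\sum_{a<c<b}\bigl((-1)^{|t_{ab}|-1}t_{ac}v_{c,b-c}+g_{ac}t_{cb}\bigr).$$ Similarly $A_L^{(m)}$ and $A_R^{(m)}$ are the DGAs of the borders, generated by border chords only; the structure morphisms $\phi_L^{(m)}:A_L^{(m)}\to A^{(m)}$ and $\phi_R^{(m)}:A_R^{(m)}\to A^{(m)}$ are the inclusion and $k_{PQ}\mapsto(-1)^{|k_{PQ}|+1}g_{PQ}$,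 with $g$ taken at the right border. **The augmentation category.** Write $s^{ij}$ for the generators starting on copy $i$ and ending on copy $j$, and let $S^{12}$ be the finite set of generators of $A^{(2)}$ from copy $1$ to copy $2$. Objects of $\mathrm{Aug}_+(T,\mu;K)$ are augmentations $\epsilon:A^{(1)}\to K$ (morphisms of graded algebras, $K$ in degree $0$, with $\epsilon\circ\partial=0$); $\hom(\epsilon,\epsilon')=(K\langle S^{12}\rangle)^\vee$ with $|s^\vee|=|s|+1$. For objects $\epsilon_1,\dots,\epsilon_{k+1}$ let $\mathbf e$ be the diagonal augmentation of $A^{(k+1)}$, equal to $\epsilon_i$ on copy $i$ and $0$ on generators between different copies, let $\phi_{\mathbf e}(s)=s+\mathbf e(s)$ and $\partial_{\mathbf e}=\phi_{\mathbf e}\partial^{(k+1)}\phi_{\mathbf e}^{-1}$. The operation $m_k:\hom(\epsilon_k,\epsilon_{k+1})\otimes\cdots\otimes\hom(\epsilon_1,\epsilon_2)\to\hom(\epsilon_1,\epsilon_{k+1})$ is $$m_k(s_k^\vee\otimes\cdots\otimes s_1^\vee)=\sum_{s\in S^{12}}(-1)^{\sigma}\,\bigl[\text{coefficient of } s_1^{12}s_2^{23}\cdots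 s_k^{k,k+1}\text{ in }\partial_{\mathbf e}s^{1,k+1}\bigr]\;s^\vee,$$ $$\sigma=\tfrac{k(k-1)}2+\sum_{p<q}|s_p^\vee||s_q^\vee|+\sum_{p}(k-p)|s_p^\vee|.$$ The border restriction functors $F_*:\mathrm{Aug}_+(T,\mu;K)\to\mathrm{Aug}_+(T_*,\mu_*;K)$, $*=L,R$, are $\epsilon\mapsto\epsilon\circ\phi_*^{(1)}$ on objects, and $F_*^k$ is given by the same formula with $\phi_{\mathbf e}(\phi_*^{(k+1)}(s^{1,k+1}))$ in place of $\partial_{\mathbf e}s^{1,k+1}$ and $s$ ranging over the chords of $T_*$. For every edge $e$ of $T$ (they correspond to the left cusps and the strands of the left border) let $y_e\in S^{12}$ be the crossing between copies $1$ and $2$ next to the left cusp, respectively the border chord from copy $1$ to copy $2$ of the strand. The edges of $T_L$, $T_R$ are their strands. **Theorem.** For each of $T$, $T_L$ and $T_R$, the augmentation category is strictly unital, and for every object $\epsilon$ the unit in $\hom(\epsilon,\epsilon)$ is $u=-\sum_e y_e^\vee$, the sum over all edges: $u$ has degree $0$, $m_2(a\otimes u)=a$ and $m_2(u\otimes a)=a$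 for all morphisms $a$ out of, respectively into, $\epsilon$, and for $k\ne2$, $m_k(a_k\otimes\cdots\otimes a_1)=0$ whenever some $a_p$ is a unit. Moreover both border restriction functors $F_L$, $F_R$ are defined on objects and preserve the units: $F_*^1(u)=u_*$, where $u_*$ is the unit for $T_*$, and $F_*^k(a_k\otimes\cdots\otimes a_1)=0$ for $k\ge2$ whenever some $a_p$ is a unit. -/

import Mathlib

noncomputable section

namespace LegendrianGraph

/-! ## Fronts of bordered Legendrian graphs in normal form

A generic front over an interval is read from left to right as a word of elementary slices.
Strands are numbered `0, 1, 2, …` from the top. -/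

/-- The strands of a front over a generic vertical line: `mu P` is the Maslov potential of
the strand `P`, for `P < n`. -/
structure Strands where
  n : ℕ
  mu : ℕ → ℤ

/-- Elementary slices: a left cusp creating the strands `k`, `k+1` of potentials `d`, `d-1`;
a crossing of the strands `k`, `k+1`; a right cusp, carrying a basepoint, joining the strands
`k`, `k+1`. -/
inductive Slice
  | leftCusp (k : ℕ) (d : ℤ)
  | crossing (k : ℕ)
  | rightCusp (k : ℕ)

/-- A slice can be put to the right of the given strands. -/
def Slice.Fits : Slice → Strands → Prop
  | .leftCusp k _, S => k ≤ S.n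
  | .crossing k, S => k + 1 < S.n
  | .rightCusp k, S => k + 1 < S.n ∧ S.mu k = S.mu (k + 1) + 1

/-- The strands to the right of a slice. -/
def Slice.act : Slice → Strands → Strands
  | .leftCusp k d, S =>
      ⟨S.n + 2, fun x => if x < k then S.mu x else if x = k then d
        else if x = k + 1 then d - 1 else S.mu (x - 2)⟩
  | .crossing k, S => ⟨S.n, fun x => S.mu (Equiv.swap k (k + 1) x)⟩
  | .rightCusp k, S => ⟨S.n - 2, fun x => if x < k then S.mu x else S.mu (x + 2)⟩

/-- Every slice of the word fits. -/
def Slice.AllFit : List Slice → Strands → Prop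
  | [], _ => True
  | s :: l, S => s.Fits S ∧ Slice.AllFit l (s.act S)

/-- The strands at the right end of a word of slices. -/
def Slice.actAll (l : List Slice) (S : Strands) : Strands := l.foldl (fun S s => s.act S) S

/-- A front, with Maslov potential, of a bordered Legendrian graph in normal form. Its strands
at the left border are `left`; then come left cusps, crossings and right cusps with basepoints
(`slices`); at the right end the topmost `vals.sum` strands run into vertices, the first vertex
(of valency the first entry of `vals`) taking the topmost strands and so on, and the remaining
strands form the right border. -/
structure NormalFront where
  left : Strands
  slices : List Slice
  vals : List ℕ
  fit : Slice.AllFit slices left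
  vals_pos : ∀ n ∈ vals, 1 ≤ n
  vals_le : vals.sum ≤ (Slice.actAll slices left).n

/-- The trivial front, that is, parallel strands. -/
def Strands.trivialFront (S : Strands) : NormalFront where
  left := S
  slices := []
  vals := []
  fit := trivial
  vals_pos := by simp
  vals_le := by simp

/-- The left border of a front. -/
def NormalFront.leftBorder (T : NormalFront) : NormalFront := T.left.trivialFront

/-- The right border of a front. -/
def NormalFront.rightBorder (T : NormalFront) : NormalFront :=
  Strands.trivialFront
    ⟨(Slice.actAll T.slices T.left).n - T.vals.sum,
      fun x => (Slice.actAll T.slices T.left).mu (T.vals.sum + x)⟩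

/-! ## Generators -/

/-- Names of the generators of the DGAs of the front copies `T^(m)`. The copies are numbered
`0, …, m-1` from the top; a name contains the copies `i`, `j` of its two ends. Slices of `T` are
numbered by `s`, vertices by `p`.

* `k a b i j`: Reeb chord over the left border, from strand `a` of copy `i` to strand `b` of
  copy `j`; in particular `k a a i j` is the generator attached to the edge starting at the
  left border strand `a`.
* `y s i j`: crossing of the copies `i < j` next to the left cusp `s`; this is the generator
  attached to the edge starting at that cusp.
* `c s i j`: if `s` is a crossing, its copy between copy `i` of the upper and copy `j` of the
  lower strand (to the left of the crossing); if `s` is a right cusp, the crossing (in Ng's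
  resolution) of copies `i ≥ j`, the one with `i = j` being the kink of the cusp of copy `i`.
* `b s i a l`: generators of the internal DGA of the basepoint on the right cusp `s` in copy `i`.
* `t p a b i j`: crossings near the vertex `p` of the half edge `a` of copy `i` with the half
  edge `b` of copy `j`, where `a < b` and `i ≥ j`; those with `i = j` form the half twist in Ng's
  resolution of copy `i` of the vertex.
* `v p i a l`: generators of the internal DGA of copy `i` of the vertex `p`. -/
inductive Gen
  | k (a b i j : ℕ)
  | y (s i j : ℕ)
  | c (s i j : ℕ)
  | b (s i a l : ℕ)
  | t (p a b i j : ℕ)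
  | v (p i a l : ℕ)
  deriving DecidableEq

instance : Inhabited Gen := ⟨.k 0 0 0 0⟩

/-- The copy in which a generator starts. -/
def Gen.row : Gen → ℕ
  | .k _ _ i _ => i
  | .y _ i _ => i
  | .c _ i _ => i
  | .b _ i _ _ => i
  | .t _ _ _ i _ => i
  | .v _ i _ _ => i

/-- The copy in which a generator ends. -/
def Gen.col : Gen → ℕ
  | .k _ _ _ j => j
  | .y _ _ j => j
  | .c _ _ j => j
  | .b _ i _ _ => i
  | .t _ _ _ _ j => j
  | .v _ i _ _ => i

/-- Renaming of the copies. -/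
def Gen.relabel (f : ℕ → ℕ) : Gen → Gen
  | .k α β i j => .k α β (f i) (f j)
  | .y s i j => .y s (f i) (f j)
  | .c s i j => .c s (f i) (f j)
  | .b s i a l => .b s (f i) a l
  | .t p α β i j => .t p α β (f i) (f j)
  | .v p i a l => .v p (f i) a l

/-- The generator with the same underlying chord, from copy `p` to copy `q`; for a generator
from copy `0` to copy `1`. -/
def Gen.move (p q : ℕ) : Gen → Gen := Gen.relabel (fun i => if i = 0 then p else q)

/-- The chord from strand `P` to strand `Q` over the left border of an `m`-copy, where copy `i`
of the strand `a` is the strand `a * m + i`. -/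
def Gen.border (m P Q : ℕ) : Gen := .k (P / m) (Q / m) (P % m) (Q % m)

/-! ## Canonical front copies -/

/-- Slices whose new generators have been named: `cross k x` is a crossing with name `x`,
`rightCusp k s i` produces the kink `c s i i` and the basepoint generators `b s i _ _`, and
`vertex n p i` ends the topmost `n` strands in a vertex with generators `t p _ _ i i` and
`v p i _ _`. -/
inductive NamedSlice
  | leftCusp (k : ℕ) (d : ℤ)
  | cross (k : ℕ) (x : Gen)
  | rightCusp (k s i : ℕ)
  | vertex (n p i : ℕ)

/-- The `m`-copy of the `s`-th slice: the front is replaced by `m` copies, pushed off in the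
`z`-direction, the copy `0` being the top one. -/
def Slice.copies (m s : ℕ) : Slice → List NamedSlice
  | .leftCusp k d =>
      (List.range m).map (fun i => .leftCusp (k * m + 2 * i) d) ++
      (List.range m).flatMap fun j => (List.range j).map fun t =>
        .cross (k * m + (2 * j - 1 - t)) (.y s (j - 1 - t) j)
  | .crossing k =>
      (List.range m).flatMap fun j => (List.range m).map fun t =>
        .cross (k * m + (m + j - 1 - t)) (.c s (m - 1 - t) j)
  | .rightCusp k =>
      ((List.range m).flatMap fun i => (List.range (m - 1 - i)).map fun t =>
        .cross (k * m + (i + m - 1 - t)) (.c s (m - 1 - t) i)) ++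
      (List.range m).map fun i => .rightCusp (k * m) s i

/-- The `m`-copy of the `p`-th vertex, of valency `n`, whose half edges are the topmost ones. -/
def vertexCopies (m n p : ℕ) : List NamedSlice :=
  ((List.range m).reverse.flatMap fun j => (List.range n).reverse.flatMap fun a =>
    (List.range ((n - 1 - a) * j)).map fun u =>
      .cross (a * (j + 1) + j + u) (.t p a (a + 1 + u / j) j (u % j))) ++
  (List.range m).map fun i => .vertex n p i

/-- The canonical front `m`-copy of `T` as a word of named slices. -/
def NormalFront.copies (T : NormalFront) (m : ℕ) : List NamedSlice :=
  (T.slices.zipIdx.flatMap fun s => s.1.copies m s.2) ++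
    T.vals.zipIdx.flatMap fun v => vertexCopies m v.1 v.2

/-! ## The Chekanov--Eliashberg DGA -/

variable (K : Type*) [Field K]

/-- A free graded algebra with a differential, on a set of named generators: `deg` and `dif` give
the degree and the differential of the generators, and have no meaning elsewhere. The differential
extends to the free algebra by linearity and the graded Leibniz rule
`∂(xy) = ∂x · y + (-1)^|x| x · ∂y`. -/
structure FreeDGA where
  gens : Set Gen
  deg : Gen → ℤ
  dif : Gen → FreeAlgebra K Gen

/-- The sign `(-1)^z`. -/
def sg (z : ℤ) : K := if Even z then 1 else -1

variable {K}

/-- A generator as an element of the free algebra. -/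
abbrev gen (x : Gen) : FreeAlgebra K Gen := FreeAlgebra.ι K x

variable (K)

/-- The DGA `toFreeDGA` of the part of a front to the left of a vertical line, together with, for
each two strands `a < b` met by this line, the signed count `g a b` of the half disks whose right
boundary lies on this line between `a` and `b`. -/
structure FrontState extends FreeDGA K where
  strands : Strands
  g : ℕ → ℕ → FreeAlgebra K Gen

/-- The left border of the `m`-copy of the strands `S`, with the border DGA: the chords `k_{PQ}`,
for `P < Q`, with `|k_{PQ}| = μ(P) - μ(Q) - 1` and
`∂ k_{PQ} = ∑_{P<R<Q} (-1)^{|k_{PR}|-1} k_{PR} k_{RQ}`. -/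
def FrontState.init (S : Strands) (m : ℕ) : FrontState K where
  gens := {x | ∃ a b i j, x = .k a b i j ∧ i < m ∧ j < m ∧ b < S.n ∧ a * m + i < b * m + j}
  deg
    | .k a b _ _ => S.mu a - S.mu b - 1
    | _ => 0
  dif
    | .k a b i j => ∑ R ∈ Finset.Ioo (a * m + i) (b * m + j),
        sg K (S.mu a - S.mu (R / m)) •
          (gen (.border m (a * m + i) R) * gen (.border m R (b * m + j)))
    | _ => 0
  strands := ⟨S.n * m, fun P => S.mu (P / m)⟩
  g P Q := if P < Q ∧ Q < S.n * m then gen (.border m P Q) else 0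

/-- The generators `ξ_{a,l}`, for `a < n` and `1 ≤ l`, of the internal DGA of an `n`-valent vertex
with half edges of potentials `mu 0, …, mu (n-1)` have degree `μ(a) - μ(a+l) + N - 1`, where `a+l`
is taken modulo `n` and `N` is twice the number of passages from half edge `n-1` to `0`. -/
def internalDeg (n : ℕ) (mu : ℕ → ℤ) (a l : ℕ) : ℤ :=
  mu a - mu ((a + l) % n) + 2 * ((a + l) / n : ℕ) - 1

/-- The differential in the internal DGA of a vertex,
`∂ ξ_{a,l} = δ_{l,n} + ∑_{l₁+l₂=l} (-1)^{|ξ_{a,l₁}|-1} ξ_{a,l₁} ξ_{a+l₁,l₂}`. -/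
def internalDif (n : ℕ) (mu : ℕ → ℤ) (xi : ℕ → ℕ → Gen) (a l : ℕ) : FreeAlgebra K Gen :=
  (if l = n then 1 else 0) + ∑ l₁ ∈ Finset.Ioo 0 l,
    sg K (internalDeg n mu a l₁ - 1) • (gen (xi a l₁) * gen (xi ((a + l₁) % n) (l - l₁)))

variable {K}

/-- A left cusp: the region between its two branches is a half disk without further corners. -/
def FrontState.leftCusp (F : FrontState K) (k : ℕ) (d : ℤ) : FrontState K where
  toFreeDGA := F.toFreeDGA
  strands := (Slice.leftCusp k d).act F.strands
  g a b :=
    if a = k ∧ b = k + 1 then 1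
    else if a = k ∨ a = k + 1 ∨ b = k ∨ b = k + 1 then 0
    else F.g (if a < k then a else a - 2) (if b < k then b else b - 2)

/-- A crossing named `x`: its differential counts the half disks ending there; half disks pass
the crossing or turn a convex corner at it. -/
def FrontState.cross (F : FrontState K) (k : ℕ) (x : Gen) : FrontState K where
  gens := insert x F.gens
  deg := Function.update F.deg x (F.strands.mu k - F.strands.mu (k + 1))
  dif := Function.update F.dif x (F.g k (k + 1))
  strands := (Slice.crossing k).act F.strands
  g a b :=
    if a = k ∧ b = k + 1 then 0
    else if b = k ∧ a < k then F.g a (k + 1) + F.g a k * gen x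
    else if b = k + 1 ∧ a < k then F.g a k
    else if a = k ∧ k + 1 < b then F.g (k + 1) b
    else if a = k + 1 ∧ k + 1 < b then
      F.g k b - sg K (F.strands.mu k - F.strands.mu (k + 1)) • (gen x * F.g (k + 1) b)
    else F.g a b

/-- A right cusp with a basepoint: in Ng's resolution there are a kink `x = c s i i` and, to its
right, the basepoint, a bivalent vertex with half edges `0` (upper) and `1` (lower) of potentials
`1` and `0`, and generators `b a l = b s i a l`. The half disks passing the cusp have a convex
corner at the basepoint and reach the two branches around the kink. -/
def FrontState.rightCusp (F : FrontState K) (k s i : ℕ) : FrontState K where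
  gens := insert (.c s i i) F.gens ∪ {z | ∃ a l, z = .b s i a l ∧ a < 2 ∧ 1 ≤ l}
  deg z := match z with
    | .b s' i' a l => if s' = s ∧ i' = i then internalDeg 2 (fun h => if h = 0 then 1 else 0) a l
        else F.deg z
    | z => if z = .c s i i then 1 else F.deg z
  dif z := match z with
    | .b s' i' a l => if s' = s ∧ i' = i then
        internalDif K 2 (fun h => if h = 0 then 1 else 0) (Gen.b s i) a l else F.dif z
    | z => if z = .c s i i then gen (.b s i 0 1) + F.g k (k + 1) else F.dif z
  strands := (Slice.rightCusp k).act F.strands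
  g a b :=
    if a < k ∧ k ≤ b then
      let x : FreeAlgebra K Gen := gen (.c s i i)
      let β : ℕ → ℕ → FreeAlgebra K Gen := fun h l => gen (.b s i h l)
      let B := b + 2
      let R := F.g a (k + 1) + F.g a k * x
      let L := F.g k B + x * F.g (k + 1) B
      F.g a B + R * β 1 1 * L + F.g a k * β 0 2 * L + R * β 1 2 * F.g (k + 1) B
        + F.g a k * β 0 3 * F.g (k + 1) B
    else F.g (if a < k then a else a + 2) (if b < k then b else b + 2)

/-- A vertex, of type `(n, 0)`, ending the topmost `n` strands: in Ng's resolution there is a half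
twist with crossings `t a b = t p a b i i`, for `a < b`, to the left of the vertex, and
`∂ t_{ab} = (-1)^{|t_{ab}|-1} v_{ab} + g_{ab}
  + ∑_{a<c<b} ((-1)^{|t_{ab}|-1} t_{ac} v_{cb} + g_{ac} t_{cb})`,
where `v_{ab} = v_{a,b-a}`. -/
def FrontState.vertex (F : FrontState K) (n p i : ℕ) : FrontState K where
  gens := F.gens ∪ {z | ∃ a l, z = .v p i a l ∧ a < n ∧ 1 ≤ l} ∪
    {z | ∃ a b, z = .t p a b i i ∧ a < b ∧ b < n}
  deg z := match z with
    | .v p' i' a l => if p' = p ∧ i' = i then internalDeg n F.strands.mu a l else F.deg z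
    | .t p' a b i' j' => if p' = p ∧ i' = i ∧ j' = i then F.strands.mu a - F.strands.mu b
        else F.deg z
    | z => F.deg z
  dif z := match z with
    | .v p' i' a l => if p' = p ∧ i' = i then internalDif K n F.strands.mu (Gen.v p i) a l
        else F.dif z
    | .t p' a b i' j' => if p' = p ∧ i' = i ∧ j' = i then
        let ε : K := sg K (F.strands.mu a - F.strands.mu b - 1)
        ε • gen (.v p i a (b - a)) + F.g a b + ∑ c ∈ Finset.Ioo a b,
          (ε • (gen (.t p a c i i) * gen (.v p i c (b - c))) + F.g a c * gen (.t p c b i i))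
        else F.dif z
    | z => F.dif z
  strands := ⟨F.strands.n - n, fun x => F.strands.mu (x + n)⟩
  g a b := F.g (a + n) (b + n)

/-- Adding one slice on the right. -/
def FrontState.step (F : FrontState K) : NamedSlice → FrontState K
  | .leftCusp k d => F.leftCusp k d
  | .cross k x => F.cross k x
  | .rightCusp k s i => F.rightCusp k s i
  | .vertex n p i => F.vertex n p i

variable (K)

/-- The state at the right border of the canonical front `m`-copy of `T`. -/
def NormalFront.state (T : NormalFront) (m : ℕ) : FrontState K :=
  (T.copies m).foldl FrontState.step (FrontState.init K T.left m)

/-- The Chekanov--Eliashberg DGA of the canonical front `m`-copy of `T`. -/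
def NormalFront.ce (T : NormalFront) (m : ℕ) : FreeDGA K := (T.state K m).toFreeDGA

/-- The structure morphism `φ_L^(m)` from the DGA of the left border, the inclusion. -/
def NormalFront.phiLeft (_T : NormalFront) (_m : ℕ) (x : Gen) : FreeAlgebra K Gen := gen x

/-- The structure morphism `φ_R^(m)` from the DGA of the right border,
`k_{PQ} ↦ (-1)^{|k_{PQ}|+1} g_{PQ}`. -/
def NormalFront.phiRight (T : NormalFront) (m : ℕ) : Gen → FreeAlgebra K Gen
  | .k a b i j =>
      sg K ((T.state K m).strands.mu (a * m + i) - (T.state K m).strands.mu (b * m + j)) •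
        (T.state K m).g (a * m + i) (b * m + j)
  | _ => 0

/-! ## The augmentation category -/

/-- `ε`, given by its values on generators, is an augmentation of the DGA of `T`: a morphism of
graded algebras to `K`, which sits in degree `0`, with `ε ∘ ∂ = 0`. (Names of generators that do
not occur in the DGA have value `0`; by the Leibniz rule, `ε ∘ ∂ = 0` is a condition on
generators.) -/
def NormalFront.IsAugmentation (T : NormalFront) (ε : Gen → K) : Prop :=
  (∀ x, ε x ≠ 0 → x ∈ (T.ce K 1).gens ∧ (T.ce K 1).deg x = 0) ∧
    ∀ x ∈ (T.ce K 1).gens, FreeAlgebra.lift K ε ((T.ce K 1).dif x) = 0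

/-- The objects of the augmentation category. -/
def NormalFront.Ob (T : NormalFront) : Type _ := {ε : Gen → K // T.IsAugmentation K ε}

/-- The set `S^{12}` of generators of the DGA of the `2`-copy going from the first to the second
copy. -/
def NormalFront.chords (T : NormalFront) : Set Gen :=
  {x | x ∈ (T.ce K 2).gens ∧ x.row = 0 ∧ x.col = 1}

/-- The morphism spaces `hom(ε₁, ε₂)` of the augmentation category, the dual of the vector space
spanned by `S^{12}`; it does not depend on the objects. -/
abbrev NormalFront.Hom (T : NormalFront) : Type _ := T.chords K → K

/-- The degree `|s^∨| = |s| + 1` of the dual of a chord. -/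
def NormalFront.homDeg (T : NormalFront) (s : Gen) : ℤ := (T.ce K 2).deg s + 1

open Classical in
/-- The value of a morphism at a chord. -/
def NormalFront.evalHom (T : NormalFront) (a : T.Hom K) (s : Gen) : K :=
  if h : s ∈ T.chords K then a ⟨s, h⟩ else 0

/-- The exponent of the sign in `m_k`, for morphisms `a p` from the `p`-th to the `(p+1)`-st object
of degrees `d p`. -/
def sigma (k : ℕ) (d : Fin k → ℤ) : ℤ :=
  (k.choose 2 : ℤ) + ∑ p, ∑ q ∈ Finset.Ioi p, d p * d q + ∑ p : Fin k, ((k : ℤ) - 1 - p) * d p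

open Classical in
/-- The signed pairing of morphisms `a 0, …, a (k-1)` with a word: it is zero unless the word is of
the form `s₀^{01} s₁^{12} ⋯ s_{k-1}^{k-1,k}` for chords `s p`, and is then the product of the
values `a p (s p)`, up to the sign. -/
def NormalFront.pairWord (T : NormalFront) {k : ℕ} (a : Fin k → T.Hom K) (w : List Gen) : K :=
  if w.length = k ∧ ∀ p : Fin k, (w.getD p default).row = p ∧ (w.getD p default).col = p + 1 then
    let s : Fin k → Gen := fun p => (w.getD p default).relabel (fun i => i - p)
    sg K (sigma k fun p => T.homDeg K (s p)) * ∏ p, T.evalHom K (a p) (s p)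
  else 0

/-- The linear extension of `pairWord` to the free algebra. -/
def NormalFront.pair (T : NormalFront) {k : ℕ} (a : Fin k → T.Hom K) (x : FreeAlgebra K Gen) : K :=
  (FreeAlgebra.equivMonoidAlgebraFreeMonoid x).coeff.sum fun w c =>
    c * T.pairWord K a w.toList

/-- The value at `x` of the diagonal augmentation of the DGA of the `(k+1)`-copy given by the
augmentations `e 0, …, e k`: it is `e i` on the generators of copy `i`, and zero on the generators
between different copies. -/
def diagonalAug {k : ℕ} (e : Fin (k + 1) → Gen → K) (x : Gen) : K :=
  if h : x.row < k + 1 then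
    if x.row = x.col then e ⟨x.row, h⟩ (x.relabel fun _ => 0) else 0
  else 0

/-- The automorphism `φ_e : x ↦ x + e(x)` for the diagonal augmentation given by `e`. -/
def twist {k : ℕ} (e : Fin (k + 1) → Gen → K) : FreeAlgebra K Gen →ₐ[K] FreeAlgebra K Gen :=
  FreeAlgebra.lift K fun x => gen x + algebraMap K (FreeAlgebra K Gen) (diagonalAug K e x)

/-- The operation `m_k : hom(e_{k-1}, e_k) ⊗ ⋯ ⊗ hom(e_0, e_1) → hom(e_0, e_k)` applied to
`a (k-1) ⊗ ⋯ ⊗ a 0`: the coefficient at `s` is obtained by pairing with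
`(φ_e ∘ ∂ ∘ φ_e⁻¹) s^{0k} = φ_e (∂ s^{0k})` in the `(k+1)`-copy. -/
def NormalFront.m (T : NormalFront) {k : ℕ} (e : Fin (k + 1) → T.Ob K) (a : Fin k → T.Hom K) :
    T.Hom K := fun s =>
  T.pair K a (twist K (fun i => (e i).1) ((T.ce K (k + 1)).dif (s.1.move 0 k)))

/-- The element `-∑_e y_e^∨` of `hom(ε, ε)`, the sum over all edges. -/
def NormalFront.negY (T : NormalFront) : T.Hom K := fun s =>
  match s.1 with
  | .k a b _ _ => if a = b then -1 else 0
  | .y _ _ _ => -1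
  | _ => 0

/-- The morphism `u`, seen in `hom(ε, ε)` for every object `ε`, is a strict unit of the augmentation
category of `T`: it has degree `0`, it is a two-sided unit for `m_2`, and the other operations
vanish as soon as one of their arguments is `u`. -/
def NormalFront.IsStrictUnit (T : NormalFront) (u : T.Hom K) : Prop :=
  (∀ s, u s ≠ 0 → T.homDeg K s = 0) ∧
  (∀ (ε₀ ε₁ : T.Ob K) (a : T.Hom K),
    T.m K ![ε₀, ε₀, ε₁] ![u, a] = a ∧ T.m K ![ε₀, ε₁, ε₁] ![a, u] = a) ∧
  ∀ (k : ℕ) (e : Fin (k + 1) → T.Ob K) (a : Fin k → T.Hom K) (p : Fin k), k ≠ 2 →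
    e p.castSucc = e p.succ → a p = u → T.m K e a = 0

open Classical in
/-- The pullback of an augmentation of `T` to `T'` along a morphism given on the generators of the
DGA of `T'` by `f`. -/
def NormalFront.pullback (_T T' : NormalFront) (f : Gen → FreeAlgebra K Gen) (ε : Gen → K) :
    Gen → K :=
  fun x => if x ∈ (T'.ce K 1).gens then FreeAlgebra.lift K ε (f x) else 0

/-- The component `F^k` of the functor from the augmentation category of `T` to that of `T'`
induced by the morphisms `f m` from the DGA of the `m`-copy of `T'` to that of `T`: the coefficient
of `F^k (a (k-1) ⊗ ⋯ ⊗ a 0)` at `s` is obtained by pairing with `(φ_e ∘ f) s^{0k}`. -/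
def NormalFront.functorMap (T T' : NormalFront) (f : ℕ → Gen → FreeAlgebra K Gen) {k : ℕ}
    (e : Fin (k + 1) → T.Ob K) (a : Fin k → T.Hom K) : T'.Hom K := fun s =>
  T.pair K a (twist K (fun i => (e i).1) (f (k + 1) (s.1.move 0 k)))

/-- The functor induced by the morphisms `f m` is defined on objects and strictly preserves the
given units: `F^1(u) = u'`, and `F^k` vanishes for `k ≥ 2` as soon as one of its arguments is
`u`. -/
def NormalFront.PreservesUnit (T T' : NormalFront) (f : ℕ → Gen → FreeAlgebra K Gen)
    (u : T.Hom K) (u' : T'.Hom K) : Prop :=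
  (∀ ε : T.Ob K, T'.IsAugmentation K (T.pullback K T' (f 1) ε.1)) ∧
  (∀ ε : T.Ob K, T.functorMap K T' f ![ε, ε] ![u] = u') ∧
  ∀ (k : ℕ) (e : Fin (k + 1) → T.Ob K) (a : Fin k → T.Hom K) (p : Fin k), 2 ≤ k →
    e p.castSucc = e p.succ → a p = u → T.functorMap K T' f e a = 0

end LegendrianGraph

end

noncomputable section

namespace LegendrianGraph

/-! ## Pairing words with morphisms -/

/-! The `p`-th argument of an operation pairs with the letter from copy `p` to copy `p + 1` of a
word in ∂s^{0,k}, where copies are numbered from `0`. If that argument is the unit, the letter must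
be an edge generator. Moreover a contributing word climbs one copy at a time, so no letter skips a
copy, and letters inside one copy matter only through their augmentation values. Hence three kinds
of generators may be set to zero: those skipping a copy, those from `p` to `p + 1` not attached to
an edge, and those inside one copy on which the augmentation vanishes (`Gen.Killed`, `reduce`). The
pairing does not notice this (`pairLin_twist_reduce`).

Modulo these generators the half disks become very simple. A half disk from a copy `i ≤ p` to a copy
`j > p` survives only between two copies of the same strand, with `i = p` and `j = p + 1`, and it is
then the generator of the edge of that strand. This is `Unital`. It holds at the left border and is
preserved by the front copies of left cusps, crossings, right cusps and vertices (`leftCusp_copies`,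
`crossing_copies`, `rightCusp_copies`, `vertexCopies`, assembled in `blockState` and
`tracks_state`).

The differentials follow. Edge generators satisfy ∂y^{ij} = ∑ y^{it} y^{tj} exactly (`ce_edge`). For
any other chord z with end edges x, x', modulo killed generators, ∂z^{ij} is [i = p] x^{p,p+1}
z^{p+1,j} − [j = p+1] (−1)^{|z|} z^{i,p} x'^{p,p+1} (`ce_chord`). For `k > 2` these words are too
short. For `k = 2` exactly one survives and gives back the other argument. For `k = 1` the two terms
contribute the same augmentation value with opposite signs, because source and target agree and
augmentations live in degree `0`.

The left restriction is an inclusion. For the right one, `Unital` at the right border is the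
statement about units. That objects restrict is a separate matter: an augmentation turns the half
disk counts into a strictly upper triangular matrix of square zero (`NilSquare`), on which the
slices act by adding a block, conjugating, eliminating a pair, or passing to a corner. -/

/-- The generators attached to edges. -/
def Gen.IsEdge : Gen → Prop
  | .k α β _ _ => α = β
  | .y _ _ _ => True
  | _ => False

/-- The generators that do not contribute to an operation whose `p`-th argument is the unit: those
which skip a copy, those from copy `p` to copy `p + 1` which are not attached to an edge, and a set
`N` of generators with both ends on the same copy, on which the augmentations vanish. -/
def Gen.Killed (N : Set Gen) (p : ℕ) (z : Gen) : Prop :=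
  z.row + 1 < z.col ∨ (z.row = p ∧ z.col = p + 1 ∧ ¬ z.IsEdge) ∨ z ∈ N

@[simp] lemma Gen.row_relabel (f : ℕ → ℕ) (z : Gen) : (z.relabel f).row = f z.row := by
  cases z <;> rfl

@[simp] lemma Gen.col_relabel (f : ℕ → ℕ) (z : Gen) : (z.relabel f).col = f z.col := by
  cases z <;> rfl

@[simp] lemma Gen.isEdge_relabel (f : ℕ → ℕ) (z : Gen) : (z.relabel f).IsEdge ↔ z.IsEdge := by
  cases z <;> rfl

lemma Gen.relabel_relabel (f g : ℕ → ℕ) (z : Gen) :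
    (z.relabel f).relabel g = z.relabel (g ∘ f) := by
  cases z <;> rfl

lemma Gen.relabel_id {f : ℕ → ℕ} {z : Gen} (h₁ : f z.row = z.row) (h₂ : f z.col = z.col) :
    z.relabel f = z := by
  cases z <;> simp_all [Gen.relabel, Gen.row, Gen.col]

lemma Gen.row_move {z : Gen} (h : z.row = 0) (p q : ℕ) : (z.move p q).row = p := by
  simp [Gen.move, h]

lemma Gen.col_move {z : Gen} (h : z.col = 1) (p q : ℕ) : (z.move p q).col = q := by
  simp [Gen.move, h]

variable {K : Type*} [Field K] {N : Set Gen}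

variable (N) in
open Classical in
/-- The endomorphism of the free algebra which removes the killed generators. -/
def reduce (p : ℕ) : FreeAlgebra K Gen →ₐ[K] FreeAlgebra K Gen :=
  FreeAlgebra.lift K fun z => if z.Killed N p then 0 else gen z

lemma reduce_gen_of_killed {p : ℕ} {z : Gen} (h : z.Killed N p) :
    reduce N p (gen z : FreeAlgebra K Gen) = 0 := by
  simp [reduce, h]

lemma reduce_gen_of_not_killed {p : ℕ} {z : Gen} (h : ¬ z.Killed N p) :
    reduce N p (gen z : FreeAlgebra K Gen) = gen z := by
  simp [reduce, h]

lemma reduce_gen_of_mem {p : ℕ} {z : Gen} (h : z ∈ N) :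
    reduce N p (gen z : FreeAlgebra K Gen) = 0 :=
  reduce_gen_of_killed (.inr (.inr h))

lemma reduce_gen_of_skip {p : ℕ} {z : Gen} (h : z.row + 1 < z.col) :
    reduce N p (gen z : FreeAlgebra K Gen) = 0 :=
  reduce_gen_of_killed (.inl h)

/-- A letter passing from the copies `≤ p` to the copies `> p` either skips a copy or goes exactly
from `p` to `p + 1`. -/
lemma reduce_gen_of_not_isEdge {p : ℕ} {z : Gen} (h : ¬ z.IsEdge) (h₁ : z.row ≤ p)
    (h₂ : p < z.col) : reduce N p (gen z : FreeAlgebra K Gen) = 0 := by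
  apply reduce_gen_of_killed
  by_cases h' : z.row + 1 < z.col
  · exact .inl h'
  · exact .inr (.inl ⟨by omega, by omega, h⟩)

/-- The monomial given by a word. -/
def monomial (K : Type*) [Field K] (w : List Gen) : FreeAlgebra K Gen :=
  (w.map (FreeAlgebra.ι K)).prod

@[simp] lemma monomial_append (w w' : List Gen) :
    monomial K (w ++ w') = monomial K w * monomial K w' := by simp [monomial]

@[simp] lemma monomial_singleton (z : Gen) : monomial K [z] = gen z := by simp [monomial]

lemma monomial_pair (z z' : Gen) : monomial K [z, z'] = gen z * gen z' := by simp [monomial]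

lemma span_monomial : Submodule.span K (Set.range (monomial K)) = ⊤ := by
  rw [eq_top_iff]
  intro x _
  induction x using FreeAlgebra.induction with
  | grade0 r =>
    rw [Algebra.algebraMap_eq_smul_one]
    exact Submodule.smul_mem _ _ (Submodule.subset_span ⟨[], by simp [monomial]⟩)
  | grade1 z => exact Submodule.subset_span ⟨[z], by simp⟩
  | add a b ha hb => exact Submodule.add_mem _ (ha trivial) (hb trivial)
  | mul a b ha hb =>
    have := Submodule.mul_mem_mul (ha trivial) (hb trivial)
    rw [Submodule.span_mul_span] at this
    refine Submodule.span_mono ?_ this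
    rintro _ ⟨_, ⟨w, rfl⟩, _, ⟨w', rfl⟩, rfl⟩
    exact ⟨w ++ w', by simp⟩

lemma equivMonoidAlgebraFreeMonoid_monomial (w : List Gen) :
    FreeAlgebra.equivMonoidAlgebraFreeMonoid (monomial K w)
      = MonoidAlgebra.single (FreeMonoid.ofList w) 1 := by
  induction w with
  | nil => simp [monomial]; rfl
  | cons z w ih =>
    have : monomial K (z :: w) = gen z * monomial K w := by simp [monomial]
    rw [this, map_mul, ih]
    simp [FreeAlgebra.equivMonoidAlgebraFreeMonoid, MonoidAlgebra.single_mul_single]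

/-! ### The pairing as a linear form on words -/

namespace NormalFront

variable (T : NormalFront) {k : ℕ} (a : Fin k → T.Hom K)

/-- The pairing as a linear form. -/
def pairLin : FreeAlgebra K Gen →ₗ[K] K where
  toFun := T.pair K a
  map_add' x y := by
    simp only [pair, map_add, MonoidAlgebra.coeff_add]
    rw [Finsupp.sum_add_index'] <;> intros <;> ring
  map_smul' c x := by
    simp only [pair, map_smul, MonoidAlgebra.coeff_smul, RingHom.id_apply, smul_eq_mul]
    rw [Finsupp.sum_smul_index' (by intros; ring), Finsupp.mul_sum]
    simp only [smul_eq_mul, mul_assoc]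

lemma pairLin_apply (x : FreeAlgebra K Gen) : T.pairLin a x = T.pair K a x := rfl

lemma pairLin_monomial (w : List Gen) : T.pairLin a (monomial K w) = T.pairWord K a w := by
  simp [pairLin, pair, equivMonoidAlgebraFreeMonoid_monomial, Finsupp.sum_single_index]

lemma pairWord_of_length_ne {w : List Gen} (h : w.length ≠ k) : T.pairWord K a w = 0 := by
  simp [pairWord, h]

lemma not_edge_negY {z : Gen} (h : ¬ z.IsEdge) : T.evalHom K (T.negY K) z = 0 := by
  unfold evalHom negY
  split_ifs
  · cases z <;> simp_all [Gen.IsEdge]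
  · rfl

/-- In a contributing word the letter in position `n` goes from copy `n` to copy `n + 1`. This
excludes letters that skip a copy or stay in one, and puts a letter from `p` to `p + 1` in position
`p`, where the unit vanishes off the edge generators. -/
lemma pairWord_of_killed (hN : ∀ z ∈ N, z.row = z.col) {p : Fin k}
    (hp : a p = T.negY K) {w : List Gen} {z : Gen} (hz : z ∈ w) (hk : z.Killed N p) :
    T.pairWord K a w = 0 := by
  unfold pairWord
  split_ifs with h
  · obtain ⟨hl, h⟩ := h
    obtain ⟨n, hn, rfl⟩ := List.getElem_of_mem hz
    have hn' := h ⟨n, hl ▸ hn⟩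
    simp only [List.getD_eq_getElem _ _ hn] at hn'
    rcases hk with hk | ⟨h₁, h₂, h₃⟩ | hk
    · omega
    · have hnp : n = p := by omega
      simp only []
      rw [Finset.prod_eq_zero (Finset.mem_univ p), mul_zero]
      rw [hp]
      apply not_edge_negY
      rw [Gen.isEdge_relabel, List.getD_eq_getElem _ _ (by omega)]
      simpa [← hnp] using h₃
    · have := hN _ hk
      omega
  · rfl

lemma pairLin_mul_gen_mul (hN : ∀ z ∈ N, z.row = z.col) {p : Fin k}
    (hp : a p = T.negY K) {z : Gen} (hk : z.Killed N p) (x y : FreeAlgebra K Gen) :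
    T.pairLin a (x * gen z * y) = 0 := by
  have hx : x ∈ Submodule.span K (Set.range (monomial K)) := span_monomial (K := K) ▸ trivial
  have hy : y ∈ Submodule.span K (Set.range (monomial K)) := span_monomial (K := K) ▸ trivial
  induction hx using Submodule.span_induction with
  | mem x hx =>
    obtain ⟨w, rfl⟩ := hx
    induction hy using Submodule.span_induction with
    | mem y hy =>
      obtain ⟨w', rfl⟩ := hy
      rw [← monomial_singleton, ← monomial_append, ← monomial_append, pairLin_monomial]
      exact T.pairWord_of_killed a hN hp (z := z) (by simp) hk
    | zero => simp
    | add y y' _ _ h h' => simp [mul_add, h, h']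
    | smul c y _ h => simp [h]
  | zero => simp
  | add y y' _ _ h h' => simp [add_mul, h, h']
  | smul c y _ h => simp [h]

lemma diagonalAug_of_ne {e : Fin (k + 1) → Gen → K} {z : Gen} (h : z.row ≠ z.col) :
    diagonalAug K e z = 0 := by
  simp [diagonalAug, h]

lemma twist_gen (e : Fin (k + 1) → Gen → K) (z : Gen) :
    twist K e (gen z) = gen z + algebraMap K _ (diagonalAug K e z) := by
  simp [twist]

lemma twist_gen_of_ne {e : Fin (k + 1) → Gen → K} {z : Gen} (h : z.row ≠ z.col) :
    twist K e (gen z) = gen z := by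
  simp [twist_gen, diagonalAug_of_ne h]

/-- The twist fixes killed letters, since the diagonal augmentation vanishes on them, so they remain
letters of every word after twisting. The outer factors `l` and `r` make the induction over products
possible. -/
lemma pairLin_twist_mul_mul {p : Fin k} (hp : a p = T.negY K) {e : Fin (k + 1) → Gen → K}
    (hN : ∀ z ∈ N, z.row = z.col ∧ diagonalAug K e z = 0)
    (x l r : FreeAlgebra K Gen) :
    T.pairLin a (twist K e (l * reduce N p x * r)) = T.pairLin a (twist K e (l * x * r)) := by
  induction x using FreeAlgebra.induction generalizing l r with
  | grade0 c => rw [AlgHom.commutes]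
  | grade1 z =>
    by_cases hz : z.Killed N p
    · have h := T.pairLin_mul_gen_mul a (fun z h => (hN z h).1) hp hz (twist K e l) (twist K e r)
      have hz' : twist K e (gen z) = gen z := by
        by_cases h' : z.row = z.col
        -- A killed letter with both ends on one copy cannot be of the first two kinds.
        · have : z ∈ N := by rcases hz with hz | hz | hz <;> omega
          simp [twist_gen, (hN z this).2]
        · exact twist_gen_of_ne h'
      rw [← hz'] at h
      simp [reduce_gen_of_killed hz, map_mul, h]
    · rw [reduce_gen_of_not_killed hz]
  | add x y hx hy => simp only [map_add, mul_add, add_mul] at hx hy ⊢; rw [hx, hy]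
  | mul x y hx hy =>
    have h₁ := hy (l * reduce N p x) r
    have h₂ := hx l (y * r)
    simp only [mul_assoc, map_mul] at h₁ h₂ ⊢
    rw [h₁, h₂]

/-- The pairing does not see killed generators. -/
lemma pairLin_twist_reduce {p : Fin k} (hp : a p = T.negY K) {e : Fin (k + 1) → Gen → K}
    (hN : ∀ z ∈ N, z.row = z.col ∧ diagonalAug K e z = 0)
    (x : FreeAlgebra K Gen) :
    T.pairLin a (twist K e (reduce N p x)) = T.pairLin a (twist K e x) := by
  simpa using T.pairLin_twist_mul_mul a hp hN x 1 1

end NormalFront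
/-! ## Labelled strands -/

/-- A strand of a front, over a part of a front without cusps: the generator from copy `0` to
copy `1` attached to its edge, the branch of the edge at the left cusp, and the potential. -/
structure Label where
  edge : Gen
  lower : Bool
  pot : ℤ
  deriving DecidableEq

lemma getElem?_append_cons_cons {α : Type*} (pre post : List α) (x y : α) (P : ℕ) :
    (pre ++ x :: y :: post)[P]? = if P < pre.length then pre[P]? else if P = pre.length then some x
      else if P = pre.length + 1 then some y else post[P - (pre.length + 2)]? := by
  split_ifs with h₁ h₂ h₃
  · exact List.getElem?_append_left h₁
  · simp [h₂]
  · simp [h₃]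
  · rw [List.getElem?_append_right (by omega)]
    obtain ⟨n, hn⟩ : ∃ n, P = pre.length + 2 + n := ⟨P - (pre.length + 2), by omega⟩
    have : P - pre.length = n + 1 + 1 := by omega
    rw [this]
    simp [hn]

/-- The strands of the state of an `m`-copy are labelled by the list `X` of strands of the
underlying front and copies, and the counts of half disks satisfy the relation `R`. -/
structure Tracks (F : FrontState K) (X : List (Label × ℕ))
    (R : Label × ℕ → Label × ℕ → FreeAlgebra K Gen → Prop) : Prop where
  n : F.strands.n = X.length
  mu : ∀ P x, X[P]? = some x → F.strands.mu P = x.1.pot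
  g : ∀ P Q x y, P < Q → X[P]? = some x → X[Q]? = some y → R x y (F.g P Q)

/-! ### Elementary slices acting on labelled strands -/

namespace Tracks

variable {F : FrontState K} {pre post : List (Label × ℕ)} {x y : Label × ℕ}
  {R R' : Label × ℕ → Label × ℕ → FreeAlgebra K Gen → Prop}

lemma mono {X : List (Label × ℕ)} (H : Tracks F X R)
    (h : X.Pairwise fun x y => ∀ v, R x y v → R' x y v) : Tracks F X R' where
  n := H.n
  mu := H.mu
  g P Q x y hPQ hx hy := by
    obtain ⟨hP, rfl⟩ := List.getElem?_eq_some_iff.1 hx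
    obtain ⟨hQ, rfl⟩ := List.getElem?_eq_some_iff.1 hy
    exact List.pairwise_iff_getElem.1 h P Q hP hQ hPQ _ (H.g P Q _ _ hPQ hx hy)

lemma mono_of_mem {X : List (Label × ℕ)} (H : Tracks F X R)
    (h : ∀ x ∈ X, ∀ y ∈ X, ∀ v, R x y v → R' x y v) : Tracks F X R' :=
  H.mono (List.Pairwise.imp_of_mem (R := fun _ _ => True) (fun hx hy _ => h _ hx _ hy)
    (List.pairwise_of_forall fun _ _ => trivial))

lemma cross_rel (H : Tracks F (pre ++ x :: y :: post) R) :
    R x y (F.g pre.length (pre.length + 1)) :=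
  H.g _ _ _ _ (by omega) (by simp) (by simp)

lemma cross_deg (H : Tracks F (pre ++ x :: y :: post) R) :
    F.strands.mu pre.length - F.strands.mu (pre.length + 1) = x.1.pot - y.1.pot := by
  rw [H.mu _ x (by simp), H.mu _ y (by simp)]

/-- The hypotheses run through the kinds of entries of `g` that a crossing produces. Keeping `R` and
`R'` arbitrary lets the same lemma serve the exact relations at left cusps, the intermediate ones at
crossings, and `Unital`. -/
lemma cross (H : Tracks F (pre ++ x :: y :: post) R) (z : Gen) (hyx : R' y x 0)
    (hpre : ∀ w ∈ pre, ∀ u v, R w y u → R w x v → R' w y (u + v * gen z))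
    (hpre' : ∀ w ∈ pre, ∀ u, R w x u → R' w x u)
    (hpost : ∀ w ∈ post, ∀ u, R y w u → R' y w u)
    (hpost' : ∀ w ∈ post, ∀ u v, R x w u → R y w v →
      R' x w (u - sg K (x.1.pot - y.1.pot) • (gen z * v)))
    (hrest : ∀ w ∈ pre ++ post, ∀ w' ∈ pre ++ post, ∀ u, R w w' u → R' w w' u) :
    Tracks (F.cross pre.length z) (pre ++ y :: x :: post) R' where
  n := by
    have := H.n
    simp only [FrontState.cross, Slice.act, List.length_append, List.length_cons] at this ⊢
    exact this
  mu P w hw := by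
    simp only [getElem?_append_cons_cons] at hw
    simp only [FrontState.cross, Slice.act]
    apply H.mu
    rw [getElem?_append_cons_cons]
    by_cases h₁ : P = pre.length
    · subst h₁; simpa using hw
    by_cases h₂ : P = pre.length + 1
    · subst h₂; simpa using hw
    rw [Equiv.swap_apply_of_ne_of_ne h₁ h₂]
    simpa [h₁, h₂] using hw
  g P Q w w' hPQ hw hw' := by
    have key : ∀ N v, N ≠ pre.length → N ≠ pre.length + 1 →
        (pre ++ y :: x :: post)[N]? = some v → (pre ++ x :: y :: post)[N]? = some v ∧
          (N < pre.length → v ∈ pre) ∧ (pre.length + 1 < N → v ∈ post) := by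
      intro N v h₁ h₂ h
      simp only [getElem?_append_cons_cons, h₁, h₂, if_false] at h ⊢
      refine ⟨h, fun h₃ => ?_, fun h₃ => ?_⟩
      · rw [if_pos h₃] at h
        exact List.mem_of_getElem? h
      · rw [if_neg (by omega)] at h
        exact List.mem_of_getElem? h
    have hx : (pre ++ x :: y :: post)[pre.length]? = some x := by simp
    have hy : (pre ++ x :: y :: post)[pre.length + 1]? = some y := by simp
    have ex : ∀ {v}, (pre ++ y :: x :: post)[pre.length]? = some v → v = y := by simp [eq_comm]
    have ey : ∀ {v}, (pre ++ y :: x :: post)[pre.length + 1]? = some v → v = x := by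
      simp [eq_comm]
    simp only [FrontState.cross]
    by_cases hP₁ : P = pre.length
    · subst hP₁
      obtain rfl := ex hw
      by_cases hQ₁ : Q = pre.length + 1
      · subst hQ₁
        obtain rfl := ey hw'
        simpa using hyx
      · obtain ⟨h, -, h'⟩ := key Q w' (by omega) hQ₁ hw'
        have hQ : pre.length + 1 < Q := by omega
        simp only [hQ₁, and_false, if_false, hQ, and_true, if_true, lt_irrefl]
        exact hpost _ (h' hQ) _ (H.g _ _ _ _ hQ hy h)
    by_cases hP₂ : P = pre.length + 1
    · subst hP₂
      obtain rfl := ey hw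
      obtain ⟨h, -, h'⟩ := key Q w' (by omega) (by omega) hw'
      have hQ : pre.length + 1 < Q := hPQ
      have e₁ : ¬ (Q = pre.length) := by omega
      have e₂ : ¬ (Q = pre.length + 1) := by omega
      simp only [e₁, e₂, hQ, and_true, if_true, false_and, and_false, if_false, hP₁]
      have := hpost' _ (h' hQ) _ _ (H.g _ _ _ _ (by omega) hx h) (H.g _ _ _ _ hQ hy h)
      rwa [H.cross_deg]
    obtain ⟨hp, hp₁, hp₂⟩ := key P w hP₁ hP₂ hw
    by_cases hQ₁ : Q = pre.length
    · subst hQ₁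
      obtain rfl := ex hw'
      simp only [hP₁, false_and, if_false, hPQ, true_and, if_true]
      exact hpre _ (hp₁ hPQ) _ _ (H.g _ _ _ _ (by omega) hp hy) (H.g _ _ _ _ hPQ hp hx)
    by_cases hQ₂ : Q = pre.length + 1
    · subst hQ₂
      obtain rfl := ey hw'
      have hP : P < pre.length := by omega
      simp only [hP₁, false_and, if_false, hP, true_and, if_true, hQ₁]
      exact hpre' _ (hp₁ hP) _ (H.g _ _ _ _ hP hp hx)
    · obtain ⟨hq, hq₁, hq₂⟩ := key Q w' hQ₁ hQ₂ hw'
      simp only [hP₁, hP₂, hQ₁, hQ₂, false_and, if_false]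
      refine hrest _ ?_ _ ?_ _ (H.g _ _ _ _ hPQ hp hq)
      · rcases lt_or_ge P pre.length with h | h
        · exact List.mem_append_left _ (hp₁ h)
        · exact List.mem_append_right _ (hp₂ (by omega))
      · rcases lt_or_ge Q pre.length with h | h
        · exact List.mem_append_left _ (hq₁ h)
        · exact List.mem_append_right _ (hq₂ (by omega))

lemma leftCusp {d : ℤ} (H : Tracks F (pre ++ post) R) (hx : x.1.pot = d) (hy : y.1.pot = d - 1)
    (hxy : R' x y 1) (hpre : ∀ w ∈ pre, R' w x 0 ∧ R' w y 0)
    (hpost : ∀ w ∈ post, R' x w 0 ∧ R' y w 0)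
    (hrest : ∀ w ∈ pre ++ post, ∀ w' ∈ pre ++ post, ∀ u, R w w' u → R' w w' u) :
    Tracks (F.leftCusp pre.length d) (pre ++ x :: y :: post) R' where
  n := by
    have := H.n
    simp only [FrontState.leftCusp, Slice.act, List.length_append, List.length_cons] at this ⊢
    omega
  mu P w hw := by
    rw [getElem?_append_cons_cons] at hw
    simp only [FrontState.leftCusp, Slice.act]
    split_ifs with h₁ h₂ h₃
    · exact H.mu P w (by rw [List.getElem?_append_left h₁]; simpa [h₁] using hw)
    · simp_all
    · simp_all
    · refine H.mu _ w ?_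
      rw [List.getElem?_append_right (by omega)]
      simp only [h₁, h₂, h₃, if_false] at hw
      rw [← hw]; congr 1; omega
  g P Q w w' hPQ hw hw' := by
    have key : ∀ N v, N ≠ pre.length → N ≠ pre.length + 1 →
        (pre ++ x :: y :: post)[N]? = some v →
          (pre ++ post)[if N < pre.length then N else N - 2]? = some v ∧
          (N < pre.length → v ∈ pre) ∧ (pre.length + 1 < N → v ∈ post) := by
      intro N v h₁ h₂ h
      simp only [getElem?_append_cons_cons, h₁, h₂, if_false] at h
      split_ifs with h₃
      · rw [if_pos h₃] at h
        exact ⟨by rwa [List.getElem?_append_left h₃], fun _ => List.mem_of_getElem? h, by omega⟩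
      · rw [if_neg h₃] at h
        refine ⟨?_, by omega, fun _ => List.mem_of_getElem? h⟩
        rw [List.getElem?_append_right (by omega), ← h]
        congr 1; omega
    have ex : ∀ {v}, (pre ++ x :: y :: post)[pre.length]? = some v → v = x := by simp [eq_comm]
    have ey : ∀ {v}, (pre ++ x :: y :: post)[pre.length + 1]? = some v → v = y := by
      simp [eq_comm]
    simp only [FrontState.leftCusp]
    by_cases hP₁ : P = pre.length
    · subst hP₁
      obtain rfl := ex hw
      by_cases hQ₁ : Q = pre.length + 1
      · subst hQ₁
        obtain rfl := ey hw'
        simpa using hxy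
      · obtain ⟨-, -, h'⟩ := key Q w' (by omega) hQ₁ hw'
        simpa [hQ₁] using (hpost _ (h' (by omega))).1
    by_cases hP₂ : P = pre.length + 1
    · subst hP₂
      obtain rfl := ey hw
      obtain ⟨-, -, h'⟩ := key Q w' (by omega) (by omega) hw'
      simpa using (hpost _ (h' hPQ)).2
    obtain ⟨hp, hp₁, hp₂⟩ := key P w hP₁ hP₂ hw
    by_cases hQ₁ : Q = pre.length
    · subst hQ₁
      obtain rfl := ex hw'
      simpa [hP₁] using (hpre _ (hp₁ hPQ)).1
    by_cases hQ₂ : Q = pre.length + 1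
    · subst hQ₂
      obtain rfl := ey hw'
      simpa [hP₁] using (hpre _ (hp₁ (by omega))).2
    · obtain ⟨hq, hq₁, hq₂⟩ := key Q w' hQ₁ hQ₂ hw'
      simp only [hP₁, hP₂, hQ₁, hQ₂, false_and, if_false, or_self]
      refine hrest _ (List.mem_of_getElem? hp) _ (List.mem_of_getElem? hq) _
        (H.g _ _ _ _ ?_ hp hq)
      split_ifs <;> omega

lemma rightCusp (H : Tracks F (pre ++ x :: y :: post) R) (s i : ℕ)
    (h : ∀ w ∈ pre, ∀ w' ∈ post, ∀ u v₁ v₂ v₃ v₄, R w w' u → R w x v₁ → R w y v₂ →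
      R x w' v₃ → R y w' v₄ → R' w w' (u + (v₂ + v₁ * gen (.c s i i)) * gen (.b s i 1 1) *
        (v₃ + gen (.c s i i) * v₄) + v₁ * gen (.b s i 0 2) * (v₃ + gen (.c s i i) * v₄) +
        (v₂ + v₁ * gen (.c s i i)) * gen (.b s i 1 2) * v₄ + v₁ * gen (.b s i 0 3) * v₄))
    (hpre : ∀ w ∈ pre, ∀ w' ∈ pre, ∀ u, R w w' u → R' w w' u)
    (hpost : ∀ w ∈ post, ∀ w' ∈ post, ∀ u, R w w' u → R' w w' u) :
    Tracks (F.rightCusp pre.length s i) (pre ++ post) R' where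
  n := by
    have := H.n
    simp only [FrontState.rightCusp, Slice.act, List.length_append, List.length_cons] at this ⊢
    omega
  mu P w hw := by
    simp only [FrontState.rightCusp, Slice.act]
    split_ifs with h₁
    · rw [List.getElem?_append_left h₁] at hw
      exact H.mu P w (by rwa [List.getElem?_append_left h₁])
    · rw [List.getElem?_append_right (by omega)] at hw
      refine H.mu _ w ?_
      rw [getElem?_append_cons_cons, if_neg (by omega), if_neg (by omega), if_neg (by omega), ← hw]
      congr 1; omega
  g P Q w w' hPQ hw hw' := by
    have left : ∀ {N v}, N < pre.length → (pre ++ post)[N]? = some v →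
        (pre ++ x :: y :: post)[N]? = some v ∧ v ∈ pre := by
      intro N v h₁ h
      rw [List.getElem?_append_left h₁] at h ⊢
      exact ⟨h, List.mem_of_getElem? h⟩
    have right : ∀ {N v}, ¬ N < pre.length → (pre ++ post)[N]? = some v →
        (pre ++ x :: y :: post)[N + 2]? = some v ∧ v ∈ post := by
      intro N v h₁ h
      rw [List.getElem?_append_right (by omega)] at h
      refine ⟨?_, List.mem_of_getElem? h⟩
      rw [getElem?_append_cons_cons, if_neg (by omega), if_neg (by omega), if_neg (by omega), ← h]
      congr 1; omega
    have hx : (pre ++ x :: y :: post)[pre.length]? = some x := by simp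
    have hy : (pre ++ x :: y :: post)[pre.length + 1]? = some y := by simp
    simp only [FrontState.rightCusp]
    by_cases hP : P < pre.length
    · obtain ⟨hp, hp'⟩ := left hP hw
      by_cases hQ : Q < pre.length
      · obtain ⟨hq, hq'⟩ := left hQ hw'
        rw [if_neg (by omega), if_pos hP, if_pos hQ]
        exact hpre _ hp' _ hq' _ (H.g _ _ _ _ hPQ hp hq)
      · obtain ⟨hq, hq'⟩ := right hQ hw'
        rw [if_pos ⟨hP, by omega⟩]
        exact h _ hp' _ hq' _ _ _ _ _ (H.g _ _ _ _ (by omega) hp hq)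
          (H.g _ _ _ _ hP hp hx) (H.g _ _ _ _ (by omega) hp hy)
          (H.g _ _ _ _ (by omega) hx hq) (H.g _ _ _ _ (by omega) hy hq)
    · have hQ : ¬ Q < pre.length := by omega
      obtain ⟨hp, hp'⟩ := right hP hw
      obtain ⟨hq, hq'⟩ := right hQ hw'
      rw [if_neg (by omega), if_neg hP, if_neg hQ]
      exact hpost _ hp' _ hq' _ (H.g _ _ _ _ (by omega) hp hq)

lemma vertex {n : ℕ} (H : Tracks F (pre ++ post) R) (hn : pre.length = n) (p i : ℕ) :
    Tracks (F.vertex n p i) post R where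
  n := by
    have := H.n
    simp only [FrontState.vertex, List.length_append] at this ⊢
    omega
  mu P w hw := by
    apply H.mu
    rw [List.getElem?_append_right (by omega), ← hw]
    congr 1; omega
  g P Q w w' hPQ hw hw' := by
    apply H.g _ _ _ _ (by omega)
    · rw [List.getElem?_append_right (by omega), ← hw]
      congr 1; omega
    · rw [List.getElem?_append_right (by omega), ← hw']
      congr 1; omega

end Tracks

/-! ## Cusps and vertices of front copies -/

variable (N) in
/-- Modulo killed generators, the half disks from a copy `i ≤ p` to a copy `j > p` are those given
by the generator from copy `p` to copy `p + 1` of an edge. -/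
def Unital (p : ℕ) (x y : Label × ℕ) (v : FreeAlgebra K Gen) : Prop :=
  x.2 ≤ p → p < y.2 → reduce N p v =
    if x.1 = y.1 ∧ x.2 = p ∧ y.2 = p + 1 then reduce N p (gen (x.1.edge.move p (p + 1))) else 0

/-- The strands of the `m`-copy of a front with strands `L`. -/
def blocks (L : List Label) (m : ℕ) : List (Label × ℕ) :=
  L.flatMap fun x => (List.range m).map (x, ·)

@[simp] lemma blocks_nil (m : ℕ) : blocks [] m = [] := rfl

@[simp] lemma blocks_zero (L : List Label) : blocks L 0 = [] := by
  simp [blocks]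

lemma blocks_cons (x : Label) (L : List Label) (m : ℕ) :
    blocks (x :: L) m = (List.range m).map (x, ·) ++ blocks L m := by
  simp [blocks]

@[simp] lemma blocks_append (L L' : List Label) (m : ℕ) :
    blocks (L ++ L') m = blocks L m ++ blocks L' m := by
  simp [blocks]

@[simp] lemma length_blocks (L : List Label) (m : ℕ) : (blocks L m).length = L.length * m := by
  induction L with
  | nil => simp
  | cons x L ih => simp [blocks_cons, ih]; ring

lemma mem_blocks {L : List Label} {m : ℕ} {x : Label × ℕ} :
    x ∈ blocks L m ↔ x.1 ∈ L ∧ x.2 < m := by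
  obtain ⟨a, i⟩ := x
  simp [blocks]

lemma getElem?_blocks {L : List Label} {m a i : ℕ} {x : Label} (hi : i < m) (hx : L[a]? = some x) :
    (blocks L m)[a * m + i]? = some (x, i) := by
  induction L generalizing a with
  | nil => simp at hx
  | cons y L ih =>
    rw [blocks_cons]
    cases a with
    | zero => simp_all [List.getElem?_append_left]
    | succ a =>
      have e : (a + 1) * m = a * m + m := by ring
      rw [List.getElem?_append_right (by simp; omega)]
      simpa [e, show a * m + m + i - m = a * m + i by omega] using ih (by simpa using hx)

lemma foldl_range_induction {σ : Type*} (P : ℕ → σ → Prop) {f : σ → ℕ → σ} {n : ℕ} {s : σ}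
    (h₀ : P 0 s) (h : ∀ i < n, ∀ s, P i s → P (i + 1) (f s i)) :
    P n ((List.range n).foldl f s) := by
  induction n with
  | zero => exact h₀
  | succ n ih =>
    rw [List.range_succ, List.foldl_append]
    exact h _ (by omega) _ (ih fun i hi => h i (by omega))

lemma range'_sub {i m : ℕ} (h : i < m) :
    List.range' i (m - i) = i :: List.range' (i + 1) (m - (i + 1)) := by
  rw [show m - i = (m - (i + 1)) + 1 by omega, List.range'_succ]

/-! ### Re-sorting the strands in front of right cusps and vertices -/

namespace Tracks

variable {F : FrontState K} {pre post : List (Label × ℕ)} {x y : Label × ℕ} {p : ℕ}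

/-- A crossing of a strand with a strand of a higher copy, of another edge. -/
lemma cross_descent (H : Tracks F (pre ++ x :: y :: post) (Unital N p)) (z : Gen)
    (hne : x.1 ≠ y.1) (h : y.2 < x.2) :
    Tracks (F.cross pre.length z) (pre ++ y :: x :: post) (Unital N p) := by
  refine H.cross z ?_ ?_ (fun _ _ _ h => h) (fun _ _ _ h => h) ?_ (fun _ _ _ _ _ h => h)
  · intro _ _
    rw [if_neg fun h => hne h.1.symm, map_zero]
  -- The correction term matters only if `y` is on a copy `> p`. Then `x` is on a copy `≥ p + 2`,
  -- which a surviving half disk from a copy `≤ p` does not reach. The next case is symmetric.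
  · intro w _ u v hu hv h₁ h₂
    rw [map_add, map_mul, hu h₁ h₂, hv h₁ (by omega), if_neg (c := w.1 = x.1 ∧ _) (by omega)]
    simp
  · intro w _ u v hu hv h₁ h₂
    rw [map_sub, map_smul, map_mul, hu h₁ h₂, hv (by omega) h₂,
      if_neg (c := y.1 = w.1 ∧ _) (by omega)]
    simp

lemma sweepDown {mid : List (Label × ℕ)} (name : ℕ → Gen)
    (h : ∀ y ∈ mid, x.1 ≠ y.1 ∧ y.2 < x.2)
    (H : Tracks F (pre ++ x :: (mid ++ post)) (Unital N p)) :
    Tracks (((List.range mid.length).map fun u => .cross (pre.length + u) (name u)).foldl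
      FrontState.step F) (pre ++ mid ++ x :: post) (Unital N p) := by
  induction mid generalizing F pre name with
  | nil => simpa using H
  | cons y mid ih =>
    have h' := h y (by simp)
    have := ih (fun u => name (u + 1)) (fun y hy => h y (by simp [hy])) (pre := pre ++ [y])
      (F := F.cross pre.length (name 0)) (by
        simpa using cross_descent (post := mid ++ post) (by simpa using H) (name 0) h'.1 h'.2)
    rw [List.length_cons, List.range_succ_eq_map]
    simpa [FrontState.step, Function.comp_def, add_assoc, add_comm, add_left_comm] using this

lemma sweepUp {mid : List (Label × ℕ)} (name : ℕ → Gen)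
    (h : ∀ x ∈ mid, x.1 ≠ y.1 ∧ y.2 < x.2)
    (H : Tracks F (pre ++ mid ++ y :: post) (Unital N p)) :
    Tracks (((List.range mid.length).map fun t =>
      .cross (pre.length + (mid.length - 1 - t)) (name t)).foldl
      FrontState.step F) (pre ++ y :: (mid ++ post)) (Unital N p) := by
  induction mid using List.reverseRecOn generalizing F post name with
  | nil => simpa using H
  | append_singleton mid x ih =>
    have h' := h x (by simp)
    have hx := cross_descent (pre := pre ++ mid) (post := post) (by simpa using H) (name 0)
      h'.1 h'.2
    have := ih (fun u => name (u + 1)) (fun y hy => h y (by simp [hy])) (post := x :: post) hx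
    rw [List.length_append, List.length_singleton, List.range_succ_eq_map]
    simp only [List.map_cons, List.foldl_cons, List.map_map, Function.comp_def, FrontState.step]
    convert this using 3 <;> simp [Nat.sub_sub, add_comm]

/-- The `m`-copy of a right cusp. -/
lemma rightCusp_copies {m s : ℕ} {U D : Label} {L L' : List Label}
    (hN : ∀ i < m, Gen.c s i i ∈ N ∧ ∀ a l, 2 ≤ l → Gen.b s i a l ∈ N)
    (hnd : (L ++ U :: D :: L').Nodup)
    (H : Tracks F (blocks (L ++ U :: D :: L') m) (Unital N p)) :
    Tracks (((Slice.rightCusp L.length).copies m s).foldl FrontState.step F)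
      (blocks (L ++ L') m) (Unital N p) := by
  have hUD : U ≠ D := by
    rintro rfl
    simp [List.nodup_append] at hnd
  have hL : ∀ w ∈ blocks L m, w.1 ≠ U ∧ w.1 ≠ D := by
    intro w hw
    rw [mem_blocks] at hw
    rw [List.nodup_append] at hnd
    exact ⟨hnd.2.2 _ hw.1 _ (by simp), hnd.2.2 _ hw.1 _ (by simp)⟩
  have hL' : ∀ w ∈ blocks L' m, w.1 ≠ U := by
    rintro w hw rfl
    rw [mem_blocks] at hw
    simp [List.nodup_append, hw] at hnd
  rw [Slice.copies, List.foldl_append, List.foldl_flatMap, List.foldl_map]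
  -- the crossings
  set F₁ := List.foldl _ F _
  -- These crossings regroup the two blocks of branches into adjacent pairs, one for each copy of
  -- the cusp.
  have H₁ : Tracks F₁ (blocks L m ++ (List.range m).flatMap (fun i => [(U, i), (D, i)]) ++
      blocks L' m) (Unital N p) := by
    have := foldl_range_induction (n := m) (s := F) (f := fun F i => List.foldl FrontState.step F
        ((List.range (m - 1 - i)).map fun t =>
        .cross (L.length * m + (i + m - 1 - t)) (.c s (m - 1 - t) i)))
      (P := fun i F => Tracks F (blocks L m ++ (List.range i).flatMap (fun i => [(U, i), (D, i)])
        ++ (List.range' i (m - i)).map (U, ·) ++ (List.range' i (m - i)).map (D, ·) ++ blocks L' m)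
        (Unital N p)) ?_ ?_
    · simpa using this
    · simpa [blocks_cons, List.range_eq_range'] using H
    · intro i hi F HF
      have := sweepUp (pre := blocks L m ++ (List.range i).flatMap (fun i => [(U, i), (D, i)])
          ++ [(U, i)]) (mid := (List.range' (i + 1) (m - (i + 1))).map (U, ·)) (y := (D, i))
        (post := (List.range' (i + 1) (m - (i + 1))).map (D, ·) ++ blocks L' m)
        (fun t => .c s (m - 1 - t) i) ?_ (by simpa [range'_sub hi] using HF)
      · simp only [List.length_map, List.length_range', List.length_append, length_blocks,
          List.length_flatMap] at this
        rw [List.range_succ]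
        simp only [List.flatMap_append]
        convert this using 1
        · congr 1
          rw [show m - (i + 1) = m - 1 - i by omega]
          apply List.map_congr_left
          intro t ht
          rw [List.mem_range] at ht
          congr 1
          simp
          omega
        · simp
      · simp only [List.mem_map, List.mem_range'_1]
        rintro _ ⟨j, hj, rfl⟩
        exact ⟨hUD, by simp; omega⟩
  -- the cusps
  have := foldl_range_induction (n := m) (s := F₁)
      (f := fun F i => F.rightCusp (L.length * m) s i)
      -- Closing copy `p` of the cusp can create half disks ending on a remaining copy of `U`. Those
      -- strands vanish at later cusps, so the invariant may ignore half disks ending on `U`.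
      (P := fun i F => Tracks F (blocks L m ++ ((List.range' i (m - i)).flatMap
        (fun i => [(U, i), (D, i)]) ++ blocks L' m)) fun x y v => y.1 = U ∨ Unital N p x y v) ?_ ?_
  · simp only [Nat.sub_self, List.range'_zero, List.flatMap_nil, List.nil_append] at this
    rw [← blocks_append] at this
    refine this.mono_of_mem ?_
    intro x hx y hy v hv
    refine hv.resolve_left ?_
    rw [blocks_append, List.mem_append] at hy
    rcases hy with hy | hy
    · exact (hL _ hy).1
    · exact hL' _ hy
  · simp only [Nat.sub_zero, ← List.range_eq_range', ← List.append_assoc]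
    exact H₁.mono_of_mem fun _ _ _ _ v hv => .inr hv
  · intro i hi F HF
    rw [range'_sub hi] at HF
    have hlen := length_blocks L m
    rw [← hlen]
    refine rightCusp (x := (U, i)) (y := (D, i)) (by simpa using HF) s i ?_
      (fun _ _ _ _ _ h => h) (fun _ _ _ _ _ h => h)
    intro w hw w' _ u v₁ v₂ v₃ v₄ hu _ hv₂ hv₃ _
    have hN' := hN i hi
    refine or_iff_not_imp_left.2 fun hw' h₁ h₂ => ?_
    -- Without the kink and the longer basepoint generators, the only added term is g_{w,D} b_{2,1}
    -- g_{U,w'}.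
    simp only [map_add, map_mul, reduce_gen_of_mem hN'.1, reduce_gen_of_mem (hN'.2 0 2 le_rfl),
      reduce_gen_of_mem (hN'.2 1 2 le_rfl), reduce_gen_of_mem (hN'.2 0 3 (by omega)),
      mul_zero, zero_mul, add_zero]
    rw [(hu.resolve_left hw') h₁ h₂]
    -- One of the two factors passes from copies `≤ p` to copies `> p` between different strands:
    -- the one ending on `D` if `i > p`, the one starting on `U` if `i ≤ p`.
    rcases lt_or_ge p i with h | h
    · rw [(hv₂.resolve_left hUD.symm) h₁ h, if_neg (c := w.1 = D ∧ _) fun h => (hL w hw).2 h.1]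
      simp
    · rw [(hv₃.resolve_left hw') h h₂, if_neg (c := U = w'.1 ∧ _) fun h => hw' h.1.symm]
      simp

/-- The `m`-copy of a vertex. -/
lemma vertexCopies {m q : ℕ} {L L' : List Label} (hnd : (L ++ L').Nodup)
    (H : Tracks F (blocks (L ++ L') m) (Unital N p)) :
    Tracks ((vertexCopies m L.length q).foldl FrontState.step F) (blocks L' m) (Unital N p) := by
  rw [LegendrianGraph.vertexCopies, List.foldl_append, List.foldl_flatMap]
  set F₁ := List.foldl _ F _
  have H₁ : Tracks F₁ ((List.range m).flatMap (fun i => L.map (·, i)) ++ blocks L' m)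
      (Unital N p) := by
    -- The last copy is separated first. The `tail` holds the copies already separated and the
    -- strands that do not enter the vertex.
    have : ∀ (j : ℕ) (F : FrontState K) (tail : List (Label × ℕ)),
        Tracks F (blocks L j ++ tail) (Unital N p) → Tracks
        ((List.range j).reverse.foldl (fun F j => List.foldl FrontState.step F
          ((List.range L.length).reverse.flatMap fun a =>
    (List.range ((L.length - 1 - a) * j)).map fun u =>
      .cross (a * (j + 1) + j + u) (.t q a (a + 1 + u / j) j (u % j)))) F)
        ((List.range j).flatMap (fun i => L.map (·, i)) ++ tail) (Unital N p) := by
      intro j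
      induction j with
      | zero => intro F tail H; simpa using H
      | succ j ih =>
        intro F tail H
        rw [List.range_succ, List.reverse_append, List.reverse_singleton, List.singleton_append,
          List.foldl_cons, List.flatMap_append, List.append_assoc]
        apply ih
        -- Copy `j` of the half edges in `B` has already been moved below the lower-numbered copies.
        -- The last half edge of `A` is next.
        have inner : ∀ (A B : List Label) (F : FrontState K), A ++ B = L →
            Tracks F (blocks A (j + 1) ++ blocks B j ++ B.map (·, j) ++ tail) (Unital N p) →
            Tracks (List.foldl FrontState.step F ((List.range A.length).reverse.flatMap fun a =>
              (List.range ((L.length - 1 - a) * j)).map fun u =>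
              .cross (a * (j + 1) + j + u) (.t q a (a + 1 + u / j) j (u % j))))
              (blocks L j ++ L.map (·, j) ++ tail) (Unital N p) := by
          intro A
          induction A using List.reverseRecOn with
          | nil =>
            rintro B F rfl HF
            simpa using HF
          | append_singleton A a ihA =>
            intro B F hAB HF
            have hlen : L.length - 1 - A.length = B.length := by
              rw [← hAB]; simp
            rw [List.length_append, List.length_singleton, List.range_succ, List.reverse_append,
              List.reverse_singleton, List.singleton_append, List.flatMap_cons, List.foldl_append]
            apply ihA (a :: B) _ (by simpa using hAB)
            have := sweepDown (pre := blocks A (j + 1) ++ (List.range j).map (a, ·))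
              (mid := blocks B j) (x := (a, j)) (post := B.map (·, j) ++ tail)
              (fun u => .t q A.length (A.length + 1 + u / j) j (u % j)) ?_
              (by simpa [blocks_cons, List.range_succ] using HF)
            · simpa [blocks_cons, hlen] using this
            · intro y hy
              rw [mem_blocks] at hy
              refine ⟨?_, hy.2⟩
              rintro rfl
              rw [← hAB] at hnd
              simp [List.nodup_append, hy] at hnd
        simpa using inner L [] F (by simp) (by simpa using H)
    exact this m F _ (by simpa using H)
  have := foldl_range_induction (n := m) (s := F₁)
      (f := fun F i => F.vertex L.length q i)
      (P := fun i F => Tracks F (((List.range' i (m - i)).flatMap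
        (fun i => L.map (·, i)) ++ blocks L' m)) (Unital N p)) ?_ ?_
  · rw [List.foldl_map]
    simpa [FrontState.step] using this
  · simpa [← List.range_eq_range'] using H₁
  · intro i hi F HF
    rw [range'_sub hi] at HF
    exact vertex (pre := L.map (·, i)) (by simpa using HF) (by simp) q i

end Tracks

/-! ## Crossings of front copies -/

/-- A strand sweeps upwards, so the invariant is indexed by the number of strands still to be passed
and descends from `n` to `0`. -/
lemma sweep_induction (P : ℕ → FrontState K → Prop) {q n : ℕ} {name : ℕ → Gen} {F : FrontState K}
    (h₀ : P n F) (h : ∀ r < n, ∀ F, P (r + 1) F → P r (F.cross (q + r) (name r))) :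
    P 0 (((List.range n).map fun t => .cross (q + (n - 1 - t)) (name (n - 1 - t))).foldl
      FrontState.step F) := by
  induction n generalizing F with
  | zero => simpa using h₀
  | succ n ih =>
    rw [List.range_succ_eq_map]
    simp only [List.map_cons, List.foldl_cons, List.map_map, Function.comp_def]
    have := ih (h n (by omega) _ h₀) fun r hr => h r (by omega)
    convert this using 3
    · simp [FrontState.step]
    · funext t
      rw [show n + 1 - 1 - (t + 1) = n - 1 - t by omega]

section Crossing

open Classical in
/-- The value `v` if `P` holds, and zero otherwise. -/
def onlyIf {α : Type*} [Zero α] (P : Prop) (v : α) : α := if P then v else 0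

@[simp] lemma onlyIf_true {α : Type*} [Zero α] (v : α) : onlyIf True v = v := if_pos trivial

@[simp] lemma onlyIf_false {α : Type*} [Zero α] (v : α) : onlyIf False v = 0 := if_neg id

variable (N) in
/-- The half disks during the crossing of the copies of the strands `A` and `B` in the `s`-th
slice, when the crossings in `δ` have been passed. -/
def CrossRel (p s : ℕ) (A B : Label) (δ : ℕ → ℕ → Prop) (x y : Label × ℕ)
    (v : FreeAlgebra K Gen) : Prop :=
  x.2 ≤ p → p < y.2 → reduce N p v =
    if x.1 = A ∧ y.1 = B then
      onlyIf (x.2 = p ∧ δ (p + 1) y.2)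
        (reduce N p (gen (A.edge.move p (p + 1)) * gen (.c s (p + 1) y.2))) -
      onlyIf (y.2 = p + 1 ∧ δ x.2 p) (sg K (A.pot - B.pot) •
        reduce N p (gen (.c s x.2 p) * gen (B.edge.move p (p + 1))))
    else if x.1 = y.1 ∧ x.2 = p ∧ y.2 = p + 1 then reduce N p (gen (x.1.edge.move p (p + 1))) else 0

variable (N) in
/-- The differential of the crossing of copy `i` of `A` and copy `j` of `B`, modulo killed
generators. -/
def CrossDif (p s : ℕ) (A B : Label) (i j : ℕ) (v : FreeAlgebra K Gen) : Prop :=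
  i ≤ p → p < j → reduce N p v =
    onlyIf (i = p) (reduce N p (gen (A.edge.move p (p + 1)) * gen (.c s (p + 1) j))) -
    onlyIf (j = p + 1) (sg K (A.pot - B.pot) •
        reduce N p (gen (.c s i p) * gen (B.edge.move p (p + 1))))

/-- The crossings passed before copy `j` of the lower strand meets copy `r - 1` of the upper
one. -/
def crossDone (m r j i j' : ℕ) : Prop := i < m ∧ (j' < j ∨ (j' = j ∧ r ≤ i))

/-- Two of the new products survive: the edge generator of `A` times the crossing, between `A_p` and
`B_j`, if `r = p + 1`; and the crossing times the edge generator of `B`, between `A_r` and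
`B_{p+1}`, if `j = p`. They are the two terms in `CrossRel`. The crossing itself is killed if `r ≤ p
< j`. -/
lemma crossRel_step {p s m r j : ℕ} {A B : Label} (hAB : A ≠ B) (hr : r < m) (hj : j < m)
    {pre post : List (Label × ℕ)} {F : FrontState K}
    (hpre : ∀ w ∈ pre, (w.1 = A → w.2 < r) ∧ (w.1 = B → w.2 < j))
    (hpost : ∀ w ∈ post, (w.1 = A → r < w.2) ∧ (w.1 = B → j < w.2))
    (H : Tracks F (pre ++ (A, r) :: (B, j) :: post)
      (CrossRel N p s A B (crossDone m (r + 1) j))) :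
    Tracks (F.cross pre.length (.c s r j)) (pre ++ (B, j) :: (A, r) :: post)
      (CrossRel N p s A B (crossDone m r j)) := by
  have hname : r ≤ p → p < j → reduce N p (gen (.c s r j) : FreeAlgebra K Gen) = 0 := fun h h' =>
    reduce_gen_of_not_isEdge (by simp [Gen.IsEdge]) h h'
  refine H.cross _ ?_ ?_ ?_ ?_ ?_ ?_
  · intro _ _
    simp [hAB, hAB.symm]
  · intro w hw u v hu hv h₁ h₂
    have hA := (hpre w hw).1
    simp only [CrossRel] at hu hv h₁ h₂
    rw [map_add, map_mul, hu h₁ h₂]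
    have hv' : reduce N p v * reduce N p (gen (.c s r j) : FreeAlgebra K Gen) =
        if w.1 = A ∧ w.2 = p ∧ r = p + 1 then
          reduce N p (gen (A.edge.move p (p + 1)) * gen (.c s r j)) else 0 := by
      rcases lt_or_ge p r with h | h
      · rw [hv h₁ h]
        by_cases hw' : w.1 = A ∧ w.2 = p ∧ r = p + 1
        · simp [hw', hAB]
        · simp [hw', hAB]
      · rw [hname h h₂, if_neg (by omega), mul_zero]
    rw [hv']
    by_cases hwA : w.1 = A
    · simp only [hwA, true_and, if_true]
      have e₁ : crossDone m (r + 1) j w.2 p ↔ crossDone m r j w.2 p := by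
        grind [crossDone]
      by_cases hw' : w.2 = p ∧ r = p + 1
      · obtain ⟨h, rfl⟩ := hw'
        simp only [e₁]
        simp [crossDone, h, hr]
        abel
      · have e₂ : (w.2 = p ∧ crossDone m (r + 1) j (p + 1) j) ↔
            (w.2 = p ∧ crossDone m r j (p + 1) j) := by
          grind [crossDone]
        simp only [e₁, e₂, hw', if_false, add_zero]
    · simp [hwA]
  · intro w hw u hu h₁ h₂
    simpa [hAB] using hu h₁ h₂
  · intro w hw u hu h₁ h₂
    simpa [hAB.symm] using hu h₁ h₂
  · intro w hw u v hu hv h₁ h₂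
    simp only [CrossRel] at hu hv h₁ h₂
    rw [map_sub, map_smul, map_mul, hu h₁ h₂]
    have hv' : reduce N p (gen (.c s r j) : FreeAlgebra K Gen) * reduce N p v =
        if w.1 = B ∧ j = p ∧ w.2 = p + 1 then
          reduce N p (gen (.c s r p) * gen (B.edge.move p (p + 1))) else 0 := by
      rcases lt_or_ge p j with h | h
      · rw [hname h₁ h, if_neg (by omega), zero_mul]
      · rw [hv h h₂]
        by_cases hw' : w.1 = B ∧ j = p ∧ w.2 = p + 1
        · simp [hw', hAB.symm]
        · simp [hw', hAB.symm]
          intro h h' h''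
          exact absurd ⟨h.symm, h', h''⟩ hw'
    rw [hv']
    by_cases hwB : w.1 = B
    · simp only [hwB, true_and, if_true]
      have e₁ : r = p ∧ crossDone m (r + 1) j (p + 1) w.2 ↔
          r = p ∧ crossDone m r j (p + 1) w.2 := by
        grind [crossDone]
      simp only [e₁]
      by_cases hw' : j = p ∧ w.2 = p + 1
      · obtain ⟨rfl, h⟩ := hw'
        simp [crossDone, h, hr]
      · have e₂ : (w.2 = p + 1 ∧ crossDone m (r + 1) j r p) ↔
            (w.2 = p + 1 ∧ crossDone m r j r p) := by
          grind [crossDone]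
        simp only [e₂, hw', if_false, smul_zero, sub_zero]
    · simp [hwB]
  · intro w hw w' hw' u hu h₁ h₂
    simp only [CrossRel] at hu ⊢
    rw [hu h₁ h₂]
    by_cases h : w.1 = A ∧ w'.1 = B
    · have k₁ : w.2 ≠ r := by
        rcases List.mem_append.1 hw with hw | hw
        · exact ((hpre _ hw).1 h.1).ne
        · exact ((hpost _ hw).1 h.1).ne'
      have k₂ : w'.2 ≠ j := by
        rcases List.mem_append.1 hw' with hw | hw
        · exact ((hpre _ hw).2 h.2).ne
        · exact ((hpost _ hw).2 h.2).ne'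
      have e₁ : crossDone m (r + 1) j (p + 1) w'.2 ↔ crossDone m r j (p + 1) w'.2 := by
        grind [crossDone]
      have e₂ : crossDone m (r + 1) j w.2 p ↔ crossDone m r j w.2 p := by
        grind [crossDone]
      simp only [e₁, e₂]
    · rw [if_neg h, if_neg h]

/-- The `m`-copy of a crossing. -/
lemma Tracks.crossing_copies {p m s : ℕ} {A B : Label} {L L' : List Label} {F : FrontState K}
    (hnd : (L ++ A :: B :: L').Nodup)
    (H : Tracks F (blocks (L ++ A :: B :: L') m) (Unital N p)) :
    Tracks (((Slice.crossing L.length).copies m s).foldl FrontState.step F)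
      (blocks (L ++ B :: A :: L') m) (Unital N p) ∧
    ∀ i j, i < m → j < m →
      (((Slice.crossing L.length).copies m s).foldl FrontState.step F).deg (.c s i j)
        = A.pot - B.pot ∧
      CrossDif N p s A B i j
        ((((Slice.crossing L.length).copies m s).foldl FrontState.step F).dif (.c s i j)) := by
  have hAB : A ≠ B := by
    rintro rfl
    simp [List.nodup_append] at hnd
  have hL : ∀ w ∈ blocks L m, w.1 ≠ A ∧ w.1 ≠ B := by
    intro w hw
    rw [mem_blocks] at hw
    rw [List.nodup_append] at hnd
    exact ⟨hnd.2.2 _ hw.1 _ (by simp), hnd.2.2 _ hw.1 _ (by simp)⟩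
  have hL' : ∀ w ∈ blocks L' m, w.1 ≠ A ∧ w.1 ≠ B := by
    intro w hw
    rw [mem_blocks] at hw
    constructor <;> rintro rfl <;> simp [List.nodup_append, hw] at hnd
  have key := foldl_range_induction (n := m) (s := F)
    (f := fun F j => List.foldl FrontState.step F ((List.range m).map fun t =>
        .cross (L.length * m + (m + j - 1 - t)) (.c s (m - 1 - t) j)))
    (P := fun j F => Tracks F (blocks L m ++ (List.range j).map (B, ·) ++
      (List.range m).map (A, ·) ++ (List.range' j (m - j)).map (B, ·) ++ blocks L' m)
      (CrossRel N p s A B (crossDone m m j)) ∧ ∀ i j', crossDone m m j i j' →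
      F.deg (.c s i j') = A.pot - B.pot ∧ CrossDif N p s A B i j' (F.dif (.c s i j'))) ?_ ?_
  · rw [Slice.copies, List.foldl_flatMap]
    set F₁ := List.foldl _ F _
    refine ⟨?_, fun i j hi hj => key.2 i j ⟨hi, .inl hj⟩⟩
    have := key.1
    simp only [Nat.sub_self, List.range'_zero, List.map_nil, List.append_nil] at this
    have e : blocks (L ++ B :: A :: L') m = blocks L m ++ (List.range m).map (B, ·) ++
        (List.range m).map (A, ·) ++ blocks L' m := by
      simp [blocks_cons]
    rw [e]
    refine this.mono ?_
    -- At the end all copies of `B` lie above all copies of `A`, so no ordered pair of positions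
    -- sees the exceptional terms.
    have hpw : (blocks L m ++ (List.range m).map (B, ·) ++
        (List.range m).map (A, ·) ++ blocks L' m).Pairwise fun x y => ¬ (x.1 = A ∧ y.1 = B) := by
      have h₁ : ∀ a b, (a, b) ∈ blocks L m → a ≠ A ∧ a ≠ B := fun a b h => hL _ h
      have h₂ : ∀ a b, (a, b) ∈ blocks L' m → a ≠ A ∧ a ≠ B := fun a b h => hL' _ h
      simp only [List.pairwise_append, List.pairwise_map, List.mem_append, List.mem_map,
        List.mem_range, Prod.forall]
      refine ⟨⟨⟨?_, ?_, ?_⟩, ?_, ?_⟩, ?_, ?_⟩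
      · exact List.Pairwise.imp_of_mem (R := fun _ _ => True)
          (fun {x y} hx hy _ h => (hL _ hx).1 h.1) (List.pairwise_of_forall fun _ _ => trivial)
      · exact List.pairwise_of_forall fun _ _ h => hAB h.1.symm
      · rintro a b h _ _ _ ⟨h', -⟩
        exact (h₁ a b h).1 h'
      · exact List.pairwise_of_forall fun _ _ h => hAB h.2
      · rintro a b _ c d ⟨i, _, h⟩ ⟨_, h'⟩
        simp_all
      · exact List.Pairwise.imp_of_mem (R := fun _ _ => True)
          (fun {x y} hx hy _ h => (hL' _ hx).1 h.1) (List.pairwise_of_forall fun _ _ => trivial)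
      · rintro a b _ c d h ⟨_, h'⟩
        exact (h₂ c d h).2 h'
    refine hpw.imp ?_
    intro x y hxy v hv h₁ h₂
    simpa [hxy] using hv h₁ h₂
  · simp only [List.range_zero, List.map_nil, List.append_nil, Nat.sub_zero,
      ← List.range_eq_range']
    refine ⟨?_, fun i j h => absurd h (by grind [crossDone])⟩
    have e : blocks (L ++ A :: B :: L') m = blocks L m ++ (List.range m).map (A, ·) ++
        (List.range m).map (B, ·) ++ blocks L' m := by
      simp [blocks_cons]
    rw [e] at H
    refine H.mono_of_mem ?_
    intro x _ y _ v hv h₁ h₂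
    have e₁ : ¬ crossDone m m 0 (p + 1) y.2 := by grind [crossDone]
    have e₂ : ¬ crossDone m m 0 x.2 p := by grind [crossDone]
    rw [hv h₁ h₂]
    by_cases h : x.1 = A ∧ y.1 = B
    · simp [h, hAB, e₁, e₂]
    · simp [h]
  · intro j hj F HF
    have e : ∀ t ∈ List.range m, (NamedSlice.cross (L.length * m + (m + j - 1 - t))
        (.c s (m - 1 - t) j)) = .cross (L.length * m + j + (m - 1 - t)) (.c s (m - 1 - t) j) := by
      intro t ht
      rw [List.mem_range] at ht
      congr 1
      omega
    rw [List.map_congr_left e]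
    have := sweep_induction (q := L.length * m + j) (n := m) (F := F)
      (name := fun r => .c s r j) (fun r F => Tracks F (blocks L m ++ (List.range j).map (B, ·) ++
      (List.range r).map (A, ·) ++ (B, j) :: ((List.range' r (m - r)).map (A, ·) ++
      (List.range' (j + 1) (m - (j + 1))).map (B, ·) ++ blocks L' m))
      (CrossRel N p s A B (crossDone m r j)) ∧ ∀ i j', crossDone m r j i j' →
      F.deg (.c s i j') = A.pot - B.pot ∧ CrossDif N p s A B i j' (F.dif (.c s i j'))) ?_ ?_
    -- The end of the sweep of copy `j` is the beginning of that of copy `j + 1`.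
    · have e : crossDone m 0 j = crossDone m m (j + 1) := by
        funext i j'
        simp only [crossDone, eq_iff_iff]
        omega
      rw [e] at this
      refine ⟨?_, this.2⟩
      convert this.1 using 1
      simp [List.range_succ, List.range_eq_range']
    · refine ⟨?_, HF.2⟩
      simpa [range'_sub hj] using HF.1
    · rintro r hr F ⟨HF, hF⟩
      have HF' : Tracks F ((blocks L m ++ (List.range j).map (B, ·) ++ (List.range r).map (A, ·)) ++
          (A, r) :: (B, j) :: ((List.range' (r + 1) (m - (r + 1))).map (A, ·) ++
        (List.range' (j + 1) (m - (j + 1))).map (B, ·) ++ blocks L' m))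
        (CrossRel N p s A B (crossDone m (r + 1) j)) := by
        simpa [List.range_succ] using HF
      have hlen : (blocks L m ++ (List.range j).map (B, ·) ++ (List.range r).map (A, ·)).length
          = L.length * m + j + r := by simp [add_assoc]
      have hstep := crossRel_step hAB hr hj ?_ ?_ HF'
      · have hdeg := HF'.cross_deg
        have hdif := HF'.cross_rel
        rw [hlen] at hstep hdeg hdif
        refine ⟨?_, ?_⟩
        · simpa [range'_sub hr] using hstep
        · intro i j' hij
          by_cases hc : i = r ∧ j' = j
          · obtain ⟨rfl, rfl⟩ := hc
            simp only [FrontState.cross, Function.update_self]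
            refine ⟨hdeg, fun h₁ h₂ => ?_⟩
            rw [hdif h₁ h₂]
            have e₁ : i = p ∧ crossDone m (i + 1) j' (p + 1) j' ↔ i = p := by
              grind [crossDone]
            have e₂ : j' = p + 1 ∧ crossDone m (i + 1) j' i p ↔ j' = p + 1 := by
              grind [crossDone]
            simp only [e₁, e₂, and_self, if_true]
          · have hne : Gen.c s i j' ≠ .c s r j := by
              simpa using hc
            simp only [FrontState.cross, Function.update_of_ne hne]
            refine hF i j' ?_
            simp only [crossDone] at hij ⊢
            omega
      · intro w hw
        simp only [List.mem_append, List.mem_map, List.mem_range] at hw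
        rcases hw with (hw | ⟨i, hi, rfl⟩) | ⟨i, hi, rfl⟩
        · simp [hL w hw]
        · simp [hAB.symm, hi]
        · simp [hAB, hi]
      · intro w hw
        simp only [List.mem_append, List.mem_map, List.mem_range'_1] at hw
        rcases hw with (⟨i, hi, rfl⟩ | ⟨i, hi, rfl⟩) | hw
        · simp [hAB]; omega
        · simp [hAB.symm]; omega
        · simp [hL' w hw]

end Crossing

/-! ## Left cusps of front copies -/

section LeftCusp

/-- The upper strand of the left cusp `s`, of potential `d`. -/
def upper (s : ℕ) (d : ℤ) : Label := ⟨.y s 0 1, false, d⟩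

/-- The lower strand of the left cusp `s`, whose upper strand has potential `d`. -/
def lower (s : ℕ) (d : ℤ) : Label := ⟨.y s 0 1, true, d - 1⟩

lemma upper_ne_lower (s : ℕ) (d : ℤ) : upper s d ≠ lower s d := by
  simp [upper, lower]

variable (N) in
/-- The half disks during the crossings next to the copies of the left cusp `s` with strands `U`
and `D`, when the crossings in `δ` have been passed. -/
def CuspRel (p s : ℕ) (U D : Label) (δ : ℕ → ℕ → Prop) (x y : Label × ℕ)
    (v : FreeAlgebra K Gen) : Prop :=
  if x.1 = U then
    if y.1 = U then v = onlyIf (δ x.2 y.2) (gen (.y s x.2 y.2))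
    else v = onlyIf (y.1 = D ∧ x.2 = y.2) 1
  else if x.1 = D then
    if y.1 = U then
      v = ∑ t ∈ Finset.Ioo x.2 y.2, onlyIf (δ t y.2) (gen (.y s x.2 t) * gen (.y s t y.2))
    else v = onlyIf (y.1 = D ∧ δ x.2 y.2) (gen (.y s x.2 y.2))
  else if y.1 = U ∨ y.1 = D then v = 0
  else Unital N p x y v

/-- The crossings passed before the upper strand of copy `j` meets the lower one of copy `r - 1`. -/
def cuspDone (r j i j' : ℕ) : Prop := i < j' ∧ (j' < j ∨ (j' = j ∧ r ≤ i))

/-- The differential of the crossing of copies `i` and `j`. -/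
def CuspDif (s i j : ℕ) (v : FreeAlgebra K Gen) : Prop :=
  v = ∑ t ∈ Finset.Ioo i j, gen (.y s i t) * gen (.y s t j)

/-- The half disk `1` inside a cusp, multiplied by the crossing `y s r j` of `D_r` and `U_j`,
produces that generator between `U_r` and `U_j` and between `D_r` and `D_j`. The generators from
`D_i` to `D_r`, already present, produce the quadratic terms from `D_i` to `U_j`. The relations are
exact, because they also yield the exact differential of the edge generators. -/
lemma cuspRel_step {p s r j : ℕ} {U D : Label} (hUD : U ≠ D) (hd : D.pot = U.pot - 1) (hr : r < j)
    {pre post : List (Label × ℕ)} {F : FrontState K}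
    (hpre : ∀ w ∈ pre, (w.1 = U → w.2 < j) ∧ (w.1 = D → w.2 < r))
    (hpost : ∀ w ∈ post, (w.1 = U → j < w.2) ∧ (w.1 = D → r < w.2))
    (H : Tracks F (pre ++ (D, r) :: (U, j) :: post) (CuspRel N p s U D (cuspDone (r + 1) j))) :
    Tracks (F.cross pre.length (.y s r j)) (pre ++ (U, j) :: (D, r) :: post)
      (CuspRel N p s U D (cuspDone r j)) := by
  -- The crossing has degree `-1`, so the minus sign in the crossing rule becomes a plus sign.
  have hsg : sg K (D.pot - U.pot) = -1 := by
    rw [hd, show U.pot - 1 - U.pot = -1 by ring]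
    simp [sg]
  have hDU := hUD.symm
  refine H.cross _ ?_ ?_ ?_ ?_ ?_ ?_
  · have : j ≠ r := hr.ne'
    simp [CuspRel, hDU, this]
  · intro w hw u v hu hv
    obtain ⟨h₁, h₂⟩ := hpre w hw
    by_cases hU : w.1 = U
    · have h₁ := h₁ hU
      simp only [CuspRel, hU, if_true, hDU, if_false, true_and] at hu hv ⊢
      subst hu hv
      by_cases h : w.2 = r
      · have e₁ : cuspDone (r + 1) j w.2 j ↔ False := by grind [cuspDone]
        have e₂ : cuspDone r j w.2 j ↔ True := by grind [cuspDone]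
        simp only [e₁, e₂]
        simp [h]
      · have e : cuspDone (r + 1) j w.2 j ↔ cuspDone r j w.2 j := by grind [cuspDone]
        simp [e, h]
    · by_cases hD : w.1 = D
      · have h₂ := h₂ hD
        simp only [CuspRel, hD, if_true, hDU, if_false, true_and] at hu hv ⊢
        subst hu hv
        have e : cuspDone (r + 1) j w.2 r ↔ True := by grind [cuspDone]
        rw [← Finset.sum_erase_add (Finset.Ioo w.2 j) (a := r) _ (by simp; omega),
          ← Finset.sum_erase_add (Finset.Ioo w.2 j) (a := r) _ (by simp; omega)]
        have e₁ : cuspDone (r + 1) j r j ↔ False := by grind [cuspDone]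
        have e₂ : cuspDone r j r j ↔ True := by grind [cuspDone]
        simp only [e, e₁, e₂, onlyIf_true, onlyIf_false, add_zero]
        congr 1
        refine Finset.sum_congr rfl fun t ht => ?_
        have e : cuspDone (r + 1) j t j ↔ cuspDone r j t j := by
          have := Finset.ne_of_mem_erase ht
          grind [cuspDone]
        simp only [e]
      · simp [CuspRel, hU, hD] at hu hv ⊢
        simp [hu, hv]
  · intro w hw u hu
    have e : cuspDone (r + 1) j w.2 r ↔ cuspDone r j w.2 r := by grind [cuspDone]
    simpa [CuspRel, e, hDU] using hu
  · intro w hw u hu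
    have e : w.1 = U → (cuspDone (r + 1) j j w.2 ↔ cuspDone r j j w.2) := by grind [cuspDone]
    simp only [CuspRel, if_true] at hu ⊢
    split_ifs at hu ⊢ with h
    · rwa [← e h]
    · exact hu
  · intro w hw u v hu hv
    obtain ⟨h₁, h₂⟩ := hpost w hw
    simp only [hsg, neg_smul, one_smul, sub_neg_eq_add]
    simp only [CuspRel, if_true, hDU, if_false] at hu hv ⊢
    by_cases hU : w.1 = U
    · have h₁ := h₁ hU
      simp only [hU, if_true] at hu hv ⊢
      subst hu hv
      have e : cuspDone (r + 1) j j w.2 ↔ False := by grind [cuspDone]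
      simp only [e, onlyIf_false, mul_zero, add_zero]
      refine Finset.sum_congr rfl fun t ht => ?_
      have e : cuspDone (r + 1) j t w.2 ↔ cuspDone r j t w.2 := by grind [cuspDone]
      simp only [e]
    · simp only [hU, if_false] at hu hv ⊢
      subst hu hv
      by_cases hD : w.1 = D
      · have h₂ := h₂ hD
        simp only [hD, true_and]
        by_cases h : j = w.2
        · have e₁ : cuspDone (r + 1) j r w.2 ↔ False := by grind [cuspDone]
          have e₂ : cuspDone r j r w.2 ↔ True := by grind [cuspDone]
          simp only [e₁, e₂]
          simp [h]
        · have e : cuspDone (r + 1) j r w.2 ↔ cuspDone r j r w.2 := by grind [cuspDone]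
          simp [e, h]
      · simp [hD]
  · intro w hw w' hw' u hu
    have k₁ : w.1 = U → w.2 ≠ j := by
      intro h
      rcases List.mem_append.1 hw with hw | hw
      · exact ((hpre _ hw).1 h).ne
      · exact ((hpost _ hw).1 h).ne'
    have k₁' : w'.1 = U → w'.2 ≠ j := by
      intro h
      rcases List.mem_append.1 hw' with hw | hw
      · exact ((hpre _ hw).1 h).ne
      · exact ((hpost _ hw).1 h).ne'
    have k₂ : w.1 = D → w.2 ≠ r := by
      intro h
      rcases List.mem_append.1 hw with hw | hw
      · exact ((hpre _ hw).2 h).ne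
      · exact ((hpost _ hw).2 h).ne'
    have e₁ : w'.1 = U → ∀ i, (cuspDone (r + 1) j i w'.2 ↔ cuspDone r j i w'.2) := by
      intro h i
      have := k₁' h
      grind [cuspDone]
    have e₂ : w.1 = D → (cuspDone (r + 1) j w.2 w'.2 ↔ cuspDone r j w.2 w'.2) := by
      intro h
      have := k₂ h
      grind [cuspDone]
    by_cases hU' : w'.1 = U
    · simp only [CuspRel, e₁ hU'] at hu ⊢
      by_cases hD : w.1 = D
      · simpa only [e₂ hD] using hu
      · simpa [hD, hU'] using hu
    · by_cases hD : w.1 = D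
      · simpa only [CuspRel, hU', if_false, e₂ hD] using hu
      · simpa only [CuspRel, hU', hD, if_false] using hu

/-- The `m`-copy of a left cusp. -/
lemma Tracks.leftCusp_copies {p m s : ℕ} {d : ℤ} {L L' : List Label} {F : FrontState K}
    (hU : upper s d ∉ L ++ L') (hD : lower s d ∉ L ++ L')
    (H : Tracks F (blocks (L ++ L') m) (Unital N p)) :
    Tracks (((Slice.leftCusp L.length d).copies m s).foldl FrontState.step F)
      (blocks (L ++ upper s d :: lower s d :: L') m) (Unital N p) ∧
    ∀ i j, i < j → j < m →
      (((Slice.leftCusp L.length d).copies m s).foldl FrontState.step F).deg (.y s i j) = -1 ∧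
      CuspDif s i j
        ((((Slice.leftCusp L.length d).copies m s).foldl FrontState.step F).dif (.y s i j)) := by
  have hUD := upper_ne_lower s d
  have hpot : (lower s d).pot = (upper s d).pot - 1 := rfl
  have hUe : (upper s d).edge = .y s 0 1 := rfl
  have hDe : (lower s d).edge = .y s 0 1 := rfl
  have hUp : (upper s d).pot = d := rfl
  have hDp : (lower s d).pot = d - 1 := rfl
  generalize upper s d = U at *
  generalize lower s d = D at *
  have hDU := hUD.symm
  have hL : ∀ w ∈ blocks L m, w.1 ≠ U ∧ w.1 ≠ D := by
    intro w hw
    rw [mem_blocks] at hw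
    constructor <;> rintro rfl
    · exact hU (List.mem_append_left _ hw.1)
    · exact hD (List.mem_append_left _ hw.1)
  have hL' : ∀ w ∈ blocks L' m, w.1 ≠ U ∧ w.1 ≠ D := by
    intro w hw
    rw [mem_blocks] at hw
    constructor <;> rintro rfl
    · exact hU (List.mem_append_right _ hw.1)
    · exact hD (List.mem_append_right _ hw.1)
  rw [Slice.copies, List.foldl_append, List.foldl_flatMap]
  -- the cusps
  set F₀ := List.foldl _ F _
  have H₀ : Tracks F₀ (blocks L m ++ (List.range m).flatMap (fun i => [(U, i), (D, i)]) ++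
      blocks L' m) (CuspRel N p s U D (cuspDone 0 0)) := by
    have := foldl_range_induction (n := m) (s := F)
      (f := fun F i => F.leftCusp (L.length * m + 2 * i) d)
      (P := fun i F => Tracks F (blocks L m ++ (List.range i).flatMap
        (fun i => [(U, i), (D, i)]) ++ blocks L' m) (CuspRel N p s U D (cuspDone 0 0))) ?_ ?_
    · simp only [F₀, List.foldl_map]
      exact this
    · rw [blocks_append] at H
      simp only [List.range_zero, List.flatMap_nil, List.append_nil]
      refine H.mono_of_mem ?_
      intro x hx y hy v hv
      have hx' : x.1 ≠ U ∧ x.1 ≠ D := (List.mem_append.1 hx).elim (hL x) (hL' x)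
      have hy' : y.1 ≠ U ∧ y.1 ≠ D := (List.mem_append.1 hy).elim (hL y) (hL' y)
      simpa [CuspRel, hx', hy'] using hv
    · intro i hi F HF
      have hlen : (blocks L m ++ (List.range i).flatMap (fun i => [(U, i), (D, i)])).length
          = L.length * m + 2 * i := by
        simp [List.length_flatMap]; ring
      have := leftCusp (x := (U, i)) (y := (D, i)) (d := d) HF hUp hDp
        (R' := CuspRel N p s U D (cuspDone 0 0)) ?_ ?_ ?_ (fun _ _ _ _ _ h => h)
      · rw [hlen] at this
        simpa [List.range_succ] using this
      · simp [CuspRel, hDU]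
      · intro w hw
        rw [List.mem_append] at hw
        rcases hw with hw | hw
        · simp [CuspRel, hL w hw]
        · simp only [List.mem_flatMap, List.mem_range, List.mem_cons, List.not_mem_nil,
            or_false] at hw
          obtain ⟨i', hi', hw⟩ := hw
          have hi₀ : i ≠ 0 := by omega
          rcases hw with rfl | rfl
          · simp [CuspRel, cuspDone, hDU, hi'.ne, hi₀]
          · simp [CuspRel, cuspDone, hDU, hi₀]
      · intro w hw
        simp [CuspRel, hL' w hw, hDU]
  -- the crossings
  have key := foldl_range_induction (n := m) (s := F₀)
    (f := fun F j => List.foldl FrontState.step F ((List.range j).map fun t =>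
        .cross (L.length * m + (2 * j - 1 - t)) (.y s (j - 1 - t) j)))
    (P := fun j F => Tracks F (blocks L m ++ (List.range j).map (U, ·) ++
      (List.range j).map (D, ·) ++ (List.range' j (m - j)).flatMap (fun i => [(U, i), (D, i)]) ++
      blocks L' m)
      (CuspRel N p s U D (cuspDone j j)) ∧ ∀ i j', cuspDone j j i j' →
      F.deg (.y s i j') = -1 ∧ CuspDif s i j' (F.dif (.y s i j'))) ?_ ?_
  · set F₁ := List.foldl _ F₀ _
    refine ⟨?_, fun i j hi hj => key.2 i j ⟨hi, .inl hj⟩⟩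
    have := key.1
    simp only [Nat.sub_self, List.range'_zero, List.flatMap_nil, List.append_nil] at this
    have e : blocks (L ++ U :: D :: L') m = blocks L m ++ (List.range m).map (U, ·) ++
        (List.range m).map (D, ·) ++ blocks L' m := by
      simp [blocks_cons]
    rw [e]
    refine this.mono ?_
    -- In the final order all copies of `U` lie above all copies of `D`, so the quadratic counts
    -- from `D` to `U` drop out.
    have hpw : (blocks L m ++ (List.range m).map (U, ·) ++
        (List.range m).map (D, ·) ++ blocks L' m).Pairwise fun x y => ¬ (x.1 = D ∧ y.1 = U) := by
      have h₁ : ∀ a b, (a, b) ∈ blocks L m → a ≠ U ∧ a ≠ D := fun a b h => hL _ h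
      have h₂ : ∀ a b, (a, b) ∈ blocks L' m → a ≠ U ∧ a ≠ D := fun a b h => hL' _ h
      simp only [List.pairwise_append, List.pairwise_map, List.mem_append, List.mem_map,
        List.mem_range, Prod.forall]
      refine ⟨⟨⟨?_, ?_, ?_⟩, ?_, ?_⟩, ?_, ?_⟩
      · exact List.Pairwise.imp_of_mem (R := fun _ _ => True)
          (fun {x y} hx hy _ h => (hL _ hx).2 h.1) (List.pairwise_of_forall fun _ _ => trivial)
      · exact List.pairwise_of_forall fun _ _ h => hUD h.1
      · rintro a b h _ _ _ ⟨h', -⟩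
        exact (h₁ a b h).2 h'
      · exact List.pairwise_of_forall fun _ _ h => hDU h.2
      · rintro a b _ c d ⟨i, _, h⟩ ⟨_, h'⟩
        simp_all
      · exact List.Pairwise.imp_of_mem (R := fun _ _ => True)
          (fun {x y} hx hy _ h => (hL' _ hx).2 h.1) (List.pairwise_of_forall fun _ _ => trivial)
      · rintro a b _ c d h ⟨_, h'⟩
        exact (h₂ c d h).1 h'
    refine hpw.imp_of_mem ?_
    intro x y hx hy hxy v hv h₁ h₂
    have hy₂ : y.2 < m := by
      rw [← e, mem_blocks] at hy
      exact hy.2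
    have hdone : cuspDone m m x.2 y.2 ↔ True := by grind [cuspDone]
    -- As `x.2 ≤ p < y.2`, the generator skips a copy unless it goes exactly from `p` to `p + 1`.
    have hskip : reduce N p (gen (.y s x.2 y.2) : FreeAlgebra K Gen) =
        if x.2 = p ∧ y.2 = p + 1 then reduce N p (gen (.y s p (p + 1))) else 0 := by
      split_ifs with h
      · rw [h.1, h.2]
      · exact reduce_gen_of_skip (by simp [Gen.row, Gen.col]; omega)
    have hmove : Gen.move p (p + 1) (.y s 0 1) = .y s p (p + 1) := by
      simp [Gen.move, Gen.relabel]
    by_cases hxU : x.1 = U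
    · by_cases hyU : y.1 = U
      · simp only [CuspRel, hxU, hyU, if_true, hdone, onlyIf_true] at hv
        simp [hv, hskip, hxU, hyU, hUe, hmove]
      · have : ¬ x.2 = y.2 := by omega
        simp only [CuspRel, hxU, hyU, if_true, if_false, this, and_false, onlyIf_false] at hv
        rw [hv, map_zero, if_neg]
        rintro ⟨h, -⟩
        exact hyU (by rw [← h, hxU])
    · by_cases hxD : x.1 = D
      · have hyU : y.1 ≠ U := fun h => hxy ⟨hxD, h⟩
        simp only [CuspRel, hxD, hyU, if_true, if_false, hDU, hdone, and_true] at hv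
        by_cases hyD : y.1 = D
        · simp only [hyD, onlyIf_true] at hv
          simp [hv, hskip, hxD, hyD, hDe, hmove]
        · simp only [hyD, onlyIf_false] at hv
          rw [hv, map_zero, if_neg]
          rintro ⟨h, -⟩
          exact hyD (by rw [← h, hxD])
      · simp only [CuspRel, hxU, hxD, if_false] at hv
        split_ifs at hv with hy'
        · rw [hv, map_zero, if_neg]
          rintro ⟨h, -⟩
          rw [← h] at hy'
          exact hy'.elim hxU hxD
        · exact hv h₁ h₂
  · simp only [List.range_zero, List.map_nil, List.append_nil, Nat.sub_zero,
      ← List.range_eq_range']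
    exact ⟨H₀, fun i j h => absurd h (by grind [cuspDone])⟩
  · intro j hj F HF
    have e : ∀ t ∈ List.range j, (NamedSlice.cross (L.length * m + (2 * j - 1 - t))
        (.y s (j - 1 - t) j)) = .cross (L.length * m + j + (j - 1 - t)) (.y s (j - 1 - t) j) := by
      intro t ht
      rw [List.mem_range] at ht
      congr 1
      omega
    rw [List.map_congr_left e]
    have := sweep_induction (q := L.length * m + j) (n := j) (F := F)
      (name := fun r => .y s r j) (fun r F => Tracks F (blocks L m ++ (List.range j).map (U, ·) ++
      (List.range r).map (D, ·) ++ (U, j) :: ((List.range' r (j - r)).map (D, ·) ++ (D, j) ::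
      ((List.range' (j + 1) (m - (j + 1))).flatMap (fun i => [(U, i), (D, i)]) ++ blocks L' m)))
      (CuspRel N p s U D (cuspDone r j)) ∧ ∀ i j', cuspDone r j i j' →
      F.deg (.y s i j') = -1 ∧ CuspDif s i j' (F.dif (.y s i j'))) ?_ ?_
    · have e : cuspDone 0 j = cuspDone (j + 1) (j + 1) := by
        funext i j'
        simp only [cuspDone, eq_iff_iff]
        omega
      rw [e] at this
      refine ⟨?_, this.2⟩
      convert this.1 using 1
      simp [List.range_succ, List.range_eq_range']
    · refine ⟨?_, HF.2⟩
      simpa [range'_sub hj] using HF.1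
    · rintro r hr F ⟨HF, hF⟩
      have HF' : Tracks F ((blocks L m ++ (List.range j).map (U, ·) ++ (List.range r).map (D, ·)) ++
          (D, r) :: (U, j) :: ((List.range' (r + 1) (j - (r + 1))).map (D, ·) ++ (D, j) ::
        ((List.range' (j + 1) (m - (j + 1))).flatMap (fun i => [(U, i), (D, i)]) ++ blocks L' m)))
        (CuspRel N p s U D (cuspDone (r + 1) j)) := by
        simpa [List.range_succ] using HF
      have hlen : (blocks L m ++ (List.range j).map (U, ·) ++ (List.range r).map (D, ·)).length
          = L.length * m + j + r := by simp [add_assoc]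
      have hstep := cuspRel_step hUD hpot hr ?_ ?_ HF'
      · have hdeg := HF'.cross_deg
        have hdif := HF'.cross_rel
        rw [hlen] at hstep hdeg hdif
        refine ⟨?_, ?_⟩
        · simpa [range'_sub hr] using hstep
        · intro i j' hij
          by_cases hc : i = r ∧ j' = j
          · obtain ⟨rfl, rfl⟩ := hc
            simp only [FrontState.cross, Function.update_self]
            refine ⟨by rw [hdeg, hUp, hDp]; ring, ?_⟩
            simp only [CuspRel, hDU, if_false, if_true] at hdif
            rw [hdif]
            refine Finset.sum_congr rfl fun t ht => ?_
            rw [Finset.mem_Ioo] at ht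
            have e : cuspDone (i + 1) j' t j' ↔ True := by grind [cuspDone]
            simp only [e, onlyIf_true]
          · have hne : Gen.y s i j' ≠ .y s r j := by
              simpa using hc
            simp only [FrontState.cross, Function.update_of_ne hne]
            exact hF i j' (by grind [cuspDone])
      · intro w hw
        simp only [List.mem_append, List.mem_map, List.mem_range] at hw
        rcases hw with (hw | ⟨i, hi, rfl⟩) | ⟨i, hi, rfl⟩
        · simp [hL w hw]
        · simp [hUD, hi]
        · simp [hDU, hi]
      · intro w hw
        simp only [List.mem_append, List.mem_cons, List.mem_map, List.mem_flatMap,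
          List.mem_range'_1, List.not_mem_nil, or_false] at hw
        rcases hw with ⟨i, hi, rfl⟩ | rfl | ⟨i, hi, rfl | rfl⟩ | hw
        · simp [hDU]; omega
        · simp [hDU, hr]
        · simp [hUD]; omega
        · simp [hDU]; omega
        · simp [hL' w hw]

end LeftCusp

/-! ## Names of generators -/

/-- The names of generators that may be introduced by a named slice. -/
def NamedSlice.Touches : NamedSlice → Gen → Prop
  | .leftCusp _ _, _ => False
  | .cross _ x, z => z = x
  | .rightCusp _ s i, z => z = .c s i i ∨ ∃ h l, z = .b s i h l
  | .vertex _ p i, z => (∃ h l, z = .v p i h l) ∨ ∃ α β, z = .t p α β i i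

/-- The place of a name: `0` for the left border, `s + 1` for the slice `s`, and none for the
vertices. -/
def Gen.slot : Gen → Option ℕ
  | .k _ _ _ _ => some 0
  | .y s _ _ => some (s + 1)
  | .c s _ _ => some (s + 1)
  | .b s _ _ _ => some (s + 1)
  | .t _ _ _ _ _ => none
  | .v _ _ _ _ => none

lemma FrontState.step_of_not_touches (F : FrontState K) {x : NamedSlice} {z : Gen}
    (h : ¬ x.Touches z) : (F.step x).dif z = F.dif z ∧ (F.step x).deg z = F.deg z := by
  cases x with
  | leftCusp k d => exact ⟨rfl, rfl⟩
  | cross k x =>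
    simp only [NamedSlice.Touches] at h
    simp [FrontState.step, FrontState.cross, h]
  | rightCusp k s i =>
    simp only [NamedSlice.Touches, not_or, not_exists] at h
    obtain ⟨h₁, h₂⟩ := h
    cases z <;> simp_all [FrontState.step, FrontState.rightCusp]
    all_goals grind
  | vertex n p i =>
    simp only [NamedSlice.Touches, not_or, not_exists] at h
    obtain ⟨h₁, h₂⟩ := h
    cases z <;> simp_all [FrontState.step, FrontState.vertex]
    all_goals grind

lemma FrontState.foldl_of_not_touches (F : FrontState K) {l : List NamedSlice} {z : Gen}
    (h : ∀ x ∈ l, ¬ x.Touches z) :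
    (l.foldl FrontState.step F).dif z = F.dif z ∧ (l.foldl FrontState.step F).deg z = F.deg z := by
  induction l generalizing F with
  | nil => exact ⟨rfl, rfl⟩
  | cons x l ih =>
    have h₁ := F.step_of_not_touches (h x (by simp))
    have h₂ := ih (F.step x) fun y hy => h y (by simp [hy])
    exact ⟨h₂.1.trans h₁.1, h₂.2.trans h₁.2⟩

lemma FrontState.gens_subset_step (F : FrontState K) (x : NamedSlice) :
    F.gens ⊆ (F.step x).gens := by
  intro z hz
  cases x with
  | leftCusp k d => exact hz
  | cross k x => exact .inr hz
  | rightCusp k s i => exact .inl (.inr hz)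
  | vertex n p i => exact .inl (.inl hz)

lemma FrontState.gens_subset_foldl (F : FrontState K) (l : List NamedSlice) :
    F.gens ⊆ (l.foldl FrontState.step F).gens := by
  induction l generalizing F with
  | nil => exact subset_rfl
  | cons x l ih => exact (F.gens_subset_step x).trans (ih _)

lemma FrontState.mem_gens_step {F : FrontState K} {x : NamedSlice} {z : Gen}
    (h : z ∈ (F.step x).gens) : z ∈ F.gens ∨ x.Touches z := by
  cases x with
  | leftCusp k d => exact .inl h
  | cross k x => exact h.symm
  | rightCusp k s i =>
    rcases h with (h | h) | ⟨h, l, rfl, _⟩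
    · exact .inr (.inl h)
    · exact .inl h
    · exact .inr (.inr ⟨_, _, rfl⟩)
  | vertex n p i =>
    rcases h with (h | ⟨h, l, rfl, _⟩) | ⟨h, l, rfl, _⟩
    · exact .inl h
    · exact .inr (.inl ⟨_, _, rfl⟩)
    · exact .inr (.inr ⟨_, _, rfl⟩)

lemma FrontState.mem_gens_foldl {F : FrontState K} {l : List NamedSlice} {z : Gen}
    (h : z ∈ (l.foldl FrontState.step F).gens) : z ∈ F.gens ∨ ∃ x ∈ l, x.Touches z := by
  induction l generalizing F with
  | nil => exact .inl h
  | cons x l ih =>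
    rcases ih h with h | ⟨y, hy, h⟩
    · rcases mem_gens_step h with h | h
      · exact .inl h
      · exact .inr ⟨x, by simp, h⟩
    · exact .inr ⟨y, by simp [hy], h⟩

lemma FrontState.mem_gens_foldl_of_mem {F : FrontState K} {l : List NamedSlice} {x : NamedSlice}
    {z : Gen} (hx : x ∈ l) (h : ∀ F : FrontState K, z ∈ (F.step x).gens) :
    z ∈ (l.foldl FrontState.step F).gens := by
  induction l generalizing F with
  | nil => simp at hx
  | cons y l ih =>
    rcases List.mem_cons.1 hx with rfl | hx
    · exact gens_subset_foldl _ l (h F)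
    · exact ih hx

/-- The names introduced by the `m`-copy of a slice. -/
lemma touches_copies {m s : ℕ} {σ : Slice} {x : NamedSlice} {z : Gen} (hx : x ∈ σ.copies m s)
    (h : x.Touches z) :
    match σ with
    | .leftCusp _ _ => ∃ i j, i < j ∧ j < m ∧ z = .y s i j
    | .crossing _ => ∃ i j, i < m ∧ j < m ∧ z = .c s i j
    | .rightCusp _ => (∃ i j, j ≤ i ∧ i < m ∧ z = .c s i j) ∨ ∃ i a l, i < m ∧ z = .b s i a l := by
  cases σ with
  | leftCusp k d =>
    simp only [Slice.copies, List.mem_append, List.mem_map, List.mem_range, List.mem_flatMap] at hx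
    rcases hx with ⟨i, hi, rfl⟩ | ⟨j, hj, t, ht, rfl⟩
    · exact h.elim
    · exact ⟨j - 1 - t, j, by omega, hj, h⟩
  | crossing k =>
    simp only [Slice.copies, List.mem_map, List.mem_range, List.mem_flatMap] at hx
    obtain ⟨j, hj, t, ht, rfl⟩ := hx
    exact ⟨m - 1 - t, j, by omega, hj, h⟩
  | rightCusp k =>
    simp only [Slice.copies, List.mem_append, List.mem_map, List.mem_range, List.mem_flatMap] at hx
    rcases hx with ⟨j, hj, t, ht, rfl⟩ | ⟨i, hi, rfl⟩
    · exact .inl ⟨m - 1 - t, j, by omega, by omega, h⟩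
    · rcases h with h | ⟨a, l, h⟩
      · exact .inl ⟨i, i, le_rfl, hi, h⟩
      · exact .inr ⟨i, a, l, hi, h⟩

lemma slot_of_touches_copies {m s : ℕ} {σ : Slice} {x : NamedSlice} {z : Gen}
    (hx : x ∈ σ.copies m s) (h : x.Touches z) : z.slot = some (s + 1) := by
  have := touches_copies hx h
  cases σ with
  | leftCusp k d => obtain ⟨i, j, _, _, rfl⟩ := this; rfl
  | crossing k => obtain ⟨i, j, _, _, rfl⟩ := this; rfl
  | rightCusp k => obtain ⟨i, j, _, _, rfl⟩ | ⟨i, a, l, _, rfl⟩ := this <;> rfl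

/-- The generators at vertices stay in one copy or lead to a lower-numbered one. Hence vertices
contribute no chords from the first copy to the second. -/
lemma touches_vertexCopies {m n p : ℕ} {x : NamedSlice} {z : Gen} (hx : x ∈ vertexCopies m n p)
    (h : x.Touches z) : z.slot = none ∧ z.col ≤ z.row := by
  simp only [vertexCopies, List.mem_append, List.mem_map, List.mem_range, List.mem_flatMap,
    List.mem_reverse] at hx
  rcases hx with ⟨j, hj, a, ha, u, hu, rfl⟩ | ⟨i, hi, rfl⟩
  · obtain rfl := h
    have : 0 < j := by
      rcases Nat.eq_zero_or_pos j with rfl | h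
      · simp at hu
      · exact h
    exact ⟨rfl, (Nat.mod_lt _ this).le⟩
  · rcases h with ⟨_, _, rfl⟩ | ⟨_, _, rfl⟩ <;> exact ⟨rfl, le_rfl⟩

/-! ### Partial states and the chords of a front -/

namespace NormalFront

variable (K) (T : NormalFront)

/-- The state of the `m`-copy of `T` after the first `s` slices. -/
def stateAt (s m : ℕ) : FrontState K :=
  ((T.slices.take s).zipIdx.flatMap fun x => x.1.copies m x.2).foldl FrontState.step
    (FrontState.init K T.left m)

@[simp] lemma stateAt_zero (m : ℕ) : T.stateAt K 0 m = FrontState.init K T.left m := by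
  simp [stateAt]

variable {T}

lemma stateAt_succ {s : ℕ} {σ : Slice} (h : T.slices[s]? = some σ) (m : ℕ) :
    T.stateAt K (s + 1) m = (σ.copies m s).foldl FrontState.step (T.stateAt K s m) := by
  obtain ⟨hs, rfl⟩ := List.getElem?_eq_some_iff.1 h
  rw [stateAt, stateAt, List.take_succ_eq_append_getElem hs, List.zipIdx_append,
    List.flatMap_append, List.foldl_append]
  simp [hs.le]

variable (T)

lemma state_eq (m : ℕ) : T.state K m =
    (T.vals.zipIdx.flatMap fun v => LegendrianGraph.vertexCopies m v.1 v.2).foldl FrontState.step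
      (T.stateAt K T.slices.length m) := by
  rw [state, NormalFront.copies, List.foldl_append, stateAt, List.take_length]

variable {K T}

lemma stateAt_of_slot_le {s t s' m : ℕ} {z : Gen} (hz : z.slot = some t) (hts : t ≤ s)
    (hss' : s ≤ s') (hs' : s' ≤ T.slices.length) :
    (T.stateAt K s' m).dif z = (T.stateAt K s m).dif z ∧
      (T.stateAt K s' m).deg z = (T.stateAt K s m).deg z := by
  induction s', hss' using Nat.le_induction with
  | base => exact ⟨rfl, rfl⟩
  | succ s' hss' ih =>
    have hσ : T.slices[s']? = some T.slices[s'] := List.getElem?_eq_getElem _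
    rw [stateAt_succ K hσ]
    have := (T.stateAt K s' m).foldl_of_not_touches (l := T.slices[s'].copies m s') (z := z) ?_
    · exact ⟨this.1.trans (ih (by omega)).1, this.2.trans (ih (by omega)).2⟩
    · intro x hx h
      have := slot_of_touches_copies hx h
      rw [hz, Option.some_inj] at this
      omega

/-- The slices on the right of a generator do not change its differential. -/
lemma ce_of_slot_le {s t m : ℕ} {z : Gen} (hz : z.slot = some t) (hts : t ≤ s)
    (hs : s ≤ T.slices.length) :
    (T.ce K m).dif z = (T.stateAt K s m).dif z ∧ (T.ce K m).deg z = (T.stateAt K s m).deg z := by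
  have h₁ := stateAt_of_slot_le (K := K) (m := m) hz hts hs le_rfl
  rw [ce, state_eq]
  have h₂ := (T.stateAt K T.slices.length m).foldl_of_not_touches
    (l := T.vals.zipIdx.flatMap fun v => LegendrianGraph.vertexCopies m v.1 v.2) (z := z) ?_
  · exact ⟨h₂.1.trans h₁.1, h₂.2.trans h₁.2⟩
  · intro x hx h
    obtain ⟨v, _, hx⟩ := List.mem_flatMap.1 hx
    have := (touches_vertexCopies hx h).1
    simp [hz] at this

variable (K T) in
lemma init_gens_subset (m : ℕ) : (FrontState.init K T.left m).gens ⊆ (T.ce K m).gens :=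
  FrontState.gens_subset_foldl _ _

lemma mem_copies {m s : ℕ} {σ : Slice} {x : NamedSlice} (h : T.slices[s]? = some σ)
    (hx : x ∈ σ.copies m s) : x ∈ T.copies m := by
  refine List.mem_append_left _ (List.mem_flatMap.2 ⟨(σ, s), ?_, hx⟩)
  rwa [List.mem_zipIdx_iff_getElem?]

lemma mem_gens_ce {m : ℕ} {z : Gen} (h : z ∈ (T.ce K m).gens) :
    z ∈ (FrontState.init K T.left m).gens ∨
      (∃ (s : ℕ) (σ : Slice), T.slices[s]? = some σ ∧ ∃ x ∈ σ.copies m s, x.Touches z) ∨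
      z.col ≤ z.row := by
  rcases FrontState.mem_gens_foldl h with h | ⟨x, hx, h⟩
  · exact .inl h
  rcases List.mem_append.1 hx with hx | hx
  · obtain ⟨⟨σ, s⟩, hs, hx⟩ := List.mem_flatMap.1 hx
    exact .inr (.inl ⟨s, σ, by rwa [List.mem_zipIdx_iff_getElem?] at hs, x, hx, h⟩)
  · obtain ⟨v, _, hx⟩ := List.mem_flatMap.1 hx
    exact .inr (.inr (touches_vertexCopies hx h).2)

/-- The chords of a front. -/
lemma mem_chords {z : Gen} (h : z ∈ T.chords K) :
    (∃ a b, a ≤ b ∧ b < T.left.n ∧ z = .k a b 0 1) ∨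
    (∃ s k d, T.slices[s]? = some (.leftCusp k d) ∧ z = .y s 0 1) ∨
    ∃ s k, T.slices[s]? = some (.crossing k) ∧ z = .c s 0 1 := by
  obtain ⟨h, hr, hc⟩ := h
  rcases mem_gens_ce h with ⟨a, b, i, j, rfl, hi, hj, hb, hab⟩ | ⟨s, σ, hs, x, hx, h⟩ | h
  · simp only [Gen.row, Gen.col] at hr hc
    subst hr hc
    exact .inl ⟨a, b, by omega, hb, rfl⟩
  · have := touches_copies hx h
    cases σ with
    | leftCusp k d =>
      obtain ⟨i, j, _, _, rfl⟩ := this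
      simp only [Gen.row, Gen.col] at hr hc
      subst hr hc
      exact .inr (.inl ⟨s, k, d, hs, rfl⟩)
    | crossing k =>
      obtain ⟨i, j, _, _, rfl⟩ := this
      simp only [Gen.row, Gen.col] at hr hc
      subst hr hc
      exact .inr (.inr ⟨s, k, hs, rfl⟩)
    | rightCusp k =>
      obtain ⟨i, j, _, _, rfl⟩ | ⟨i, a, l, _, rfl⟩ := this
      all_goals
        simp only [Gen.row, Gen.col] at hr hc
        omega
  · omega

lemma k_mem_chords {a b : ℕ} (hab : a ≤ b) (hb : b < T.left.n) : Gen.k a b 0 1 ∈ T.chords K :=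
  ⟨init_gens_subset K T 2 ⟨a, b, 0, 1, rfl, by omega, by omega, hb, by omega⟩, rfl, rfl⟩

lemma y_mem_chords {s k : ℕ} {d : ℤ} (h : T.slices[s]? = some (.leftCusp k d)) :
    Gen.y s 0 1 ∈ T.chords K := by
  refine ⟨FrontState.mem_gens_foldl_of_mem (x := .cross (k * 2 + 1) (.y s 0 1))
    (mem_copies h ?_) fun _ => .inl rfl, rfl, rfl⟩
  simp [Slice.copies, List.range_succ]

end NormalFront

/-! ## The strands of a front -/

/-- The labels of the strands to the right of the `s`-th slice. -/
def Slice.labels (s : ℕ) : Slice → List Label → List Label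
  | .leftCusp k d, L => L.take k ++ upper s d :: lower s d :: L.drop k
  | .crossing k, L => L.take k ++ ((L.drop k).take 2).reverse ++ L.drop (k + 2)
  | .rightCusp k, L => L.take k ++ L.drop (k + 2)

lemma Slice.labels_crossing (s : ℕ) (A B : Label) (L L' : List Label) :
    Slice.labels s (.crossing L.length) (L ++ A :: B :: L') = L ++ B :: A :: L' := by
  simp [Slice.labels, ← List.drop_drop]

lemma Slice.labels_rightCusp (s : ℕ) (A B : Label) (L L' : List Label) :
    Slice.labels s (.rightCusp L.length) (L ++ A :: B :: L') = L ++ L' := by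
  simp [Slice.labels, ← List.drop_drop]

lemma exists_eq_append_cons_cons {α : Type*} {L : List α} {k : ℕ} (h : k + 1 < L.length) :
    ∃ pre A B post, L = pre ++ A :: B :: post ∧ pre.length = k := by
  refine ⟨L.take k, L[k], L[k + 1], L.drop (k + 2), ?_, by simp; omega⟩
  rw [← List.drop_eq_getElem_cons, ← List.drop_eq_getElem_cons, List.take_append_drop]

lemma Slice.AllFit.fits {l : List Slice} {S : Strands} (h : Slice.AllFit l S) {s : ℕ} {σ : Slice}
    (hσ : l[s]? = some σ) : σ.Fits (Slice.actAll (l.take s) S) := by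
  induction l generalizing S s with
  | nil => simp at hσ
  | cons τ l ih =>
    cases s with
    | zero =>
      obtain rfl : τ = σ := by simpa using hσ
      exact h.1
    | succ s => exact ih h.2 (by simpa using hσ)

/-- A slice of the `1`-copy. -/
def Slice.named (s : ℕ) : Slice → NamedSlice
  | .leftCusp k d => .leftCusp k d
  | .crossing k => .cross k (.c s 0 0)
  | .rightCusp k => .rightCusp k s 0

lemma Slice.copies_one (s : ℕ) (σ : Slice) : σ.copies 1 s = [σ.named s] := by
  cases σ <;> simp [Slice.copies, Slice.named]

lemma vertexCopies_one (n p : ℕ) : vertexCopies 1 n p = [.vertex n p 0] := by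
  simp [vertexCopies]

lemma step_named_strands (F : FrontState K) (s : ℕ) (σ : Slice) :
    (F.step (σ.named s)).strands = σ.act F.strands := by
  cases σ <;> rfl

/-! ### The block structure of front copies -/

namespace NormalFront

variable {T : NormalFront}

/-- The label of a strand of the left border. -/
def leftLabel (T : NormalFront) (a : ℕ) : Label := ⟨.k a a 0 1, false, T.left.mu a⟩

/-- The labels of the strands to the right of the first `s` slices. -/
def labels (T : NormalFront) : ℕ → List Label
  | 0 => (List.range T.left.n).map T.leftLabel
  | s + 1 => match T.slices[s]? with
    | some σ => σ.labels s (T.labels s)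
    | none => T.labels s

lemma labels_succ {s : ℕ} {σ : Slice} (h : T.slices[s]? = some σ) :
    T.labels (s + 1) = σ.labels s (T.labels s) := by
  rw [labels, h]

/-- The set `N` contains the names, at right cusps, of the generators of non-zero degree. -/
def Vanishing (T : NormalFront) (N : Set Gen) (m : ℕ) : Prop :=
  ∀ s k, T.slices[s]? = some (.rightCusp k) →
    ∀ i < m, Gen.c s i i ∈ N ∧ ∀ a l, 2 ≤ l → Gen.b s i a l ∈ N

/-- An edge starting in the left border or in one of the first `s` slices. -/
def IsEdgeBefore (T : NormalFront) (s : ℕ) (e : Gen) : Prop :=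
  (∃ a < T.left.n, e = .k a a 0 1) ∨
    ∃ s' < s, ∃ k d, T.slices[s']? = some (.leftCusp k d) ∧ e = .y s' 0 1

lemma IsEdgeBefore.mem_chords {s : ℕ} {e : Gen} (h : T.IsEdgeBefore s e) :
    e ∈ T.chords K ∧ e.IsEdge := by
  rcases h with ⟨a, ha, rfl⟩ | ⟨s', _, k, d, h, rfl⟩
  · exact ⟨k_mem_chords le_rfl ha, rfl⟩
  · exact ⟨y_mem_chords h, trivial⟩

lemma IsEdgeBefore.mono {s s' : ℕ} (hs : s ≤ s') {e : Gen} (h : T.IsEdgeBefore s e) :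
    T.IsEdgeBefore s' e := by
  rcases h with h | ⟨t, ht, h⟩
  · exact .inl h
  · exact .inr ⟨t, by omega, h⟩

lemma strands_stateAt_one {s : ℕ} (hs : s ≤ T.slices.length) :
    (T.stateAt K s 1).strands = Slice.actAll (T.slices.take s) T.left := by
  induction s with
  | zero => simp [FrontState.init, Slice.actAll]
  | succ s ih =>
    have hσ : T.slices[s]? = some T.slices[s] := List.getElem?_eq_getElem _
    rw [stateAt_succ K hσ, Slice.copies_one, List.foldl_cons, List.foldl_nil, step_named_strands,
      ih (by omega), List.take_succ_eq_append_getElem, Slice.actAll, Slice.actAll,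
      List.foldl_append, List.foldl_cons, List.foldl_nil]

/-- Half disks at the left border are single chords. A chord from a copy `≤ p` to a copy `> p`
joining different strands is not an edge generator; one joining copies of the same strand skips a
copy unless it goes from `p` to `p + 1`. -/
lemma tracks_init {p m : ℕ} :
    Tracks (FrontState.init K T.left m) (blocks (T.labels 0) m) (Unital N p) := by
  have hlen : (blocks (T.labels 0) m).length = T.left.n * m := by simp [labels]
  have key : ∀ P x, (blocks (T.labels 0) m)[P]? = some x →
      P < T.left.n * m ∧ x = (T.leftLabel (P / m), P % m) := by
    intro P x hx
    obtain ⟨hP, -⟩ := List.getElem?_eq_some_iff.1 hx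
    rw [hlen] at hP
    refine ⟨hP, ?_⟩
    have hm : 0 < m := Nat.pos_of_ne_zero (by rintro rfl; simp at hP)
    have hd : P / m < T.left.n := Nat.div_lt_of_lt_mul (by rwa [mul_comm])
    have := getElem?_blocks (L := T.labels 0) (a := P / m) (x := T.leftLabel (P / m))
      (Nat.mod_lt P hm) (by simp [labels, hd])
    rw [mul_comm, Nat.div_add_mod, hx] at this
    simpa using this
  refine ⟨by simp [FrontState.init, labels], ?_, ?_⟩
  · intro P x hx
    obtain ⟨-, rfl⟩ := key P x hx
    rfl
  · intro P Q x y hPQ hx hy h₁ h₂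
    obtain ⟨hP, rfl⟩ := key P x hx
    obtain ⟨hQ, rfl⟩ := key Q y hy
    simp only [FrontState.init, hPQ, hQ, and_self, if_true, Gen.border] at h₁ h₂ ⊢
    have hab : T.leftLabel (P / m) = T.leftLabel (Q / m) ↔ P / m = Q / m := by
      refine ⟨fun h => ?_, fun h => by rw [h]⟩
      have := congrArg Label.edge h
      simp only [leftLabel, Gen.k.injEq] at this
      exact this.1
    simp only [hab]
    split_ifs with h
    · rw [h.1, h.2.1, h.2.2]
      simp [leftLabel, Gen.move, Gen.relabel]
    · by_cases h' : P / m = Q / m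
      · exact reduce_gen_of_skip (by simp only [Gen.row, Gen.col]; omega)
      · exact reduce_gen_of_not_isEdge (by simpa [Gen.IsEdge] using h') h₁ h₂

variable (K T) in
/-- The structure of the canonical copies of a front after the first `s` slices. -/
structure BlockState (s : ℕ) : Prop where
  nodup : (T.labels s).Nodup
  edge : ∀ x ∈ T.labels s, T.IsEdgeBefore s x.edge
  tracks : ∀ N p m, T.Vanishing N m →
    Tracks (T.stateAt K s m) (blocks (T.labels s) m) (Unital N p)

namespace BlockState

lemma strands {s : ℕ} (H : T.BlockState K s) (hs : s ≤ T.slices.length) :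
    (Slice.actAll (T.slices.take s) T.left).n = (T.labels s).length ∧
    ∀ a x, (T.labels s)[a]? = some x →
      (Slice.actAll (T.slices.take s) T.left).mu a = x.pot := by
  -- With `N` the whole set the vanishing condition is empty. Only the number and the potentials of
  -- the strands are used here.
  have h := H.tracks Set.univ 0 1 fun _ _ _ _ _ => ⟨trivial, fun _ _ _ => trivial⟩
  have h₁ := h.n
  have h₂ := h.mu
  rw [strands_stateAt_one hs] at h₁ h₂
  refine ⟨by simpa using h₁, fun a x hx => ?_⟩
  have := getElem?_blocks (m := 1) zero_lt_one hx
  simpa using h₂ _ _ this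

lemma fits {s : ℕ} {σ : Slice} (h : T.slices[s]? = some σ) :
    σ.Fits (Slice.actAll (T.slices.take s) T.left) :=
  T.fit.fits h

lemma leftCusp_decomp {s k : ℕ} {d : ℤ} (H : T.BlockState K s)
    (h : T.slices[s]? = some (.leftCusp k d)) :
    ∃ L L', T.labels s = L ++ L' ∧ L.length = k ∧
      T.labels (s + 1) = L ++ upper s d :: lower s d :: L' ∧
      upper s d ∉ L ++ L' ∧ lower s d ∉ L ++ L' := by
  obtain ⟨hs, -⟩ := List.getElem?_eq_some_iff.1 h
  have hk : k ≤ (T.labels s).length := (H.strands hs.le).1 ▸ fits h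
  have hlen : ((T.labels s).take k).length = k := by simpa using hk
  -- Edges present so far start strictly to the left of slice `s`, so the two new labels are fresh.
  have hnew : ∀ x ∈ T.labels s, x.edge ≠ .y s 0 1 := by
    rintro x hx he
    rcases H.edge x hx with ⟨a, _, h⟩ | ⟨s', hs', _, _, _, h⟩
    · simp [he] at h
    · simp only [he, Gen.y.injEq, and_true] at h
      omega
  refine ⟨(T.labels s).take k, (T.labels s).drop k, by simp, hlen, ?_, ?_, ?_⟩
  · rw [labels_succ h]
    rfl
  · rw [List.take_append_drop]
    exact fun hx => hnew _ hx rfl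
  · rw [List.take_append_drop]
    exact fun hx => hnew _ hx rfl

lemma crossing_decomp {s k : ℕ} (H : T.BlockState K s) (h : T.slices[s]? = some (.crossing k)) :
    ∃ L A B L', T.labels s = L ++ A :: B :: L' ∧ L.length = k ∧
      T.labels (s + 1) = L ++ B :: A :: L' := by
  obtain ⟨hs, -⟩ := List.getElem?_eq_some_iff.1 h
  have hk : k + 1 < (T.labels s).length := (H.strands hs.le).1 ▸ fits h
  obtain ⟨L, A, B, L', hL, rfl⟩ := exists_eq_append_cons_cons hk
  exact ⟨L, A, B, L', hL, rfl, by rw [labels_succ h, hL, Slice.labels_crossing]⟩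

lemma rightCusp_decomp {s k : ℕ} (H : T.BlockState K s) (h : T.slices[s]? = some (.rightCusp k)) :
    ∃ L A B L', T.labels s = L ++ A :: B :: L' ∧ L.length = k ∧ T.labels (s + 1) = L ++ L' := by
  obtain ⟨hs, -⟩ := List.getElem?_eq_some_iff.1 h
  have hk : k + 1 < (T.labels s).length := (H.strands hs.le).1 ▸ (fits h).1
  obtain ⟨L, A, B, L', hL, rfl⟩ := exists_eq_append_cons_cons hk
  exact ⟨L, A, B, L', hL, rfl, by rw [labels_succ h, hL, Slice.labels_rightCusp]⟩

end BlockState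

variable (K T) in
-- Distinctness of the labels is carried along because the slice lemmas rely on crossing or merging
-- strands being different. The two branches of a cusp share their edge generator and are told apart
-- by the field `lower`.
lemma blockState {s : ℕ} (hs : s ≤ T.slices.length) : T.BlockState K s := by
  induction s with
  | zero =>
    refine ⟨?_, ?_, fun N p m _ => by simpa using tracks_init⟩
    · refine List.Nodup.map (fun a b h => ?_) List.nodup_range
      have := congrArg Label.edge h
      simp only [leftLabel, Gen.k.injEq] at this
      exact this.1
    · simp only [labels, List.mem_map, List.mem_range]
      rintro _ ⟨a, ha, rfl⟩
      exact .inl ⟨a, ha, rfl⟩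
  | succ s ih =>
    have H := ih (by omega)
    have hσ : T.slices[s]? = some T.slices[s] := List.getElem?_eq_getElem _
    generalize T.slices[s] = σ at hσ
    have hedge : ∀ x ∈ T.labels s, T.IsEdgeBefore (s + 1) x.edge :=
      fun x hx => (H.edge x hx).mono (by omega)
    have hnd := H.nodup
    have htr := H.tracks
    cases σ with
    | leftCusp k d =>
      obtain ⟨L, L', hL, rfl, hL₁, hU, hD⟩ := H.leftCusp_decomp hσ
      rw [hL] at hnd htr hedge
      refine ⟨?_, ?_, fun N p m hN => ?_⟩
      · rw [hL₁]
        simp only [List.nodup_append, List.nodup_cons, List.mem_append, List.mem_cons]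
          at hnd hU hD ⊢
        have := upper_ne_lower s d
        grind
      · rw [hL₁]
        have he : T.IsEdgeBefore (s + 1) (.y s 0 1) := .inr ⟨s, by omega, _, _, hσ, rfl⟩
        simp only [List.mem_append, List.mem_cons]
        rintro x (hx | rfl | rfl | hx)
        · exact hedge _ (by simp [hx])
        · exact he
        · exact he
        · exact hedge _ (by simp [hx])
      · rw [stateAt_succ K hσ, hL₁]
        exact (Tracks.leftCusp_copies hU hD (htr N p m hN)).1
    | crossing k =>
      obtain ⟨L, A, B, L', hL, rfl, hL₁⟩ := H.crossing_decomp hσ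
      rw [hL] at hnd htr hedge
      refine ⟨?_, ?_, fun N p m hN => ?_⟩
      · rw [hL₁]
        exact (((List.Perm.swap A B L').append_left L).nodup_iff).2 hnd
      · rw [hL₁]
        exact fun x hx => hedge x (((List.Perm.swap A B L').append_left L).mem_iff.1 hx)
      · rw [stateAt_succ K hσ, hL₁]
        exact (Tracks.crossing_copies hnd (htr N p m hN)).1
    | rightCusp k =>
      obtain ⟨L, A, B, L', hL, rfl, hL₁⟩ := H.rightCusp_decomp hσ
      rw [hL] at hnd htr hedge
      have hsub : (L ++ L').Sublist (L ++ A :: B :: L') :=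
        ((List.sublist_cons_self B L').cons A).append_left L
      refine ⟨?_, ?_, fun N p m hN => ?_⟩
      · rw [hL₁]
        exact hnd.sublist hsub
      · rw [hL₁]
        exact fun x hx => hedge x (hsub.subset hx)
      · rw [stateAt_succ K hσ, hL₁]
        exact Tracks.rightCusp_copies (hN s _ hσ) hnd (htr N p m hN)

/-! ## Differentials of chords -/

/-- The differential of a chord `z` from copy `i` to copy `j`, modulo killed generators, in terms
of the edges `e`, `e'` at its ends and its degree `d`. -/
def ChordDif (N : Set Gen) (p : ℕ) (e e' z : Gen) (d : ℤ) (i j : ℕ) (v : FreeAlgebra K Gen) :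
    Prop :=
  i ≤ p → p < j → reduce N p v =
    onlyIf (i = p) (reduce N p (gen (e.move p (p + 1)) * gen (z.move (p + 1) j))) -
    onlyIf (j = p + 1) (sg K d • reduce N p (gen (z.move i p) * gen (e'.move p (p + 1))))

lemma sg_sub_one (d : ℤ) : sg K (d - 1) = -sg K d := by
  simp only [sg, Int.even_sub_one]
  split_ifs <;> simp_all

/-- Only copies of the same strand lie in between, and equal potentials make all signs positive. -/
lemma init_dif_edge (m a i j : ℕ) (hij : i < j) (hj : j < m) :
    (FrontState.init K T.left m).dif (.k a a i j) =
      ∑ t ∈ Finset.Ioo i j, gen (.k a a i t) * gen (.k a a t j) := by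
  have : Finset.Ioo (a * m + i) (a * m + j) = (Finset.Ioo i j).map (addLeftEmbedding (a * m)) := by
    simp
  simp only [FrontState.init]
  rw [this, Finset.sum_map]
  refine Finset.sum_congr rfl fun t ht => ?_
  rw [Finset.mem_Ioo] at ht
  have hm : 0 < m := by omega
  have ediv : ∀ t < m, (a * m + t) / m = a := fun t ht => by
    rw [mul_comm, Nat.mul_add_div hm, Nat.div_eq_of_lt ht, add_zero]
  have emod : ∀ t < m, (a * m + t) % m = t := fun t ht => by
    rw [mul_comm, Nat.mul_add_mod, Nat.mod_eq_of_lt ht]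
  simp [Gen.border, ediv t (by omega), ediv i (by omega), ediv j hj, emod t (by omega),
    emod i (by omega), emod j hj, sg]

/-- The intermediate strand is on a copy `≤ p` or `> p`, so exactly one factor of each product
passes from copies `≤ p` to copies `> p`. That factor survives only as an edge generator, which
leaves copy `p + 1` of `a` or copy `p` of `b` as intermediate strand. -/
lemma init_dif_chord {m p a b i j : ℕ} (hab : a < b) (hi : i < m) (hj : j < m) :
    ChordDif N p (.k a a 0 1) (.k b b 0 1) (.k a b 0 1) (T.left.mu a - T.left.mu b - 1) i j
      ((FrontState.init K T.left m).dif (.k a b i j)) := by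
  intro h₁ h₂
  have hm : 0 < m := by omega
  have ediv : ∀ a, ∀ t < m, (a * m + t) / m = a := fun a t ht => by
    rw [mul_comm, Nat.mul_add_div hm, Nat.div_eq_of_lt ht, add_zero]
  have emod : ∀ a, ∀ t < m, (a * m + t) % m = t := fun a t ht => by
    rw [mul_comm, Nat.mul_add_mod, Nat.mod_eq_of_lt ht]
  have hab' : a * m + m ≤ b * m := by
    have := Nat.mul_le_mul_right m (Nat.succ_le_of_lt hab)
    rwa [Nat.succ_mul] at this
  have hX : ∀ R ∈ Finset.Ioo (a * m + i) (b * m + j),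
      reduce N p (sg K (T.left.mu a - T.left.mu (R / m)) •
        (gen (Gen.border m (a * m + i) R) * gen (Gen.border m R (b * m + j)) :
          FreeAlgebra K Gen)) =
      onlyIf (i = p ∧ R = a * m + (p + 1))
        (reduce N p (gen (.k a a p (p + 1)) * gen (.k a b (p + 1) j))) +
      onlyIf (j = p + 1 ∧ R = b * m + p) (sg K (T.left.mu a - T.left.mu b) •
        reduce N p (gen (.k a b i p) * gen (.k b b p (p + 1)))) := by
    intro R hR
    obtain ⟨c, r, hr, rfl⟩ : ∃ c r, r < m ∧ R = c * m + r :=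
      ⟨R / m, R % m, Nat.mod_lt _ hm, by rw [mul_comm, Nat.div_add_mod]⟩
    have hR' : ∀ c', ∀ r' < m, (c * m + r = c' * m + r' ↔ c = c' ∧ r = r') := by
      intro c' r' hr'
      refine ⟨fun h => ⟨?_, ?_⟩, fun h => by rw [h.1, h.2]⟩
      · rw [← ediv c r hr, h, ediv c' r' hr']
      · rw [← emod c r hr, h, emod c' r' hr']
    simp only [Gen.border, ediv a i hi, ediv b j hj, ediv c r hr, emod a i hi, emod b j hj,
      emod c r hr, hR' a (p + 1) (by omega), hR' b p (by omega)]
    rw [map_smul, map_mul]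
    rcases le_or_gt r p with hrp | hrp
    · have e₁ : ¬ (i = p ∧ c = a ∧ r = p + 1) := by omega
      simp only [e₁, onlyIf_false, zero_add]
      by_cases h : j = p + 1 ∧ c = b ∧ r = p
      · obtain ⟨rfl, rfl, rfl⟩ := h
        simp
      · simp only [h, onlyIf_false]
        have : reduce N p (gen (.k c b r j) : FreeAlgebra K Gen) = 0 := by
          by_cases hcb : c = b
          · exact reduce_gen_of_skip (by simp only [Gen.row, Gen.col]; omega)
          · exact reduce_gen_of_not_isEdge (by simpa [Gen.IsEdge] using hcb) hrp h₂
        rw [this, mul_zero, smul_zero]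
    · have e₁ : ¬ (j = p + 1 ∧ c = b ∧ r = p) := by omega
      simp only [e₁, onlyIf_false, add_zero]
      by_cases h : i = p ∧ c = a ∧ r = p + 1
      · obtain ⟨rfl, rfl, rfl⟩ := h
        simp [sg]
      · simp only [h, onlyIf_false]
        have : reduce N p (gen (.k a c i r) : FreeAlgebra K Gen) = 0 := by
          by_cases hac : a = c
          · exact reduce_gen_of_skip (by simp only [Gen.row, Gen.col]; omega)
          · exact reduce_gen_of_not_isEdge (by simpa [Gen.IsEdge] using hac) h₁ hrp
        rw [this, zero_mul, smul_zero]
  simp only [FrontState.init]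
  -- The degree is the difference of potentials minus one, which turns the second plus sign into the
  -- minus sign of `ChordDif`.
  rw [map_sum, Finset.sum_congr rfl hX, Finset.sum_add_distrib, sg_sub_one]
  congr 1
  · rw [Finset.sum_eq_single_of_mem (a * m + (p + 1)) (by rw [Finset.mem_Ioo]; omega)]
    · simp [Gen.move, Gen.relabel]
    · intro R _ hR
      simp [hR]
  · rw [Finset.sum_eq_single_of_mem (b * m + p) (by rw [Finset.mem_Ioo]; omega)]
    · by_cases h : j = p + 1 <;> simp [Gen.move, Gen.relabel, h]
    · intro R _ hR
      simp [hR]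

/-- The differential of the generators attached to the edges. -/
lemma ce_edge {e : Gen} (he : e ∈ T.chords K) (hE : e.IsEdge) {m i j : ℕ} (hij : i < j)
    (hj : j < m) : (T.ce K m).deg (e.move i j) = -1 ∧
      (T.ce K m).dif (e.move i j) =
        ∑ t ∈ Finset.Ioo i j, gen (e.move i t) * gen (e.move t j) := by
  rcases mem_chords he with ⟨a, b, hab, hb, rfl⟩ | ⟨s, k, d, hs, rfl⟩ | ⟨s, k, hs, rfl⟩
  · obtain rfl : a = b := hE
    simp only [Gen.move, Gen.relabel, if_true, one_ne_zero, if_false]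
    have := ce_of_slot_le (K := K) (T := T) (m := m) (z := .k a a i j) (s := 0) rfl le_rfl
      (Nat.zero_le _)
    rw [this.1, this.2, stateAt_zero]
    exact ⟨by simp [FrontState.init], init_dif_edge m a i j hij hj⟩
  · simp only [Gen.move, Gen.relabel, if_true, one_ne_zero, if_false]
    obtain ⟨hs', -⟩ := List.getElem?_eq_some_iff.1 hs
    have := ce_of_slot_le (K := K) (T := T) (m := m) (z := .y s i j) (s := s + 1) rfl le_rfl hs'
    rw [this.1, this.2, stateAt_succ K hs]
    have H := T.blockState K hs'.le
    obtain ⟨L, L', hL, rfl, hL₁, hU, hD⟩ := H.leftCusp_decomp hs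
    have htr := H.tracks Set.univ 0 m fun _ _ _ _ _ => ⟨trivial, fun _ _ _ => trivial⟩
    rw [hL] at htr
    exact (Tracks.leftCusp_copies hU hD htr).2 i j hij hj
  · exact hE.elim

/-- The differential of the other chords. -/
lemma ce_chord {z : Gen} (hz : z ∈ T.chords K) (hE : ¬ z.IsEdge) :
    ∃ e ∈ T.chords K, e.IsEdge ∧ ∃ e' ∈ T.chords K, e'.IsEdge ∧ ∃ d, ∀ m i j, i < m → j < m →
      (T.ce K m).deg (z.move i j) = d ∧ ∀ N p, T.Vanishing N m →
        ChordDif N p e e' z d i j ((T.ce K m).dif (z.move i j)) := by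
  rcases mem_chords hz with ⟨a, b, hab, hb, rfl⟩ | ⟨s, k, d, hs, rfl⟩ | ⟨s, k, hs, rfl⟩
  · have hab : a < b := lt_of_le_of_ne hab hE
    refine ⟨.k a a 0 1, k_mem_chords le_rfl (by omega), rfl, .k b b 0 1, k_mem_chords le_rfl hb,
      rfl, T.left.mu a - T.left.mu b - 1, fun m i j hi hj => ?_⟩
    have := ce_of_slot_le (K := K) (T := T) (m := m) (z := .k a b i j) (s := 0) rfl le_rfl
      (Nat.zero_le _)
    have hmove : Gen.move i j (.k a b 0 1) = .k a b i j := by simp [Gen.move, Gen.relabel]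
    rw [hmove, this.1, this.2, stateAt_zero]
    exact ⟨rfl, fun N p _ => init_dif_chord hab hi hj⟩
  · exact (hE trivial).elim
  · obtain ⟨hs', -⟩ := List.getElem?_eq_some_iff.1 hs
    have H := T.blockState K hs'.le
    obtain ⟨L, A, B, L', hL, rfl, hL₁⟩ := H.crossing_decomp hs
    have hA := (H.edge A (by simp [hL])).mem_chords (K := K)
    have hB := (H.edge B (by simp [hL])).mem_chords (K := K)
    have hnd := H.nodup
    have htr := H.tracks
    rw [hL] at hnd htr
    refine ⟨_, hA.1, hA.2, _, hB.1, hB.2, A.pot - B.pot, fun m i j hi hj => ?_⟩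
    have := ce_of_slot_le (K := K) (T := T) (m := m) (z := .c s i j) (s := s + 1) rfl le_rfl hs'
    have hmove : Gen.move i j (.c s 0 1) = .c s i j := by simp [Gen.move, Gen.relabel]
    rw [hmove, this.1, this.2, stateAt_succ K hs]
    -- The degree does not involve `N`, so it is read off for the whole set.
    refine ⟨((Tracks.crossing_copies hnd (htr Set.univ 0 m
      fun _ _ _ _ _ => ⟨trivial, fun _ _ _ => trivial⟩)).2 i j hi hj).1, fun N p hN h₁ h₂ => ?_⟩
    rw [((Tracks.crossing_copies hnd (htr N p m hN)).2 i j hi hj).2 h₁ h₂]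
    simp [Gen.move, Gen.relabel]

end NormalFront

/-! ## Augmentations at the right border -/

/-- A strictly upper triangular matrix of degree `1` and square zero, on `n` strands of
potentials `mu`. -/
structure NilSquare (S : Strands) (M : ℕ → ℕ → K) : Prop where
  upper : ∀ P Q, M P Q ≠ 0 → P < Q ∧ Q < S.n ∧ S.mu P - S.mu Q = 1
  sq : ∀ P Q, ∑ R ∈ Finset.range S.n, M P R * M R Q = 0

/-- The position of a strand after the insertion of two strands at `k`. -/
def skip (k x : ℕ) : ℕ := if x < k then x else x + 2

lemma sum_range_skip {k n : ℕ} (h : k ≤ n) (f : ℕ → K) :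
    ∑ R ∈ Finset.range (n + 2), f R =
      ∑ R ∈ Finset.range n, f (skip k R) + f k + f (k + 1) := by
  obtain ⟨m, rfl⟩ := Nat.exists_eq_add_of_le h
  rw [show k + m + 2 = k + (m + 2) by ring, Finset.sum_range_add f k (m + 2),
    Finset.sum_range_add (fun R => f (skip k R)) k m, Finset.sum_range_succ',
    Finset.sum_range_succ']
  have h₁ : ∑ x ∈ Finset.range k, f (skip k x) = ∑ x ∈ Finset.range k, f x :=
    Finset.sum_congr rfl fun x hx => by rw [skip, if_pos (Finset.mem_range.1 hx)]
  have h₂ : ∑ x ∈ Finset.range m, f (skip k (k + x)) =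
      ∑ x ∈ Finset.range m, f (k + (x + 1 + 1)) :=
    Finset.sum_congr rfl fun x hx => by rw [skip, if_neg (by omega)]; congr 1
  rw [h₁, h₂]
  simp only [add_zero, zero_add]
  ring

/-! ### How slices transform a matrix of square zero -/

namespace NilSquare

variable {S : Strands} {M M' : ℕ → ℕ → K} {k : ℕ}

lemma zero_of_le (H : NilSquare S M) {P Q : ℕ} (h : Q ≤ P) : M P Q = 0 := by
  by_contra h'
  have := (H.upper P Q h').1
  omega

/-- `M'` is the direct sum of `M` and a nilpotent Jordan block of size two on the new strands. -/
lemma leftCusp (H : NilSquare S M) {d : ℤ} (hk : k ≤ S.n)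
    (h : ∀ P Q, M' (skip k P) (skip k Q) = M P Q) (h₁ : M' k (k + 1) = 1)
    (hrow : ∀ Q, Q ≠ k + 1 → M' k Q = 0) (hrow' : ∀ Q, M' (k + 1) Q = 0)
    (hcol : ∀ P, M' P k = 0) (hcol' : ∀ P, P ≠ k → M' P (k + 1) = 0) :
    NilSquare ((Slice.leftCusp k d).act S) M' := by
  have cases : ∀ P, P = k ∨ P = k + 1 ∨ ∃ P', P = skip k P' := by
    intro P
    rcases lt_trichotomy P k with h | h | h
    · exact .inr (.inr ⟨P, by rw [skip, if_pos h]⟩)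
    · exact .inl h
    · by_cases h' : P = k + 1
      · exact .inr (.inl h')
      · exact .inr (.inr ⟨P - 2, by rw [skip, if_neg (by omega)]; omega⟩)
  have hne : ∀ P, skip k P ≠ k ∧ skip k P ≠ k + 1 := by
    intro P
    unfold skip
    split_ifs <;> omega
  have hmu : ∀ P, ((Slice.leftCusp k d).act S).mu (skip k P) = S.mu P := by
    intro P
    simp only [Slice.act, skip]
    split_ifs <;> first | omega | simp
  constructor
  · intro P Q hPQ
    rcases cases P with rfl | rfl | ⟨P, rfl⟩
    · by_cases hQ : Q = P + 1
      · subst hQ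
        simp [Slice.act]
        omega
      · exact (hPQ (hrow _ hQ)).elim
    · exact (hPQ (hrow' _)).elim
    · rcases cases Q with rfl | rfl | ⟨Q, rfl⟩
      · exact (hPQ (hcol _)).elim
      · exact (hPQ (hcol' _ (hne P).1)).elim
      · rw [h] at hPQ
        rw [hmu, hmu]
        obtain ⟨h₁, h₂, h₃⟩ := H.upper _ _ hPQ
        refine ⟨?_, ?_, h₃⟩
        · unfold skip
          split_ifs <;> omega
        · simp only [skip, Slice.act]
          split_ifs <;> omega
  · intro P Q
    simp only [Slice.act]
    rw [sum_range_skip hk, hcol, zero_mul, add_zero, hrow', mul_zero, add_zero]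
    rcases cases P with rfl | rfl | ⟨P, rfl⟩
    · exact Finset.sum_eq_zero fun R _ => by rw [hrow _ (hne R).2, zero_mul]
    · exact Finset.sum_eq_zero fun R _ => by rw [hrow', zero_mul]
    · rcases cases Q with rfl | rfl | ⟨Q, rfl⟩
      · exact Finset.sum_eq_zero fun R _ => by rw [hcol, mul_zero]
      · exact Finset.sum_eq_zero fun R _ => by rw [hcol' _ (hne R).1, mul_zero]
      · simp only [h]
        exact H.sq P Q

/-- Up to the transposition, `M'` is (1 − xE) M (1 + xE) with E the matrix unit at `(k, k + 1)`,
hence a conjugate of `M`. The vanishing of `M k (k + 1)` keeps it triangular after the swap, and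
`hx` keeps its degree. -/
lemma cross (H : NilSquare S M) (hk : k + 1 < S.n) {x : K} (h₀ : M k (k + 1) = 0)
    (hx : x ≠ 0 → S.mu k = S.mu (k + 1))
    (h : ∀ P Q, M' (Equiv.swap k (k + 1) P) (Equiv.swap k (k + 1) Q) =
      M P Q + (if Q = k + 1 then M P k * x else 0) - (if P = k then x * M (k + 1) Q else 0)) :
    NilSquare ((Slice.crossing k).act S) M' := by
  have hswap : ∀ P, Equiv.swap k (k + 1) (Equiv.swap k (k + 1) P) = P :=
    fun P => Equiv.swap_apply_self _ _ _
  have surj : ∀ P, ∃ P', P = Equiv.swap k (k + 1) P' := fun P => ⟨_, (hswap P).symm⟩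
  have hlt : ∀ P, Equiv.swap k (k + 1) P < S.n ↔ P < S.n := by
    intro P
    rw [Equiv.swap_apply_def]
    split_ifs <;> omega
  have hdiag : M (k + 1) k = 0 := H.zero_of_le (by omega)
  have hkk : M k k = 0 := H.zero_of_le le_rfl
  have hkk' : M (k + 1) (k + 1) = 0 := H.zero_of_le le_rfl
  constructor
  · intro P Q hPQ
    obtain ⟨P, rfl⟩ := surj P
    obtain ⟨Q, rfl⟩ := surj Q
    simp only [Slice.act, hswap, hlt]
    rw [h] at hPQ
    have key : ∀ P Q, P < Q → ¬ (P = k ∧ Q = k + 1) →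
        Equiv.swap k (k + 1) P < Equiv.swap k (k + 1) Q := by
      intro P Q h₁ h₂
      rw [Equiv.swap_apply_def, Equiv.swap_apply_def]
      split_ifs <;> omega
    by_cases hM : M P Q = 0
    · by_cases hQ : Q = k + 1 ∧ M P k * x ≠ 0
      · obtain ⟨rfl, hQ⟩ := hQ
        have h₁ := H.upper _ _ (left_ne_zero_of_mul hQ)
        have h₂ := hx (right_ne_zero_of_mul hQ)
        exact ⟨key _ _ (by omega) (by omega), by omega, by rw [← h₂]; exact h₁.2.2⟩
      · by_cases hP : P = k ∧ x * M (k + 1) Q ≠ 0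
        · obtain ⟨rfl, hP⟩ := hP
          have h₁ := H.upper _ _ (right_ne_zero_of_mul hP)
          have h₂ := hx (left_ne_zero_of_mul hP)
          exact ⟨key _ _ (by omega) (by omega), by omega, by rw [h₂]; exact h₁.2.2⟩
        · refine (hPQ ?_).elim
          rw [hM]
          split_ifs <;> simp_all
    · have h₁ := H.upper _ _ hM
      refine ⟨key _ _ h₁.1 ?_, h₁.2⟩
      rintro ⟨rfl, rfl⟩
      exact hM h₀
  · intro P Q
    obtain ⟨P, rfl⟩ := surj P
    obtain ⟨Q, rfl⟩ := surj Q
    simp only [Slice.act]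
    rw [← Finset.sum_equiv (s := Finset.range S.n) (Equiv.swap k (k + 1))
      (f := fun R => M' (Equiv.swap k (k + 1) P) (Equiv.swap k (k + 1) R) *
        M' (Equiv.swap k (k + 1) R) (Equiv.swap k (k + 1) Q)) (by simp [hlt]) (fun _ _ => rfl)]
    -- The last two terms cancel in the sum over `R`, reflecting (1 + xE)(1 − xE) = 1; the others
    -- are entries of the square of `M`.
    have e : ∀ R, M' (Equiv.swap k (k + 1) P) (Equiv.swap k (k + 1) R) *
        M' (Equiv.swap k (k + 1) R) (Equiv.swap k (k + 1) Q) =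
        M P R * M R Q + (if Q = k + 1 then x else 0) * (M P R * M R k) -
        (if P = k then x else 0) * (M (k + 1) R * M R Q) -
        (if P = k then x else 0) * (if Q = k + 1 then x else 0) * (M (k + 1) R * M R k) -
        (if R = k then M P k * x * M (k + 1) Q else 0) +
        (if R = k + 1 then M P k * x * M (k + 1) Q else 0) := by
      intro R
      rw [h, h]
      by_cases hR : R = k
      · subst hR
        simp only [hkk, hdiag, (Nat.succ_ne_self R).symm, if_true, if_false]
        split_ifs <;> ring
      · by_cases hR' : R = k + 1
        · subst hR'
          simp only [hkk', hdiag, hR, if_true, if_false]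
          split_ifs <;> ring
        · simp only [hR, hR', if_false]
          split_ifs <;> ring
    rw [Finset.sum_congr rfl fun R _ => e R]
    simp only [Finset.sum_add_distrib, Finset.sum_sub_distrib, ← Finset.mul_sum, H.sq, mul_zero,
      Finset.sum_ite_eq', Finset.mem_range, hk, show k < S.n by omega, if_true]
    ring

/-- This is Gaussian elimination: `-β` inverts the entry at `(k, k + 1)`, and the strands `k`, `k +
1` are cancelled against each other. -/
lemma rightCusp (H : NilSquare S M) (hk : k + 1 < S.n) (hmu : S.mu k = S.mu (k + 1) + 1) {β : K}
    (hβ : M k (k + 1) * β = -1)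
    (h : ∀ P Q, M' P Q = M (skip k P) (skip k Q) + M (skip k P) (k + 1) * β * M k (skip k Q)) :
    NilSquare ((Slice.rightCusp k).act S) M' := by
  have hmu' : ∀ P, ((Slice.rightCusp k).act S).mu P = S.mu (skip k P) := by
    intro P
    simp only [Slice.act, skip]
    split_ifs <;> rfl
  have hkk : M k k = 0 := H.zero_of_le le_rfl
  have hkk' : M (k + 1) (k + 1) = 0 := H.zero_of_le le_rfl
  have hlt : ∀ P Q, skip k P < skip k Q → P < Q := by
    intro P Q
    unfold skip
    split_ifs <;> omega
  have hn : ∀ Q, skip k Q < S.n → Q < S.n - 2 := by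
    intro Q
    unfold skip
    split_ifs <;> omega
  constructor
  · intro P Q hPQ
    rw [h] at hPQ
    rw [hmu', hmu']
    by_cases hM : M (skip k P) (skip k Q) = 0
    · rw [hM, zero_add] at hPQ
      have h₁ := H.upper _ _ (left_ne_zero_of_mul (left_ne_zero_of_mul hPQ))
      have h₂ := H.upper _ _ (right_ne_zero_of_mul hPQ)
      refine ⟨?_, hn _ h₂.2.1, by linarith [h₁.2.2, h₂.2.2]⟩
      have h₃ := h₁.1
      have h₄ := h₂.1
      unfold skip at h₃ h₄
      split_ifs at h₃ h₄ <;> omega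
    · have h₁ := H.upper _ _ hM
      exact ⟨hlt _ _ h₁.1, hn _ h₁.2.1, h₁.2.2⟩
  · intro P Q
    obtain ⟨n, hn⟩ : ∃ n, S.n = n + 2 := ⟨S.n - 2, by omega⟩
    have hs := fun P Q => sum_range_skip (show k ≤ n by omega) fun R =>
      (M (skip k P) R + M (skip k P) (k + 1) * β * M k R) *
      (M R (skip k Q) + M R (k + 1) * β * M k (skip k Q))
    -- Summed over all strands, the corrected products expand into entries of the square of `M`. The
    -- summands `R = k` and `R = k + 1` vanish by the choice of `β`, which leaves the sum over the
    -- remaining strands.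
    have hz : ∑ R ∈ Finset.range (n + 2),
        (M (skip k P) R + M (skip k P) (k + 1) * β * M k R) *
        (M R (skip k Q) + M R (k + 1) * β * M k (skip k Q)) = 0 := by
      have e : ∀ R, (M (skip k P) R + M (skip k P) (k + 1) * β * M k R) *
          (M R (skip k Q) + M R (k + 1) * β * M k (skip k Q)) =
          M (skip k P) R * M R (skip k Q) +
          (M (skip k P) (k + 1) * β) * (M k R * M R (skip k Q)) +
          (β * M k (skip k Q)) * (M (skip k P) R * M R (k + 1)) +
          (M (skip k P) (k + 1) * β * β * M k (skip k Q)) * (M k R * M R (k + 1)) := by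
        intro R
        ring
      rw [Finset.sum_congr rfl fun R _ => e R]
      simp only [Finset.sum_add_distrib, ← Finset.mul_sum, ← hn, H.sq]
      ring
    rw [hs] at hz
    have h₁ : M k (skip k Q) + M k (k + 1) * β * M k (skip k Q) = 0 := by
      rw [hβ]; ring
    have h₂ : M (skip k P) (k + 1) + M (skip k P) (k + 1) * β * M k (k + 1) = 0 := by
      rw [mul_assoc, mul_comm β, hβ]; ring
    rw [h₁, h₂] at hz
    simp only [Slice.act, hn, Nat.add_sub_cancel, h]
    linear_combination hz

/-- The lower right corner of a product of upper triangular matrices is the product of the corners.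
-/
lemma vertex (H : NilSquare S M) {n : ℕ} (hn : n ≤ S.n)
    (h : ∀ P Q, M' P Q = M (P + n) (Q + n)) :
    NilSquare ⟨S.n - n, fun x => S.mu (x + n)⟩ M' := by
  constructor
  · intro P Q hPQ
    rw [h] at hPQ
    obtain ⟨h₁, h₂, h₃⟩ := H.upper _ _ hPQ
    exact ⟨by omega, by simp only; omega, h₃⟩
  · intro P Q
    have := H.sq (P + n) (Q + n)
    rw [show S.n = n + (S.n - n) by omega, Finset.sum_range_add, Finset.sum_eq_zero, zero_add]
      at this
    · simpa only [h, add_comm n] using this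
    · intro R hR
      rw [H.zero_of_le (Q := R) (by rw [Finset.mem_range] at hR; omega), zero_mul]

end NilSquare

/-- The values of an augmentation on the half disks of a front. -/
def FrontState.mat (F : FrontState K) (ε : Gen → K) (P Q : ℕ) : K :=
  if P < Q ∧ Q < F.strands.n then FreeAlgebra.lift K ε (F.g P Q) else 0

/-! ### Augmented half disk counts after one slice -/

namespace FrontState

variable {F : FrontState K} {ε : Gen → K}

lemma mat_leftCusp {k : ℕ} {d : ℤ} (H : NilSquare F.strands (F.mat ε)) (hk : k ≤ F.strands.n) :
    NilSquare (F.leftCusp k d).strands ((F.leftCusp k d).mat ε) := by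
  refine H.leftCusp hk ?_ ?_ ?_ ?_ ?_ ?_
  · intro P Q
    have e : (skip k P < skip k Q ∧ skip k Q < F.strands.n + 2) ↔ (P < Q ∧ Q < F.strands.n) := by
      unfold skip
      split_ifs <;> omega
    have hne : ∀ P, skip k P ≠ k ∧ skip k P ≠ k + 1 := by
      intro P
      unfold skip
      split_ifs <;> omega
    have hs : ∀ P, (if skip k P < k then skip k P else skip k P - 2) = P := by
      intro P
      unfold skip
      split_ifs <;> omega
    simp only [mat, FrontState.leftCusp, Slice.act, e, hne, false_and, or_self, if_false, hs]
  · simp only [mat, FrontState.leftCusp, Slice.act, and_self, if_true, map_one]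
    exact if_pos (by omega)
  · intro Q hQ
    simp [mat, FrontState.leftCusp, hQ]
  · intro Q
    simp [mat, FrontState.leftCusp]
  · intro P
    simp [mat, FrontState.leftCusp]
  · intro P hP
    simp [mat, FrontState.leftCusp, hP]

lemma mat_cross {k : ℕ} {z : Gen} (H : NilSquare F.strands (F.mat ε)) (hk : k + 1 < F.strands.n)
    (h₀ : FreeAlgebra.lift K ε (F.g k (k + 1)) = 0)
    (hz : ε z ≠ 0 → F.strands.mu k - F.strands.mu (k + 1) = 0) :
    NilSquare (F.cross k z).strands ((F.cross k z).mat ε) := by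
  refine H.cross (x := ε z) hk (by simp [mat, h₀]) (fun h => by linarith [hz h]) ?_
  -- The sign in the crossing rule is invisible, since `ε z` can be nonzero only in degree `0`.
  have hsg : sg K (F.strands.mu k - F.strands.mu (k + 1)) * ε z = ε z := by
    by_cases h : ε z = 0
    · simp [h]
    · rw [hz h]
      simp [sg]
  intro P Q
  have hzero : ∀ P Q, Q ≤ P → F.mat ε P Q = 0 := fun P Q h => H.zero_of_le h
  have hval : ∀ P Q, P < Q → Q < F.strands.n →
      F.mat ε P Q = FreeAlgebra.lift K ε (F.g P Q) := fun P Q h h' => if_pos ⟨h, h'⟩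
  have hval' : ∀ P Q, P < Q → Q < F.strands.n → (F.cross k z).mat ε P Q =
      FreeAlgebra.lift K ε ((F.cross k z).g P Q) := fun P Q h h' => if_pos ⟨h, h'⟩
  have hzero' : ∀ P Q, Q ≤ P → (F.cross k z).mat ε P Q = 0 := fun P Q h => if_neg (by omega)
  have hbig : ∀ P Q, F.strands.n ≤ Q → F.mat ε P Q = 0 := fun P Q h => if_neg (by omega)
  have hbig' : ∀ P Q, F.strands.n ≤ Q → (F.cross k z).mat ε P Q = 0 :=
    fun P Q h => if_neg (by simp only [FrontState.cross, Slice.act]; omega)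
  by_cases hQn : F.strands.n ≤ Q
  · have : Equiv.swap k (k + 1) Q = Q := Equiv.swap_apply_of_ne_of_ne (by omega) (by omega)
    rw [this, hbig' _ _ hQn, hbig _ _ hQn, hbig _ _ hQn, if_neg (by omega)]
    simp
  rw [not_le] at hQn
  by_cases hPk : P = k
  · subst hPk
    rw [Equiv.swap_apply_left]
    by_cases hQk : Q = P
    · subst hQk
      rw [Equiv.swap_apply_left, hzero' _ _ le_rfl, hzero _ _ le_rfl, hzero (Q + 1) _ (by omega)]
      simp
    by_cases hQk' : Q = P + 1
    · subst hQk'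
      rw [Equiv.swap_apply_right, hzero' _ _ (by omega), hval _ _ (by omega) hQn, h₀,
        hzero _ _ le_rfl, hzero _ _ le_rfl]
      simp
    rw [Equiv.swap_apply_of_ne_of_ne hQk hQk', if_neg hQk', if_pos rfl]
    rcases lt_or_ge Q P with h | h
    · rw [hzero' _ _ (by omega), hzero _ _ (by omega), hzero _ _ (by omega)]
      simp
    · rw [hval' _ _ (by omega) hQn, hval _ _ (by omega) hQn, hval _ _ (by omega) hQn]
      have h₁ : P + 1 < Q := by omega
      simp [FrontState.cross, hQk, hQk', h₁, hsg, ← mul_assoc]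
  by_cases hPk' : P = k + 1
  · subst hPk'
    rw [Equiv.swap_apply_right, if_neg hPk]
    by_cases hQk : Q = k
    · subst hQk
      rw [Equiv.swap_apply_left, hval' _ _ (by omega) (by omega), hzero _ _ (by omega)]
      simp [FrontState.cross]
    by_cases hQk' : Q = k + 1
    · subst hQk'
      rw [Equiv.swap_apply_right, hzero' _ _ (by omega), hzero _ _ (by omega),
        hzero _ _ (by omega)]
      simp
    rw [Equiv.swap_apply_of_ne_of_ne hQk hQk', if_neg hQk']
    rcases lt_or_ge Q k with h | h
    · rw [hzero' _ _ (by omega), hzero _ _ (by omega)]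
      simp
    · rw [hval' _ _ (by omega) hQn, hval _ _ (by omega) hQn]
      have h₁ : k + 1 < Q := by omega
      simp [FrontState.cross, hQk, hQk', h₁]
  rw [Equiv.swap_apply_of_ne_of_ne hPk hPk', if_neg hPk]
  by_cases hQk : Q = k
  · subst hQk
    rw [Equiv.swap_apply_left]
    rcases lt_or_ge P Q with h | h
    · rw [hval' _ _ (by omega) (by omega), hval _ _ (by omega) (by omega)]
      simp [FrontState.cross, h, hPk]
    · rw [hzero' _ _ (by omega), hzero _ _ (by omega)]
      simp
  by_cases hQk' : Q = k + 1
  · subst hQk'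
    rw [Equiv.swap_apply_right]
    rcases lt_or_ge P k with h | h
    · rw [hval' _ _ (by omega) (by omega), hval _ _ (by omega) (by omega),
        hval _ _ (by omega) (by omega)]
      simp [FrontState.cross, h, hPk]
    · rw [hzero' _ _ (by omega), hzero _ _ (by omega), hzero _ _ (by omega)]
      simp
  rw [Equiv.swap_apply_of_ne_of_ne hQk hQk', if_neg hQk']
  rcases lt_or_ge P Q with h | h
  · rw [hval' _ _ h hQn, hval _ _ h hQn]
    simp [FrontState.cross, hPk, hPk', hQk, hQk']
  · rw [hzero' _ _ h, hzero _ _ h]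
    simp

/-- All added terms containing the kink or a basepoint generator of length at least two die. What
remains is the elimination formula with the value of b_{2,1} as `β`. -/
lemma mat_rightCusp {k s i : ℕ} (H : NilSquare F.strands (F.mat ε)) (hk : k + 1 < F.strands.n)
    (hmu : F.strands.mu k = F.strands.mu (k + 1) + 1) (hc : ε (.c s i i) = 0)
    (hb : ∀ a l, 2 ≤ l → ε (.b s i a l) = 0)
    (hβ : FreeAlgebra.lift K ε (F.g k (k + 1)) * ε (.b s i 1 1) = -1) :
    NilSquare (F.rightCusp k s i).strands ((F.rightCusp k s i).mat ε) := by
  refine H.rightCusp (β := ε (.b s i 1 1)) hk hmu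
    (by rwa [mat, if_pos (by omega)]) ?_
  intro P Q
  have hzero : ∀ P Q, Q ≤ P → F.mat ε P Q = 0 := fun P Q h => H.zero_of_le h
  have hbig : ∀ P Q, F.strands.n ≤ Q → F.mat ε P Q = 0 := fun P Q h => if_neg (by omega)
  have hval : ∀ P Q, P < Q → Q < F.strands.n →
      F.mat ε P Q = FreeAlgebra.lift K ε (F.g P Q) := fun P Q h h' => if_pos ⟨h, h'⟩
  by_cases hPQ : P < Q ∧ Q < F.strands.n - 2
  · rw [mat, if_pos (by exact hPQ)]
    obtain ⟨hPQ, hQ⟩ := hPQ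
    by_cases hP : P < k
    · have hP' : skip k P = P := by rw [skip, if_pos hP]
      by_cases hQk : Q < k
      · have hQ' : skip k Q = Q := by rw [skip, if_pos hQk]
        rw [hP', hQ', hval _ _ hPQ (by omega), hzero k Q (by omega)]
        have : ¬ k ≤ Q := by omega
        simp [FrontState.rightCusp, this, hP, hQk]
      · have hQ' : skip k Q = Q + 2 := by rw [skip, if_neg hQk]
        rw [hP', hQ', hval _ _ (by omega) (by omega), hval _ _ (by omega) (by omega),
          hval _ _ (by omega) (by omega)]
        have : k ≤ Q := by omega
        simp [FrontState.rightCusp, this, hP, hc, hb]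
    · have hP' : skip k P = P + 2 := by rw [skip, if_neg hP]
      have hQ' : skip k Q = Q + 2 := by rw [skip, if_neg (by omega)]
      rw [hP', hQ', hval _ _ (by omega) (by omega), hzero (P + 2) (k + 1) (by omega)]
      have : ¬ Q < k := by omega
      simp [FrontState.rightCusp, hP, this]
  · rw [mat, if_neg (by exact hPQ)]
    by_cases hQ : F.strands.n ≤ skip k Q
    · rw [hbig _ _ hQ, hbig _ _ hQ]
      simp
    · have hQP : Q ≤ P := by
        unfold skip at hQ
        split_ifs at hQ <;> omega
      have h₁ : skip k Q ≤ skip k P := by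
        unfold skip
        split_ifs <;> omega
      rw [hzero _ _ h₁]
      by_cases hP : P < k
      · rw [hzero k (skip k Q) (by rw [skip, if_pos (by omega)]; omega)]
        simp
      · rw [hzero (skip k P) (k + 1) (by rw [skip, if_neg hP]; omega)]
        simp

lemma mat_vertex {n p i : ℕ} (H : NilSquare F.strands (F.mat ε)) (hn : n ≤ F.strands.n) :
    NilSquare (F.vertex n p i).strands ((F.vertex n p i).mat ε) := by
  refine H.vertex hn fun P Q => ?_
  have e : (P < Q ∧ Q < F.strands.n - n) ↔ (P + n < Q + n ∧ Q + n < F.strands.n) := by omega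
  simp only [mat, FrontState.vertex, e]

end FrontState

namespace NormalFront

variable {T : NormalFront}

/-! ## Augmentations of a front -/

lemma mem_gens_ce_of_named {s : ℕ} {σ : Slice} {z : Gen} (h : T.slices[s]? = some σ)
    (hz : ∀ F : FrontState K, z ∈ (F.step (σ.named s)).gens) : z ∈ (T.ce K 1).gens :=
  FrontState.mem_gens_foldl_of_mem (mem_copies h (by simp [Slice.copies_one])) hz

variable (K) in
lemma stateAt_one_succ {s : ℕ} {σ : Slice} (h : T.slices[s]? = some σ) :
    T.stateAt K (s + 1) 1 = (T.stateAt K s 1).step (σ.named s) := by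
  rw [stateAt_succ K h, Slice.copies_one, List.foldl_cons, List.foldl_nil]

variable (K) in
lemma ce_one_eq {s : ℕ} {σ : Slice} {z : Gen} (h : T.slices[s]? = some σ)
    (hz : z.slot = some (s + 1)) :
    (T.ce K 1).dif z = ((T.stateAt K s 1).step (σ.named s)).dif z ∧
      (T.ce K 1).deg z = ((T.stateAt K s 1).step (σ.named s)).deg z := by
  rw [← stateAt_one_succ K h]
  exact ce_of_slot_le hz le_rfl (List.getElem?_eq_some_iff.1 h).1

/-- This makes every augmentation vanish on the basepoint generators of length at least two. -/
lemma internalDeg_two_pos {a l : ℕ} (hl : 2 ≤ l) :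
    0 < internalDeg 2 (fun h => if h = 0 then 1 else 0) a l := by
  simp only [internalDeg]
  split_ifs <;> omega

namespace IsAugmentation

variable {ε : Gen → K}

/-- The kink gives b_{1,1} = −g after augmentation, and ∂b_{1,2} = 1 − b_{1,1} b_{2,1} makes b_{2,1}
inverse to b_{1,1}. The other values vanish for degree reasons. -/
lemma rightCusp (H : T.IsAugmentation K ε) {s k : ℕ} (h : T.slices[s]? = some (.rightCusp k)) :
    ε (.c s 0 0) = 0 ∧ (∀ a l, 2 ≤ l → ε (.b s 0 a l) = 0) ∧
      FreeAlgebra.lift K ε ((T.stateAt K s 1).g k (k + 1)) * ε (.b s 0 1 1) = -1 := by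
  have hb : ∀ a l, 2 ≤ l → ε (.b s 0 a l) = 0 := by
    intro a l hl
    by_contra hne
    have h₁ := (H.1 _ hne).2
    rw [(ce_one_eq K h rfl).2] at h₁
    have h₂ := internalDeg_two_pos (a := a) hl
    simp only [FrontState.step, Slice.named, FrontState.rightCusp, and_self, if_true] at h₁
    omega
  refine ⟨?_, hb, ?_⟩
  · by_contra hne
    have h₁ := (H.1 _ hne).2
    rw [(ce_one_eq K h rfl).2] at h₁
    simp [FrontState.step, Slice.named, FrontState.rightCusp] at h₁
  · have hc := H.2 (.c s 0 0) (mem_gens_ce_of_named h fun F => .inl (.inl rfl))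
    have hb₂ := H.2 (.b s 0 0 2)
      (mem_gens_ce_of_named h fun F => .inr ⟨0, 2, rfl, by omega, by omega⟩)
    rw [(ce_one_eq K h rfl).1] at hc hb₂
    have hI : Finset.Ioo 0 2 = {1} := rfl
    simp only [FrontState.step, Slice.named, FrontState.rightCusp, if_true, map_add,
      FreeAlgebra.lift_ι_apply, and_self, internalDif, internalDeg, hI, Finset.sum_singleton,
      map_one, map_smul, map_mul] at hc hb₂
    simp [sg] at hb₂
    linear_combination ε (.b s 0 1 1) * hc + hb₂

lemma crossing (H : T.IsAugmentation K ε) {s k : ℕ} (h : T.slices[s]? = some (.crossing k)) :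
    FreeAlgebra.lift K ε ((T.stateAt K s 1).g k (k + 1)) = 0 ∧ (ε (.c s 0 0) ≠ 0 →
      (T.stateAt K s 1).strands.mu k - (T.stateAt K s 1).strands.mu (k + 1) = 0) := by
  constructor
  · have hc := H.2 (.c s 0 0) (mem_gens_ce_of_named h fun F => .inl rfl)
    rw [(ce_one_eq K h rfl).1] at hc
    simpa [FrontState.step, Slice.named, FrontState.cross] using hc
  · intro hne
    have h₁ := (H.1 _ hne).2
    rw [(ce_one_eq K h rfl).2] at h₁
    simpa [FrontState.step, Slice.named, FrontState.cross] using h₁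

/-- Nonzero values occur only at potential difference one, so all signs in the augmented border
differential equal `-1` and its vanishing says that the matrix has square zero. -/
lemma nilSquare_init (H : T.IsAugmentation K ε) :
    NilSquare (FrontState.init K T.left 1).strands ((FrontState.init K T.left 1).mat ε) := by
  have hval : ∀ P Q, (FrontState.init K T.left 1).mat ε P Q =
      if P < Q ∧ Q < T.left.n then ε (.k P Q 0 0) else 0 := by
    intro P Q
    simp only [FrontState.mat, FrontState.init, mul_one]
    split_ifs <;> simp [Gen.border, Nat.mod_one]
  have hup : ∀ P Q, (FrontState.init K T.left 1).mat ε P Q ≠ 0 →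
      P < Q ∧ Q < T.left.n ∧ T.left.mu P - T.left.mu Q = 1 := by
    intro P Q hPQ
    rw [hval] at hPQ
    split_ifs at hPQ with h
    · refine ⟨h.1, h.2, ?_⟩
      have h₁ := (H.1 _ hPQ).2
      rw [(ce_of_slot_le (T := T) (s := 0) rfl le_rfl (Nat.zero_le _)).2, stateAt_zero] at h₁
      simp only [FrontState.init] at h₁
      omega
    · simp at hPQ
  constructor
  · simpa [FrontState.init] using hup
  · intro P Q
    rw [show (FrontState.init K T.left 1).strands.n = T.left.n from mul_one _]
    by_cases hPQ : P < Q ∧ Q < T.left.n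
    · have h₁ := H.2 (.k P Q 0 0) (init_gens_subset K T 1
        ⟨P, Q, 0, 0, rfl, zero_lt_one, zero_lt_one, hPQ.2, by omega⟩)
      rw [(ce_of_slot_le (T := T) (s := 0) rfl le_rfl (Nat.zero_le _)).1, stateAt_zero] at h₁
      simp only [FrontState.init, mul_one, add_zero, map_sum, map_smul, map_mul, Gen.border,
        Nat.div_one, Nat.mod_one, FreeAlgebra.lift_ι_apply] at h₁
      rw [← Finset.sum_subset (s₁ := Finset.Ioo P Q)]
      · rw [← neg_eq_zero, ← Finset.sum_neg_distrib, ← h₁]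
        refine Finset.sum_congr rfl fun R hR => ?_
        rw [Finset.mem_Ioo] at hR
        have hR' := hup P R
        rw [hval, hval, if_pos ⟨hR.1, by omega⟩, if_pos ⟨hR.2, hPQ.2⟩]
        rw [hval, if_pos ⟨hR.1, by omega⟩] at hR'
        by_cases h : ε (.k P R 0 0) = 0
        · simp [h]
        · rw [(hR' h).2.2]
          simp [sg]
      · intro R hR
        rw [Finset.mem_Ioo] at hR
        rw [Finset.mem_range]
        omega
      · intro R _ hR
        by_contra h
        have h₂ := hup P R (left_ne_zero_of_mul h)
        have h₃ := hup R Q (right_ne_zero_of_mul h)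
        exact hR (Finset.mem_Ioo.2 ⟨h₂.1, h₃.1⟩)
    · refine Finset.sum_eq_zero fun R _ => ?_
      by_contra h
      have h₂ := hup P R (left_ne_zero_of_mul h)
      have h₃ := hup R Q (right_ne_zero_of_mul h)
      omega

lemma nilSquare_stateAt (H : T.IsAugmentation K ε) {s : ℕ} (hs : s ≤ T.slices.length) :
    NilSquare (T.stateAt K s 1).strands ((T.stateAt K s 1).mat ε) := by
  induction s with
  | zero => simpa using H.nilSquare_init
  | succ s ih =>
    have ih := ih (by omega)
    have hσ : T.slices[s]? = some T.slices[s] := List.getElem?_eq_getElem _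
    generalize T.slices[s] = σ at hσ
    have hf := T.fit.fits hσ
    rw [← strands_stateAt_one (K := K) (by omega)] at hf
    rw [stateAt_one_succ K hσ]
    cases σ with
    | leftCusp k d => exact FrontState.mat_leftCusp ih hf
    | crossing k =>
      obtain ⟨h₁, h₂⟩ := H.crossing hσ
      exact FrontState.mat_cross ih hf h₁ h₂
    | rightCusp k =>
      obtain ⟨h₁, h₂, h₃⟩ := H.rightCusp hσ
      exact FrontState.mat_rightCusp ih hf.1 hf.2 h₁ h₂ h₃

end IsAugmentation

lemma nilSquare_vertices {ε : Gen → K} {F : FrontState K} {l : List ℕ} (p : ℕ)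
    (H : NilSquare F.strands (F.mat ε)) (hl : l.sum ≤ F.strands.n) :
    let F' := ((l.zipIdx p).flatMap fun v => LegendrianGraph.vertexCopies 1 v.1 v.2).foldl
      FrontState.step F
    NilSquare F'.strands (F'.mat ε) ∧
      F'.strands = ⟨F.strands.n - l.sum, fun x => F.strands.mu (l.sum + x)⟩ := by
  induction l generalizing F p with
  | nil => exact ⟨H, by simp⟩
  | cons n l ih =>
    rw [List.sum_cons] at hl
    simp only [List.zipIdx_cons, List.flatMap_cons, vertexCopies_one, List.foldl_append,
      List.foldl_cons, List.foldl_nil, FrontState.step]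
    have := ih (F := F.vertex n p 0) (p + 1) (FrontState.mat_vertex H (by omega))
      (by simp only [FrontState.vertex]; omega)
    simp only [vertexCopies_one] at this
    refine ⟨this.1, this.2.trans ?_⟩
    simp only [FrontState.vertex, List.sum_cons, Strands.mk.injEq]
    exact ⟨by omega, funext fun x => congrArg _ (by omega)⟩

/-- An augmentation takes the half disks at the right border to a matrix of square zero. -/
lemma IsAugmentation.nilSquare {ε : Gen → K} (H : T.IsAugmentation K ε) :
    NilSquare (T.state K 1).strands ((T.state K 1).mat ε) ∧
      (T.state K 1).strands = T.rightBorder.left := by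
  have h := T.vals_le
  have hs := strands_stateAt_one (K := K) (T := T) le_rfl
  rw [List.take_length] at hs
  have := nilSquare_vertices 0 (H.nilSquare_stateAt le_rfl) (l := T.vals) (by rw [hs]; exact h)
  rw [state_eq]
  refine ⟨this.1, this.2.trans ?_⟩
  rw [hs]
  rfl

/-- On entries of potential difference one the sign in φ_R is `-1`, so the pulled back values form
minus the half disk matrix. The augmentation equation is then the vanishing of its square. -/
lemma rightBorder_isAugmentation {ε : Gen → K} (H : T.IsAugmentation K ε) :
    T.rightBorder.IsAugmentation K (T.pullback K T.rightBorder (T.phiRight K 1) ε) := by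
  obtain ⟨hM, hS⟩ := H.nilSquare
  have hgens : ∀ a b i j, Gen.k a b i j ∈ (T.rightBorder.ce K 1).gens ↔
      a < b ∧ b < T.rightBorder.left.n ∧ i = 0 ∧ j = 0 := by
    intro a b i j
    constructor
    · rintro ⟨a', b', i', j', h, h₁, h₂, h₃, h₄⟩
      cases h
      exact ⟨by omega, h₃, by omega, by omega⟩
    · rintro ⟨h₁, h₂, rfl, rfl⟩
      exact ⟨a, b, 0, 0, rfl, zero_lt_one, zero_lt_one, h₂, by omega⟩
  have hpb : ∀ a b, a < b → b < T.rightBorder.left.n →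
      T.pullback K T.rightBorder (T.phiRight K 1) ε (.k a b 0 0) =
        - (T.state K 1).mat ε a b := by
    intro a b hab hb
    rw [pullback, if_pos ((hgens _ _ _ _).2 ⟨hab, hb, rfl, rfl⟩)]
    have hv : (T.state K 1).mat ε a b = FreeAlgebra.lift K ε ((T.state K 1).g a b) :=
      if_pos ⟨hab, by rwa [hS]⟩
    simp only [phiRight, mul_one, add_zero, map_smul, ← hv]
    by_cases h : (T.state K 1).mat ε a b = 0
    · simp [h]
    · rw [(hM.upper _ _ h).2.2]
      simp [sg]
  have hz : ∀ z ∈ (T.rightBorder.ce K 1).gens,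
      ∃ a b, z = .k a b 0 0 ∧ a < b ∧ b < T.rightBorder.left.n := by
    rintro _ ⟨a, b, i, j, rfl, h₁, h₂, h₃, h₄⟩
    exact ⟨a, b, by rw [show i = 0 by omega, show j = 0 by omega], by omega, h₃⟩
  constructor
  · intro z hne
    have hzg : z ∈ (T.rightBorder.ce K 1).gens := by
      by_contra h
      exact hne (if_neg h)
    refine ⟨hzg, ?_⟩
    obtain ⟨a, b, rfl, hab, hb⟩ := hz z hzg
    rw [hpb a b hab hb] at hne
    have := (hM.upper a b (neg_ne_zero.1 hne)).2.2
    rw [hS] at this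
    change T.rightBorder.left.mu a - T.rightBorder.left.mu b - 1 = 0
    omega
  · intro z hzg
    obtain ⟨a, b, rfl, hab, hb⟩ := hz z hzg
    change FreeAlgebra.lift K _ ((FrontState.init K T.rightBorder.left 1).dif _) = 0
    simp only [FrontState.init, mul_one, add_zero, map_sum, map_smul, map_mul, Gen.border,
        Nat.div_one, Nat.mod_one, FreeAlgebra.lift_ι_apply]
    have hsq := hM.sq a b
    rw [hS] at hsq
    have hsub : ∑ R ∈ Finset.Ioo a b, (T.state K 1).mat ε a R * (T.state K 1).mat ε R b =
        ∑ R ∈ Finset.range T.rightBorder.left.n,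
          (T.state K 1).mat ε a R * (T.state K 1).mat ε R b := by
      refine Finset.sum_subset (fun R hR => ?_) fun R _ hR => ?_
      · rw [Finset.mem_Ioo] at hR
        rw [Finset.mem_range]
        omega
      · by_contra h
        have h₂ := hM.upper a R (left_ne_zero_of_mul h)
        have h₃ := hM.upper R b (right_ne_zero_of_mul h)
        exact hR (Finset.mem_Ioo.2 ⟨h₂.1, h₃.1⟩)
    rw [← neg_eq_zero, ← hsq, ← hsub, ← Finset.sum_neg_distrib]
    refine Finset.sum_congr rfl fun R hR => ?_
    rw [Finset.mem_Ioo] at hR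
    rw [hpb _ _ hR.1 (by omega), hpb _ _ hR.2 hb]
    by_cases h : (T.state K 1).mat ε a R = 0
    · simp [h]
    · have := (hM.upper _ _ h).2.2
      rw [hS] at this
      rw [this]
      simp [sg]

/-- The border chords generate a sub-DGA, whose differential no later slice changes. -/
lemma leftBorder_isAugmentation {ε : Gen → K} (H : T.IsAugmentation K ε) :
    T.leftBorder.IsAugmentation K (T.pullback K T.leftBorder (T.phiLeft K 1) ε) := by
  have hz : ∀ z ∈ (T.leftBorder.ce K 1).gens,
      T.pullback K T.leftBorder (T.phiLeft K 1) ε z = ε z := by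
    intro z hz
    rw [pullback, if_pos hz, phiLeft, FreeAlgebra.lift_ι_apply]
  have hce : ∀ z ∈ (T.leftBorder.ce K 1).gens, z ∈ (T.ce K 1).gens ∧
      (T.leftBorder.ce K 1).dif z = (T.ce K 1).dif z ∧
      (T.leftBorder.ce K 1).deg z = (T.ce K 1).deg z := by
    intro z hz
    refine ⟨init_gens_subset K T 1 hz, ?_⟩
    obtain ⟨a, b, i, j, rfl, -⟩ := hz
    have := ce_of_slot_le (T := T) (K := K) (m := 1) (z := .k a b i j) (s := 0) rfl le_rfl
      (Nat.zero_le _)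
    rw [stateAt_zero] at this
    exact ⟨this.1.symm, this.2.symm⟩
  constructor
  · intro z hne
    have hzg : z ∈ (T.leftBorder.ce K 1).gens := by
      by_contra h
      exact hne (if_neg h)
    rw [hz z hzg] at hne
    exact ⟨hzg, (hce z hzg).2.2.trans (H.1 z hne).2⟩
  · intro z hzg
    rw [← H.2 z (hce z hzg).1, ← (hce z hzg).2.1]
    obtain ⟨a, b, i, j, rfl, h₁, h₂, h₃, h₄⟩ := hzg
    change FreeAlgebra.lift K _ ((FrontState.init K T.left 1).dif _) =
      FreeAlgebra.lift K _ ((FrontState.init K T.left 1).dif _)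
    simp only [FrontState.init, map_sum, map_smul, map_mul, FreeAlgebra.lift_ι_apply]
    refine Finset.sum_congr rfl fun R hR => ?_
    rw [Finset.mem_Ioo] at hR
    have hmem : ∀ P Q, P < Q → Q < T.leftBorder.left.n →
        Gen.border 1 P Q ∈ (T.leftBorder.ce K 1).gens := fun P Q hPQ hQ =>
      ⟨P / 1, Q / 1, P % 1, Q % 1, rfl, by omega, by omega, by omega, by omega⟩
    rw [hz _ (hmem _ R hR.1 (by omega)), hz _ (hmem R _ hR.2 (by omega))]

end NormalFront

namespace NormalFront

variable {T : NormalFront}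

/-! ## Half disks at the right border -/

lemma tracks_vertices {m p : ℕ} {l : List ℕ} {L : List Label} {F : FrontState K} (q : ℕ)
    (hL : L.Nodup) (hl : l.sum ≤ L.length) (H : Tracks F (blocks L m) (Unital N p)) :
    Tracks (((l.zipIdx q).flatMap fun v => LegendrianGraph.vertexCopies m v.1 v.2).foldl
      FrontState.step F) (blocks (L.drop l.sum) m) (Unital N p) := by
  induction l generalizing F L q with
  | nil => simpa using H
  | cons n l ih =>
    rw [List.sum_cons] at hl
    have hn : (L.take n).length = n := by simp; omega
    rw [← List.take_append_drop n L] at H hL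
    have h₁ := Tracks.vertexCopies (q := q) hL H
    rw [hn] at h₁
    simpa [← List.drop_drop] using
      ih (q + 1) (hL.sublist (List.sublist_append_right _ _)) (by simp; omega) h₁

/-- The labels of the strands of the right border. -/
def rightLabels (T : NormalFront) : List Label := (T.labels T.slices.length).drop T.vals.sum

variable (T) in
lemma length_labels : (Slice.actAll T.slices T.left).n = (T.labels T.slices.length).length := by
  -- The statement involves no field, so any one will do.
  have := ((T.blockState ℚ le_rfl).strands le_rfl).1
  rwa [List.take_length] at this

variable (T) in
lemma length_rightLabels : T.rightLabels.length = T.rightBorder.left.n := by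
  rw [rightLabels, List.length_drop, ← T.length_labels]
  rfl

variable (K T) in
lemma tracks_state {m p : ℕ} (hN : T.Vanishing N m) :
    Tracks (T.state K m) (blocks T.rightLabels m) (Unital N p) := by
  have H := T.blockState K le_rfl
  rw [state_eq]
  exact tracks_vertices 0 H.nodup (T.length_labels ▸ T.vals_le) (H.tracks N p m hN)

/-! ## Values of pairings -/

lemma row_eq_zero {z : Gen} (h : z ∈ T.chords K) : z.row = 0 := h.2.1

lemma col_eq_one {z : Gen} (h : z ∈ T.chords K) : z.col = 1 := h.2.2

lemma move_zero_one {z : Gen} (h : z ∈ T.chords K) : z.move 0 1 = z :=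
  Gen.relabel_id (by simp [row_eq_zero h]) (by simp [col_eq_one h])

lemma homDeg_edge {z : Gen} (h : z ∈ T.chords K) (hE : z.IsEdge) : T.homDeg K z = 0 := by
  have := (ce_edge h hE (m := 2) zero_lt_one one_lt_two).1
  rw [move_zero_one h] at this
  rw [homDeg, this]
  norm_num

lemma negY_edge {s : T.chords K} (hE : s.1.IsEdge) : T.negY K s = -1 := by
  obtain ⟨s, h⟩ := s
  cases s <;> simp_all [negY, Gen.IsEdge]

lemma negY_of_not_edge {s : T.chords K} (hE : ¬ s.1.IsEdge) : T.negY K s = 0 := by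
  obtain ⟨s, h⟩ := s
  cases s <;> simp_all [negY, Gen.IsEdge]

lemma evalHom_mk {z : Gen} (h : z ∈ T.chords K) (a : T.Hom K) : T.evalHom K a z = a ⟨z, h⟩ := by
  simp [evalHom, h]

lemma evalHom_negY {z : Gen} (h : z ∈ T.chords K) (hE : z.IsEdge) :
    T.evalHom K (T.negY K) z = -1 := by
  rw [evalHom_mk h, negY_edge hE]

lemma pairWord_one (a : Fin 1 → T.Hom K) {z : Gen} (h : z ∈ T.chords K) :
    T.pairWord K a [z.move 0 1] = T.evalHom K (a 0) z := by
  have hr := row_eq_zero h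
  have hc := col_eq_one h
  have hz : z.relabel (fun i => i) = z := Gen.relabel_id rfl rfl
  rw [move_zero_one h]
  simp [pairWord, hr, hc, hz, sigma, sg]

lemma pairWord_two (a : Fin 2 → T.Hom K) {y z : Gen} (hy : y ∈ T.chords K) (hz : z ∈ T.chords K) :
    T.pairWord K a [y.move 0 1, z.move 1 2] =
      sg K (1 + T.homDeg K y * T.homDeg K z + T.homDeg K y) *
        (T.evalHom K (a 0) y * T.evalHom K (a 1) z) := by
  have hr := Gen.row_move (row_eq_zero hz) 1 2
  have hc := Gen.col_move (col_eq_one hz) 1 2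
  have hy' : y.relabel (fun i => i) = y := Gen.relabel_id rfl rfl
  have hz' : (z.move 1 2).relabel (fun i => i - 1) = z := by
    rw [Gen.move, Gen.relabel_relabel]
    exact Gen.relabel_id (by simp [row_eq_zero hz]) (by simp [col_eq_one hz])
  have hI : Finset.Ioi (0 : Fin 2) = {1} := by decide
  have hI' : Finset.Ioi (1 : Fin 2) = ∅ := by decide
  rw [move_zero_one hy]
  simp [pairWord, Fin.forall_fin_two, row_eq_zero hy, col_eq_one hy, hr, hc, hy', hz', sigma,
    Fin.sum_univ_two, hI, hI']

section

variable {k : ℕ} {a : Fin k → T.Hom K} {e : Fin (k + 1) → Gen → K}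

lemma pairLin_twist_gen {x : Gen} (hx : x.row ≠ x.col) :
    T.pairLin a (twist K e (gen x)) = T.pairWord K a [x] := by
  rw [twist_gen_of_ne hx, ← monomial_singleton, pairLin_monomial]

lemma pairLin_twist_gen_mul {x y : Gen} (hx : x.row ≠ x.col) (hy : y.row ≠ y.col) :
    T.pairLin a (twist K e (gen x * gen y)) = T.pairWord K a [x, y] := by
  rw [map_mul, twist_gen_of_ne hx, twist_gen_of_ne hy, ← monomial_pair, pairLin_monomial]

/-- Since the pairing is blind to `reduce`, the congruence for the differential becomes an equality
of pairings. -/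
lemma ChordDif.pairLin {p : Fin k} (hp : a p = T.negY K)
    (hN : ∀ z ∈ N, z.row = z.col ∧ diagonalAug K e z = 0) {x x' z : Gen} {d : ℤ} {i j : ℕ}
    {v : FreeAlgebra K Gen} (h : ChordDif N p x x' z d i j v) (hi : i ≤ p) (hj : (p : ℕ) < j) :
    T.pairLin a (twist K e v) =
      (if i = p then T.pairLin a (twist K e (gen (x.move p (p + 1)) * gen (z.move (p + 1) j)))
        else 0) -
      if j = p + 1 then
        sg K d * T.pairLin a (twist K e (gen (z.move i p) * gen (x'.move p (p + 1)))) else 0 := by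
  rw [← T.pairLin_twist_reduce a hp hN, h hi hj, map_sub, map_sub]
  congr 1
  · by_cases h : i = p <;> simp only [h, onlyIf_true, onlyIf_false, if_true, if_false, map_zero,
      T.pairLin_twist_reduce a hp hN]
  · by_cases h : j = p + 1 <;> simp only [h, onlyIf_true, onlyIf_false, if_true, if_false, map_zero,
      map_smul, smul_eq_mul, T.pairLin_twist_reduce a hp hN]

end

/-- The generators with both ends on the same copy on which the diagonal augmentation vanishes. -/
def diagonalZeros {k : ℕ} (e : Fin (k + 1) → Gen → K) : Set Gen :=
  {z | z.row = z.col ∧ diagonalAug K e z = 0}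

/-- Augmentations vanish on kinks and on longer basepoint generators, as their degrees are nonzero.
Thus the invariant `Unital` is available for the `N` given by the objects `e`. -/
lemma vanishing_diagonalZeros {k : ℕ} (e : Fin (k + 1) → T.Ob K) :
    T.Vanishing (diagonalZeros fun i => (e i).1) (k + 1) := by
  intro s j hs i hi
  obtain ⟨h₁, h₂, -⟩ := (e ⟨i, hi⟩).2.rightCusp hs
  refine ⟨⟨rfl, ?_⟩, fun a l hl => ⟨rfl, ?_⟩⟩
  · simp [diagonalAug, Gen.row, Gen.col, hi, Gen.relabel, h₁]
  · simp [diagonalAug, Gen.row, Gen.col, hi, Gen.relabel, h₂ a l hl]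

/-! ## Strict units -/

lemma row_move_ne {z : Gen} (h : z ∈ T.chords K) {i j : ℕ} (hij : i ≠ j) :
    (z.move i j).row ≠ (z.move i j).col := by
  rwa [Gen.row_move (row_eq_zero h), Gen.col_move (col_eq_one h)]

/-- For `p = 0` only the term starting with an edge generator survives. The sign `-1` of the pairing
cancels the value `-1` of the unit. -/
lemma m_two_left (ε₀ ε₁ : T.Ob K) (a : T.Hom K) : T.m K ![ε₀, ε₀, ε₁] ![T.negY K, a] = a := by
  funext ⟨s, hs⟩
  rw [m, ← pairLin_apply]
  by_cases hE : s.IsEdge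
  · rw [(ce_edge hs hE (m := 3) (i := 0) (j := 2) (by omega) (by omega)).2,
      show Finset.Ioo 0 2 = {1} from rfl, Finset.sum_singleton,
      pairLin_twist_gen_mul (row_move_ne hs (by omega)) (row_move_ne hs (by omega)),
      pairWord_two _ hs hs]
    simp [homDeg_edge hs hE, evalHom_negY hs hE, evalHom_mk hs, sg]
  · obtain ⟨x, hx, hxE, x', hx', hxE', d, h⟩ := ce_chord hs hE
    have h₂ := (h 3 0 2 (by omega) (by omega)).2 _ 0 (vanishing_diagonalZeros ![ε₀, ε₀, ε₁])
    rw [ChordDif.pairLin (a := ![T.negY K, a]) (p := 0) rfl (fun z hz => hz) h₂ le_rfl (by simp)]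
    simp only [Fin.val_zero, if_true, zero_add, show ¬ (2 : ℕ) = 1 by omega, if_false, sub_zero]
    rw [pairLin_twist_gen_mul (row_move_ne hx (by omega)) (row_move_ne hs (by omega)),
      pairWord_two _ hx hs]
    simp [homDeg_edge hx hxE, evalHom_negY hx hxE, evalHom_mk hs, sg]

/-- For `p = 1` only the term ending with an edge generator survives, with coefficient −(−1)^{|s|}.
The pairing contributes (−1)^{|s|} and the unit `-1`. -/
lemma m_two_right (ε₀ ε₁ : T.Ob K) (a : T.Hom K) : T.m K ![ε₀, ε₁, ε₁] ![a, T.negY K] = a := by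
  funext ⟨s, hs⟩
  rw [m, ← pairLin_apply]
  by_cases hE : s.IsEdge
  · rw [(ce_edge hs hE (m := 3) (i := 0) (j := 2) (by omega) (by omega)).2,
      show Finset.Ioo 0 2 = {1} from rfl, Finset.sum_singleton,
      pairLin_twist_gen_mul (row_move_ne hs (by omega)) (row_move_ne hs (by omega)),
      pairWord_two _ hs hs]
    simp [homDeg_edge hs hE, evalHom_negY hs hE, evalHom_mk hs, sg]
  · obtain ⟨x, hx, hxE, x', hx', hxE', d, h⟩ := ce_chord hs hE
    have h₂ := (h 3 0 2 (by omega) (by omega)).2 _ 1 (vanishing_diagonalZeros ![ε₀, ε₁, ε₁])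
    have hd := (h 2 0 1 (by omega) (by omega)).1
    rw [move_zero_one hs] at hd
    rw [ChordDif.pairLin (a := ![a, T.negY K]) (p := 1) rfl (fun z hz => hz) h₂ (by simp)
      (by simp)]
    simp only [Fin.val_one, if_true, show ¬ (0 : ℕ) = 1 by omega, if_false, zero_sub]
    rw [pairLin_twist_gen_mul (row_move_ne hs (by omega)) (row_move_ne hx' (by omega)),
      pairWord_two _ hs hx']
    rw [homDeg_edge hx' hxE', homDeg, hd]
    simp only [sg, evalHom_mk hs, evalHom_negY hx' hxE', Matrix.cons_val_zero, Matrix.cons_val_one]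
    by_cases hd : Even d <;> simp [hd, parity_simps]

/-- Both terms survive, each shortened to its edge letter by the augmentation of the other factor.
The two values agree because both copies carry the same augmentation, and they cancel. -/
lemma m_one {e : Fin 2 → T.Ob K} (a : Fin 1 → T.Hom K) (he : e 0 = e 1) (ha : a 0 = T.negY K) :
    T.m K e a = 0 := by
  funext ⟨s, hs⟩
  rw [m, ← pairLin_apply]
  by_cases hE : s.IsEdge
  · rw [(ce_edge hs hE (m := 2) (i := 0) (j := 1) (by omega) (by omega)).2,
      show Finset.Ioo 0 1 = ∅ from rfl]
    simp
  · obtain ⟨x, hx, hxE, x', hx', hxE', d, h⟩ := ce_chord hs hE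
    have h₂ := (h 2 0 1 (by omega) (by omega)).2 _ 0 (vanishing_diagonalZeros e)
    have hd := (h 1 0 0 (by omega) (by omega)).1
    have hmove : ∀ i, (s.move i i).relabel (fun _ => 0) = s.move 0 0 := by
      intro i
      cases s <;> simp [Gen.move, Gen.relabel]
    -- An augmentation is zero outside degree `0`, where the sign is `1`.
    have hε : sg K d * (e 0).1 (s.move 0 0) = (e 0).1 (s.move 0 0) := by
      by_cases h₀ : (e 0).1 (s.move 0 0) = 0
      · simp [h₀]
      · have := ((e 0).2.1 _ h₀).2
        rw [← hd, this]
        simp [sg]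
    have hrow := fun i => Gen.row_move (row_eq_zero hs) i i
    have hcol := fun i => Gen.col_move (col_eq_one hs) i i
    have h0 : diagonalAug K (fun i => (e i).1) (s.move 0 0) = (e 0).1 (s.move 0 0) := by
      simp [diagonalAug, hrow, hcol, hmove]
    have h1 : diagonalAug K (fun i => (e i).1) (s.move 1 1) = (e 0).1 (s.move 0 0) := by
      simp [diagonalAug, hrow, hcol, hmove, he]
    have hw : ∀ y z : Gen, T.pairLin a (gen y * gen z) = 0 := by
      intro y z
      rw [← monomial_pair, pairLin_monomial, pairWord_of_length_ne _ _ (by simp)]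
    have hx₁ : ∀ y ∈ T.chords K, y.IsEdge → T.pairLin a (gen (y.move 0 1)) = -1 := by
      intro y hy hyE
      rw [← monomial_singleton, pairLin_monomial, pairWord_one a hy, ha, evalHom_negY hy hyE]
    rw [ChordDif.pairLin (p := 0) ha (fun z hz => hz) h₂ le_rfl (by simp)]
    simp only [Fin.val_zero, if_true, zero_add, map_mul,
      twist_gen_of_ne (row_move_ne hx zero_ne_one), twist_gen_of_ne (row_move_ne hx' zero_ne_one),
      twist_gen, h0, h1, mul_add, add_mul, map_add, hw, ← Algebra.commutes, ← Algebra.smul_def,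
      map_smul, hx₁ x hx hxE, hx₁ x' hx' hxE', smul_eq_mul, Pi.zero_apply]
    linear_combination hε

/-- All surviving terms are products of two letters between different copies. The twist does not
change them, and they are too short to meet `k` arguments. -/
lemma m_of_two_lt {k : ℕ} (hk : 2 < k) (e : Fin (k + 1) → T.Ob K) (a : Fin k → T.Hom K)
    (p : Fin k) (ha : a p = T.negY K) : T.m K e a = 0 := by
  funext ⟨s, hs⟩
  have hp := p.2
  rw [m, ← pairLin_apply]
  by_cases hE : s.IsEdge
  · rw [(ce_edge hs hE (m := k + 1) (i := 0) (j := k) (by omega) (by omega)).2, map_sum, map_sum]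
    refine Finset.sum_eq_zero fun t ht => ?_
    rw [Finset.mem_Ioo] at ht
    rw [pairLin_twist_gen_mul (row_move_ne hs (by omega)) (row_move_ne hs (by omega))]
    exact pairWord_of_length_ne _ _ (by simp; omega)
  · obtain ⟨x, hx, hxE, x', hx', hxE', d, h⟩ := ce_chord hs hE
    have h₂ := (h (k + 1) 0 k (by omega) (by omega)).2 _ p (vanishing_diagonalZeros e)
    rw [ChordDif.pairLin ha (fun z hz => hz) h₂ (by omega) hp]
    have h₁ : ∀ y z : Gen, y.row ≠ y.col → z.row ≠ z.col →
        T.pairLin a (twist K (fun i => (e i).1) (gen y * gen z)) = 0 := by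
      intro y z hy hz
      rw [pairLin_twist_gen_mul hy hz]
      exact pairWord_of_length_ne _ _ (by simp; omega)
    rw [Pi.zero_apply, sub_eq_zero]
    trans 0
    · split_ifs with h₀
      · exact h₁ _ _ (row_move_ne hx (by omega)) (row_move_ne hs (by omega))
      · rfl
    · split_ifs with h₀
      · rw [h₁ _ _ (row_move_ne hs (by omega)) (row_move_ne hx' (by omega)), mul_zero]
      · rfl

variable (K T) in
/-- The augmentation category of a front is strictly unital. -/
theorem isStrictUnit_negY : T.IsStrictUnit K (T.negY K) := by
  refine ⟨fun s hs => ?_, fun ε₀ ε₁ a => ⟨m_two_left ε₀ ε₁ a, m_two_right ε₀ ε₁ a⟩,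
    fun k e a p hk he ha => ?_⟩
  · refine homDeg_edge s.2 ?_
    by_contra hE
    exact hs (negY_of_not_edge hE)
  · rcases lt_or_gt_of_ne hk with h | h
    · have := p.2
      obtain rfl : k = 1 := by omega
      obtain rfl : p = 0 := Subsingleton.elim _ _
      exact m_one a he ha
    · exact m_of_two_lt h e a p ha

/-! ## Border restrictions -/

lemma mem_chords_trivialFront {S : Strands} {z : Gen} (h : z ∈ S.trivialFront.chords K) :
    ∃ a b, a ≤ b ∧ b < S.n ∧ z = .k a b 0 1 := by
  rcases mem_chords h with h | ⟨s, k, d, h, _⟩ | ⟨s, k, h, _⟩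
  · exact h
  · simp [Strands.trivialFront] at h
  · simp [Strands.trivialFront] at h

variable (K T) in
/-- The restriction to the left border preserves units. -/
theorem preservesUnit_leftBorder :
    T.PreservesUnit K T.leftBorder (T.phiLeft K) (T.negY K) (T.leftBorder.negY K) := by
  refine ⟨fun ε => leftBorder_isAugmentation ε.2, fun ε => ?_, fun k e a p hk _ _ => ?_⟩
  all_goals
    funext ⟨s, hs⟩
    obtain ⟨i, j, hij, hj, rfl⟩ := mem_chords_trivialFront hs
    have hs' : Gen.k i j 0 1 ∈ T.chords K := k_mem_chords hij hj
    rw [functorMap, ← pairLin_apply, phiLeft, pairLin_twist_gen (row_move_ne hs' (by omega))]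
  · rw [pairWord_one _ hs', evalHom_mk hs']
    rfl
  · exact pairWord_of_length_ne _ _ (by simp; omega)

variable (K) in
/-- Half disks at the right border, paired with morphisms one of which is the unit. -/
lemma pairLin_phiRight {k : ℕ} (e : Fin (k + 1) → T.Ob K) (a : Fin k → T.Hom K) (p : Fin k)
    (ha : a p = T.negY K) {i j : ℕ} (hij : i ≤ j) (hj : j < T.rightBorder.left.n) :
    T.pairLin a (twist K (fun i => (e i).1) (T.phiRight K (k + 1) (.k i j 0 k))) =
      if i = j ∧ k = 1 then -1 else 0 := by
  have hp := p.2
  have H := T.tracks_state K (p := p) (vanishing_diagonalZeros e)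
  rw [← T.length_rightLabels] at hj
  have hi : T.rightLabels[i]? = some T.rightLabels[i] := List.getElem?_eq_getElem _
  have hj' : T.rightLabels[j]? = some T.rightLabels[j] := List.getElem?_eq_getElem _
  have hPi := getElem?_blocks (m := k + 1) (i := 0) (by omega) hi
  have hPj := getElem?_blocks (m := k + 1) (i := k) (by omega) hj'
  have hlt : i * (k + 1) + 0 < j * (k + 1) + k := by
    have := Nat.mul_le_mul_right (k + 1) hij
    omega
  have hg := H.g _ _ _ _ hlt hPi hPj (Nat.zero_le _) hp
  have hnd : T.rightLabels.Nodup :=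
    (T.blockState K le_rfl).nodup.sublist (List.drop_sublist _ _)
  have hred := T.pairLin_twist_reduce (N := diagonalZeros fun i => (e i).1) a ha fun z hz => hz
  rw [phiRight, ← hred, map_smul, hg]
  -- As the labels are distinct, equal labels mean equal strands. The copies `0` and `k` must be `p`
  -- and `p + 1`, which forces `k = 1`.
  simp only [hnd.getElem_inj_iff]
  by_cases h : i = j ∧ k = 1
  · obtain ⟨rfl, rfl⟩ := h
    obtain rfl : p = 0 := Subsingleton.elim _ _
    have hx : T.rightLabels[i] ∈ T.labels T.slices.length :=
      List.mem_of_mem_drop (List.getElem_mem _)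
    obtain ⟨hx, hxE⟩ := ((T.blockState K le_rfl).edge _ hx).mem_chords (K := K)
    rw [if_pos (by simp), if_pos (by simp), map_smul, map_smul, hred]
    simp only [Fin.val_zero, zero_add]
    rw [pairLin_twist_gen (row_move_ne hx zero_ne_one), pairWord_one _ hx, ha,
      evalHom_negY hx hxE, H.mu _ _ hPi, H.mu _ _ hPj]
    -- Both ends have the same potential, so the sign in φ_R is `1`.
    simp [sg]
  · rw [if_neg (by omega), if_neg h]
    simp

variable (K T) in
/-- The restriction to the right border preserves units. -/
theorem preservesUnit_rightBorder :
    T.PreservesUnit K T.rightBorder (T.phiRight K) (T.negY K) (T.rightBorder.negY K) := by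
  refine ⟨fun ε => rightBorder_isAugmentation ε.2, fun ε => ?_, fun k e a p hk _ ha => ?_⟩
  all_goals
    funext ⟨s, hs⟩
    obtain ⟨i, j, hij, hj, rfl⟩ := mem_chords_trivialFront hs
    rw [functorMap, ← pairLin_apply]
  · refine (pairLin_phiRight K ![ε, ε] ![T.negY K] 0 rfl hij hj).trans ?_
    simp [negY]
  · refine (pairLin_phiRight K e a p ha hij hj).trans ?_
    rw [if_neg (by omega)]
    rfl

end NormalFront

end LegendrianGraph
end

open LegendrianGraph in
/-- The augmentation category of a bordered Legendrian graph in normal form, and those of its left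
and right borders, are strictly unital with unit the negative of the sum of the duals of the
generators `y_e` over all edges, and both border restriction functors preserve the units. -/
theorem mainTheorem4 (K : Type*) [Field K] (T : NormalFront) :
    T.IsStrictUnit K (T.negY K) ∧
    T.leftBorder.IsStrictUnit K (T.leftBorder.negY K) ∧
    T.rightBorder.IsStrictUnit K (T.rightBorder.negY K) ∧
    T.PreservesUnit K T.leftBorder (T.phiLeft K) (T.negY K) (T.leftBorder.negY K) ∧
    T.PreservesUnit K T.rightBorder (T.phiRight K) (T.negY K) (T.rightBorder.negY K) := by
  exact ⟨T.isStrictUnit_negY K, T.leftBorder.isStrictUnit_negY K,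
    T.rightBorder.isStrictUnit_negY K, T.preservesUnit_leftBorder K,
    T.preservesUnit_rightBorder K⟩
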